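/- **Conventions.** $\Omega$ is an algebraically closed field of characteristic zero, $k\subset\Omega$ is a subfield such that $\Omega$ has infinite transcendence degree over $k$, and for a field $k\subset L\subset\Omega$, $A(\Omega/L)$ is the group of automorphisms of $\Omega$ fixing $L$. A variety over a field is a geometrically reduced scheme of finite type over it (not necessarily irreducible). For a variety $V$ over $\Omega$ and $\sigma\in A(\Omega/k)$, $\sigma V$ is the base change of $V$ along $\sigma\colon\Omega\to\Omega$. A map $T(\Omega)\to V(\Omega)$ is regular if it is induced by a morphism $T\to V$ of $\Omega$-varieties. A *moduli problem* $(\mathcal M,\sim)$ over $\Omega$ is a contravariant functor $\mathcal M$ from varieties over $\Omega$ to sets together with equivalence relations $\sim$ on the sets $\mathcal M(T)$ compatible with morphisms; write $\mathcal M(\Omega)=\mathcal M(\operatorname{Spec}\Omega)$, and $m_t=t^*m\in\mathcal M(\Omega)$ for $m\in\mathcal M(T)$, $t\in T(\Omega)$. A *solution* over $\Omega$ is a variety $V$ over $\Omega$ with a bijection $\alpha\colon\mathcal M(\Omega)/{\sim}\to V(\Omega)$ such that (i) for all varieties $T$ over $\Omega$ and $m\in\mathcal M(T)$ the map $t\mapsto\alpha(m_t)\colon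 T(\Omega)\to V(\Omega)$ is regular, and (ii) for every variety $W$ over $\Omega$ and map $\beta\colon\mathcal M(\Omega)/{\sim}\to W(\Omega)$ satisfying the condition analogous to (i), the map $P\mapsto\beta(\alpha^{-1}(P))\colon V(\Omega)\to W(\Omega)$ is regular. The moduli problem is *rational over $k$* if there is given a family $(g_\sigma)_{\sigma\in A(\Omega/k)}$ of isomorphisms of functors $g_\sigma\colon{}^\sigma\mathcal M\to\mathcal M$, where ${}^\sigma\mathcal M(T)=\mathcal M(\sigma^{-1}T)$, compatible with $\sim$ and such that $g_{\sigma\tau}(T)=g_\sigma(T)\circ g_\tau(\sigma^{-1}T)$ for all $\sigma,\tau,T$. Since ${}^\sigma\mathcal M(\Omega)=\mathcal M(\Omega)$, the rule $\sigma m=g_\sigma(m)$ defines an action of $A(\Omega/k)$ on $\mathcal M(\Omega)$. A *solution over $k$* is a variety $V_0$ over $k$ with a bijection $\alpha_0\colon\mathcal M(\Omega)/{\sim}\to V_0(\Omega)$ that commutes with the actions of $A(\Omega/k)$ and is such that $(V_{0,\Omega},\alpha_0)$ is a solution of $(\mathcal M,\sim)$ over $\Omega$. **Theorem.** Let $(\mathcal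 M,\sim,(g_\sigma))$ be a moduli problem rational over $k$ for which $(\mathcal M,\sim)$ has a solution $(V,\alpha)$ over $\Omega$ with $V$ quasi-projective. Then $(\mathcal M,\sim,(g_\sigma))$ has a solution over $k$ if there exists a finite subset $\Sigma\subset\mathcal M(\Omega)$ such that (a) any automorphism of $V$ fixing $\alpha(P)$ for all $P\in\Sigma$ is the identity map, and (b) there exists a subfield $L$ of $\Omega$ finitely generated over $k$ such that $g_\sigma(P)\sim P$ for all $P\in\Sigma$ and all $\sigma\in A(\Omega/L)$. -/

import Mathlib

open CategoryTheory CategoryTheory.Limits AlgebraicGeometry Opposite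

universe u w

noncomputable section

namespace Descent

/-! ### Varieties over a field -/

/-- A morphism to the spectrum of a field defines a variety if it is geometrically reduced and of
finite type (no separatedness or irreducibility is required). -/
def varietyHom : MorphismProperty Scheme.{u} :=
  @GeometricallyReduced ⊓ @LocallyOfFiniteType ⊓ @QuasiCompact

instance : varietyHom.{u}.IsStableUnderBaseChange := by
  have h₁ : MorphismProperty.IsStableUnderBaseChange @GeometricallyReduced.{u} := inferInstance
  have h₂ : MorphismProperty.IsStableUnderBaseChange @LocallyOfFiniteType.{u} := inferInstance
  have h₃ : MorphismProperty.IsStableUnderBaseChange @QuasiCompact.{u} := inferInstance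
  have h₄ : MorphismProperty.IsStableUnderBaseChange
      (@GeometricallyReduced.{u} ⊓ @LocallyOfFiniteType.{u}) := .inf
  exact .inf

/-- The schemes over `Spec k` that are varieties: geometrically reduced, of finite type. -/
def isVariety (k : Type u) [Field k] : ObjectProperty (Over (Spec (.of k))) :=
  fun X => varietyHom X.hom

/-- The category of varieties over `k`, with all `k`-morphisms. -/
abbrev Variety (k : Type u) [Field k] := (isVariety k).FullSubcategory

variable {k Ω : Type u} [Field k] [Field Ω] [Algebra k Ω]

/-- The morphism `Spec Ω ⟶ Spec k`. -/
abbrev specAlg (k Ω : Type u) [Field k] [Field Ω] [Algebra k Ω] :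
    Spec (.of Ω) ⟶ Spec (.of k) :=
  Spec.map (CommRingCat.ofHom (algebraMap k Ω))

/-- The morphism `Spec Ω ⟶ Spec Ω` defined by an automorphism `σ` of `Ω`. -/
abbrev specAut (σ : Gal(Ω/k)) : Spec (.of Ω) ⟶ Spec (.of Ω) :=
  Spec.map (CommRingCat.ofHom (σ : Ω →+* Ω))

lemma specAut_comp (σ τ : Gal(Ω/k)) : specAut σ ≫ specAut τ = specAut (σ * τ) := by
  rw [specAut, specAut, ← Spec.map_comp]; rfl

lemma specAut_one : specAut (1 : Gal(Ω/k)) = 𝟙 _ := Spec.map_id _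

lemma specAut_inv_comp (σ : Gal(Ω/k)) : specAut σ⁻¹ ≫ specAut σ = 𝟙 _ := by
  rw [specAut_comp, inv_mul_cancel, specAut_one]

lemma specAut_comp_inv (σ : Gal(Ω/k)) : specAut σ ≫ specAut σ⁻¹ = 𝟙 _ := by
  rw [specAut_comp, mul_inv_cancel, specAut_one]

lemma specAut_comp_specAlg (σ : Gal(Ω/k)) : specAut σ ≫ specAlg k Ω = specAlg k Ω := by
  rw [specAut, specAlg, ← Spec.map_comp, ← CommRingCat.ofHom_comp]
  congr 2
  exact AlgHom.comp_algebraMap σ.toAlgHom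

/-- `Spec K` as a variety over `K`. -/
def pt (K : Type u) [Field K] : Variety K where
  obj := Over.mk (𝟙 (Spec (.of K)))
  property := by
    refine ⟨⟨⟨?_⟩, ?_⟩, ?_⟩
    · intro F _ y Z fst snd h
      have : IsIso (Over.mk (𝟙 (Spec (.of K)))).hom := inferInstanceAs (IsIso (𝟙 _))
      have : IsIso snd := h.isIso_snd_of_isIso
      exact isReduced_of_isOpenImmersion snd
    · exact inferInstanceAs (LocallyOfFiniteType (𝟙 _))
    · exact inferInstanceAs (QuasiCompact (𝟙 _))

/-- The set `V(K)` of `K`-points of a variety `V` over `K`. -/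
abbrev Pts {K : Type u} [Field K] (V : Variety K) := pt K ⟶ V

/-- The set `V₀(Ω)` of `Ω`-points of a variety `V₀` over `k`: the `k`-morphisms
`Spec Ω ⟶ V₀`. -/
abbrev PtsIn (V₀ : Variety k) (Ω : Type u) [Field Ω] [Algebra k Ω] :=
  Over.mk (specAlg k Ω) ⟶ V₀.obj

/-- The action of `Gal(Ω/k)` on `V₀(Ω)`: a point with coordinates in `Ω` is
sent to the point obtained by applying `σ` to the coordinates. -/
def galPt {V₀ : Variety k} (σ : Gal(Ω/k)) (P : PtsIn V₀ Ω) : PtsIn V₀ Ω :=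
  Over.homMk (specAut σ ≫ P.left) (by
    rw [Category.assoc, Over.w P]; exact specAut_comp_specAlg σ)

/-- The base change `V₀,Ω` of a variety `V₀` over `k` to `Ω`. -/
def baseChange (Ω : Type u) [Field Ω] [Algebra k Ω] (V₀ : Variety k) : Variety Ω where
  obj := (Over.pullback (specAlg k Ω)).obj V₀.obj
  property := MorphismProperty.pullback_snd (P := varietyHom) _ _ V₀.property

/-- The canonical bijection `V₀(Ω) ≃ V₀,Ω(Ω)`. -/
def ptsBaseChange (V₀ : Variety k) : PtsIn V₀ Ω ≃ Pts (baseChange Ω V₀) where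
  toFun P := ObjectProperty.homMk (Over.homMk
    (pullback.lift P.left (𝟙 _) ((Over.w P).trans (Category.id_comp _).symm))
    (pullback.lift_snd _ _ _))
  invFun Q := Over.homMk (Q.hom.left ≫ pullback.fst V₀.obj.hom (specAlg k Ω)) (by
    have h : Q.hom.left ≫ pullback.snd V₀.obj.hom (specAlg k Ω) = 𝟙 _ := Over.w Q.hom
    exact (Category.assoc _ _ _).trans <| (congrArg (Q.hom.left ≫ ·) pullback.condition).trans <|
      (Category.assoc _ _ _).symm.trans <| (congrArg (· ≫ specAlg k Ω) h).trans <|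
      Category.id_comp _)
  left_inv P := by
    ext1
    exact pullback.lift_fst _ _ _
  right_inv Q := by
    have h : Q.hom.left ≫ pullback.snd V₀.obj.hom (specAlg k Ω) = 𝟙 _ := Over.w Q.hom
    apply ObjectProperty.hom_ext
    ext1
    apply pullback.hom_ext
    · exact pullback.lift_fst _ _ _
    · exact (pullback.lift_snd _ _ _).trans h.symm

/-- The conjugate of a scheme over `Ω` by `σ`: the same scheme, with structure morphism composed
with `Spec σ⁻¹`. -/
abbrev conjOver (σ : Gal(Ω/k)) (X : Over (Spec (.of Ω))) : Over (Spec (.of Ω)) :=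
  Over.mk (X.hom ≫ specAut σ⁻¹)

/-- The conjugate by `σ` is the base change along `σ : Ω → Ω`. -/
lemma conjOver_isPullback (σ : Gal(Ω/k)) (X : Over (Spec (.of Ω))) :
    IsPullback (𝟙 X.left) (conjOver σ X).hom X.hom (specAut σ) := by
  have : IsIso (specAut σ) := ⟨specAut σ⁻¹, specAut_comp_inv σ, specAut_inv_comp σ⟩
  apply IsPullback.of_horiz_isIso
  constructor
  simp [specAut_inv_comp]

/-- The functor `V ↦ σV` on varieties over `Ω`, for `σ` an automorphism of `Ω` over `k`. -/
def conj (σ : Gal(Ω/k)) : Variety Ω ⥤ Variety Ω where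
  obj V :=
    { obj := conjOver σ V.obj
      property := MorphismProperty.of_isPullback (P := varietyHom)
        (conjOver_isPullback σ V.obj) V.property }
  map f := ObjectProperty.homMk (Over.homMk f.hom.left (by
    change f.hom.left ≫ _ ≫ _ = _ ≫ _
    rw [← Category.assoc, Over.w f.hom]))

/-- The canonical identification `(στ)⁻¹T = τ⁻¹(σ⁻¹T)`, as a morphism whose underlying morphism
of schemes is the identity. -/
def conjMul (σ τ : Gal(Ω/k)) (T : Variety Ω) :
    (conj (σ * τ)⁻¹).obj T ⟶ (conj τ⁻¹).obj ((conj σ⁻¹).obj T) :=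
  ObjectProperty.homMk (Over.homMk (𝟙 T.obj.left) (by
    change 𝟙 _ ≫ (T.obj.hom ≫ specAut σ⁻¹⁻¹) ≫ specAut τ⁻¹⁻¹ = T.obj.hom ≫ specAut (σ * τ)⁻¹⁻¹
    rw [Category.id_comp, Category.assoc, specAut_comp, inv_inv, inv_inv, inv_inv]))

/-- The canonical identification `σ⁻¹(Spec Ω) = Spec Ω` of varieties over `Ω`. -/
def conjPt (σ : Gal(Ω/k)) : (conj σ⁻¹).obj (pt Ω) ⟶ pt Ω :=
  ObjectProperty.homMk (Over.homMk (specAut σ) (by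
    change specAut σ ≫ 𝟙 _ = 𝟙 _ ≫ specAut σ⁻¹⁻¹
    rw [Category.id_comp, Category.comp_id, inv_inv]))

attribute [local instance] MvPolynomial.gradedAlgebra in
/-- Projective space of dimension `n` over `K`, as a scheme over `Spec K`. -/
def projSpace (n : ℕ) (K : Type u) [Field K] : Over (Spec (.of K)) :=
  Over.mk (Proj.toSpecZero (MvPolynomial.homogeneousSubmodule (Fin (n + 1)) K) ≫
    Spec.map (CommRingCat.ofHom
      (algebraMap K (MvPolynomial.homogeneousSubmodule (Fin (n + 1)) K 0))))

/-- A variety over `K` is quasi-projective if it admits an immersion over `K` into some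
projective space. -/
def IsQuasiProjective {K : Type u} [Field K] (V : Variety K) : Prop :=
  ∃ (n : ℕ) (i : V.obj ⟶ projSpace n K), IsImmersion i.left

/-- A map on points is regular if it is defined by a morphism of varieties. -/
def IsRegular {K : Type u} [Field K] {T V : Variety K} (φ : Pts T → Pts V) : Prop :=
  ∃ f : T ⟶ V, ∀ t : Pts T, φ t = t ≫ f

/-! ### Moduli problems -/

/-- A moduli problem over `K`: a contravariant functor from varieties over `K` to sets with
equivalence relations on its values that are compatible with morphisms. -/
structure ModuliProblem (K : Type u) [Field K] where
  /-- The functor. -/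
  fam : (Variety K)ᵒᵖ ⥤ Type w
  /-- The equivalence relations. -/
  rel : ∀ T : Variety K, Setoid (fam.obj (op T))
  rel_map : ∀ {S T : Variety K} (f : S ⟶ T) (m m' : fam.obj (op T)),
    rel T m m' → rel S (fam.map f.op m) (fam.map f.op m')

namespace ModuliProblem

/-- The set `ℳ(Ω)/∼`. -/
abbrev Classes (M : ModuliProblem.{u, w} Ω) := Quotient (M.rel (pt Ω))

/-- The class of `m_t = t^* m` for `t ∈ T(Ω)` and `m ∈ ℳ(T)`. -/
def fibre (M : ModuliProblem.{u, w} Ω) {T : Variety Ω} (m : M.fam.obj (op T)) (t : Pts T) :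
    M.Classes :=
  Quotient.mk (M.rel (pt Ω)) (M.fam.map t.op m)

/-- A map `β : ℳ(Ω)/∼ → W(Ω)` is regular on families if for every variety `T` and every
`m ∈ ℳ(T)`, the map `t ↦ β(m_t)` is regular. -/
def RegularOnFamilies (M : ModuliProblem.{u, w} Ω) {W : Variety Ω} (β : M.Classes → Pts W) :
    Prop :=
  ∀ (T : Variety Ω) (m : M.fam.obj (op T)), IsRegular fun t => β (M.fibre m t)

/-- `(V, α)` is a solution to the moduli problem. -/
structure IsSolution (M : ModuliProblem.{u, w} Ω) (V : Variety Ω) (α : M.Classes ≃ Pts V) :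
    Prop where
  regular : M.RegularOnFamilies α
  universal : ∀ (W : Variety Ω) (β : M.Classes → Pts W), M.RegularOnFamilies β →
    IsRegular fun P => β (α.symm P)

end ModuliProblem

/-- A moduli problem over `Ω` rational over `k`: isomorphisms `g_σ : ^σℳ → ℳ`, where
`^σℳ(T) = ℳ(σ⁻¹T)`, compatible with `∼`, such that `g_{στ}(T) = g_σ(T) ∘ g_τ(σ⁻¹T)`
(where `ℳ(τ⁻¹σ⁻¹T)` and `ℳ((στ)⁻¹T)` are canonically identified). -/
structure RationalModuliProblem (k Ω : Type u) [Field k] [Field Ω] [Algebra k Ω] extends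
    ModuliProblem.{u, w} Ω where
  /-- The isomorphisms `g_σ`. -/
  g : ∀ σ : Gal(Ω/k), (conj σ⁻¹).op ⋙ fam ≅ fam
  g_rel : ∀ (σ : Gal(Ω/k)) (T : Variety Ω) (m m' : fam.obj (op ((conj σ⁻¹).obj T))),
    rel _ m m' → rel T ((g σ).hom.app (op T) m) ((g σ).hom.app (op T) m')
  g_mul : ∀ (σ τ : Gal(Ω/k)) (T : Variety Ω)
    (m : fam.obj (op ((conj τ⁻¹).obj ((conj σ⁻¹).obj T)))),
    (g (σ * τ)).hom.app (op T) (fam.map (conjMul σ τ T).op m) =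
      (g σ).hom.app (op T) ((g τ).hom.app (op ((conj σ⁻¹).obj T)) m)

namespace RationalModuliProblem

/-- The action `σ m = g_σ(m)` of `Gal(Ω/k)` on `ℳ(Ω)`, where `^σℳ(Ω)` is identified with
`ℳ(Ω)`. -/
def act (M : RationalModuliProblem.{u, w} k Ω) (σ : Gal(Ω/k)) (m : M.fam.obj (op (pt Ω))) :
    M.fam.obj (op (pt Ω)) :=
  (M.g σ).hom.app (op (pt Ω)) (M.fam.map (conjPt σ).op m)

/-- `(V₀, α)` is a solution over `k` to the moduli problem rational over `k`: after base
change it is a solution over `Ω`, and `α` commutes with the actions of `Gal(Ω/k)`. -/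
structure IsSolutionOver (M : RationalModuliProblem.{u, w} k Ω) (V₀ : Variety k)
    (α : M.Classes ≃ PtsIn V₀ Ω) : Prop where
  solution : M.IsSolution (baseChange Ω V₀) (α.trans (ptsBaseChange V₀))
  equivariant : ∀ (σ : Gal(Ω/k)) (m : M.fam.obj (op (pt Ω))),
    α (Quotient.mk (M.rel (pt Ω)) (M.act σ m)) = galPt σ (α (Quotient.mk (M.rel (pt Ω)) m))

end RationalModuliProblem

end Descent

end

open Descent

/-!
# Descent of coarse moduli varieties to the field of rationality

The universal property of the solution `(V, α)`, applied to the conjugates of `α`, produces a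
semilinear action of `Gal(Ω/k)` on `V` for which `α` is equivariant
(`RationalModuliProblem.exists_action`). The theorem amounts to finding a model of `V` over `k` that
induces this action.

A stable affine open subset is *good* if its ring of functions is spanned by invariant functions.
As the fixed field of `Gal(Ω/k)` is `k` (`mem_of_forall_gal`), a good open subset is the base change
of the spectrum of its ring of invariants, and a separated scheme covered by good open subsets
descends (`SchemeAction.exists_quotient`). So the task is to cover `V` by good open subsets.

*Over a finitely generated extension of `k`.* The variety `V` is a subvariety of a projective space.
The action on projective space through the coordinates preserves `V` over some finitely generated
field (`exists_action_of_isImmersion`), and there `V` is covered by good open subsets for that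
action. Over a larger finitely generated field `L`, both this action and the given one fix the
points `α(P)`, `P ∈ S`. By rigidity they agree over `L`, so `V` is covered by subsets that are good
for the given action, restricted to the automorphisms over `L` (`exists_good_cover_of_rigid`).

*From `L` to `k`.* A semilinear representation of `Gal(Ω/k)` that is split over a finitely generated
field, that is, spanned by its vectors fixed over that field, is split (`IsSplit.of_fg`).
Consequently all stable affine open subsets of `V` are good (`SchemeAction.good_of_stable`), and the
point is to find enough of them. The conjugates of an affine open subset are the generic fibres of a
stable family of open subsets, parametrized by the spectrum of a finitely generated `k`-algebra
(`exists_family`). Affineness of a generic fibre implies affineness of fibres at algebraic points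
(`exists_isAffineOpen_fibre`), so that an affine open subset can be replaced by one that is defined
over a finite extension of `k` (`exists_stable_affine`). If the union `W` of the good open subsets
were not everything, there would be a point outside of `W` with finite orbit
(`SchemeAction.Good.exists_pt`). In a quasi-projective variety the orbit has an affine neighbourhood
(`exists_isAffineOpen_of_isImmersion`), and it can be taken to be defined over a finite extension
of `k`. The intersection of its finitely many conjugates is affine and stable, hence good, and it
contains the orbit: a contradiction (`exists_good_cover`).
-/

noncomputable section

namespace Descent

open scoped TensorProduct IntermediateField

/-! ### Embeddings and automorphisms of large algebraically closed fields -/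

section FieldTheory

/-- An algebraically closed extension is determined up to isomorphism by its transcendence
degree. -/
theorem nonempty_algEquiv_of_trdeg_eq {E K₁ K₂ : Type u} [Field E] [Field K₁] [Field K₂]
    [Algebra E K₁] [Algebra E K₂] [IsAlgClosed K₁] [IsAlgClosed K₂]
    (h : Algebra.trdeg E K₁ = Algebra.trdeg E K₂) : Nonempty (K₁ ≃ₐ[E] K₂) := by
  obtain ⟨s, hs⟩ := exists_isTranscendenceBasis E K₁
  obtain ⟨t, ht⟩ := exists_isTranscendenceBasis E K₂
  have hst : Cardinal.mk s = Cardinal.mk t := by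
    rw [hs.cardinalMk_eq_trdeg, ht.cardinalMk_eq_trdeg, h]
  obtain ⟨e⟩ := Cardinal.eq.mp hst
  have := IsAlgClosed.isAlgClosure_of_transcendence_basis _ hs
  have := IsAlgClosed.isAlgClosure_of_transcendence_basis _ ht
  let ε : Algebra.adjoin E (Set.range ((↑) : s → K₁)) ≃ₐ[E]
      Algebra.adjoin E (Set.range ((↑) : t → K₂)) :=
    (hs.1.aevalEquiv.symm.trans (MvPolynomial.renameEquiv E e)).trans ht.1.aevalEquiv
  let φ := IsAlgClosure.equivOfEquiv K₁ K₂ ε.toRingEquiv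
  refine ⟨AlgEquiv.ofRingEquiv (f := φ) fun x => ?_⟩
  have h1 := IsAlgClosure.equivOfEquiv_algebraMap K₁ K₂ ε.toRingEquiv (algebraMap E _ x)
  rw [← IsScalarTower.algebraMap_apply] at h1
  rw [h1]
  simp [← IsScalarTower.algebraMap_apply]

/-- An extension of finite transcendence degree embeds into an algebraically closed extension of
infinite transcendence degree. -/
theorem nonempty_algHom_of_aleph0_le_trdeg {E F K : Type u} [Field E] [Field F] [Field K]
    [Algebra E F] [Algebra E K] [IsAlgClosed K] [FinTrdeg E F]
    (h : Cardinal.aleph0 ≤ Algebra.trdeg E K) : Nonempty (F →ₐ[E] K) := by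
  obtain ⟨s, hs⟩ := exists_isTranscendenceBasis E F
  obtain ⟨t, ht⟩ := exists_isTranscendenceBasis E K
  have hst : Cardinal.mk s ≤ Cardinal.mk t := by
    rw [hs.cardinalMk_eq_trdeg, ht.cardinalMk_eq_trdeg]
    exact (trdeg_lt_aleph0 E F).le.trans h
  obtain ⟨e⟩ := Cardinal.le_def _ _ |>.mp hst
  have ht' : AlgebraicIndependent E (fun i : s => (e i : K)) := ht.1.comp e e.injective
  let g : Algebra.adjoin E (Set.range ((↑) : s → F)) →ₐ[E] K :=
    (MvPolynomial.aeval (fun i : s => (e i : K))).comp hs.1.aevalEquiv.symm.toAlgHom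
  have hg : Function.Injective g := by
    intro x y hxy
    exact hs.1.aevalEquiv.symm.injective (ht' hxy)
  let _ : Algebra (Algebra.adjoin E (Set.range ((↑) : s → F))) K := g.toRingHom.toAlgebra
  have : IsScalarTower E (Algebra.adjoin E (Set.range ((↑) : s → F))) K :=
    .of_algebraMap_eq fun x => (g.commutes x).symm
  have : Algebra.IsAlgebraic (Algebra.adjoin E (Set.range ((↑) : s → F))) F := hs.isAlgebraic
  have : FaithfulSMul (Algebra.adjoin E (Set.range ((↑) : s → F))) K :=
    (faithfulSMul_iff_algebraMap_injective _ _).mpr hg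
  exact ⟨(IsAlgClosed.lift (R := Algebra.adjoin E (Set.range ((↑) : s → F))) (S := F)
    (M := K)).restrictScalars E⟩

variable {k Ω : Type u} [Field k] [Field Ω] [Algebra k Ω]

theorem trdeg_eq_of_finTrdeg {E : Type u} [Field E] [Algebra k E] [Algebra E Ω]
    [IsScalarTower k E Ω] [FinTrdeg k E] (htr : Cardinal.aleph0 ≤ Algebra.trdeg k Ω) :
    Algebra.trdeg E Ω = Algebra.trdeg k Ω := by
  have h1 := trdeg_add_eq k E (A := Ω)
  have h2 := trdeg_lt_aleph0 k E
  have h3 : Cardinal.aleph0 ≤ Algebra.trdeg E Ω := by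
    by_contra! h
    exact absurd (h1 ▸ Cardinal.add_lt_aleph0 h2 h) htr.not_gt
  rw [← h1, Cardinal.add_eq_right h3 (h2.le.trans h3)]

theorem finTrdeg_of_fg {N : IntermediateField k Ω} (hN : N.FG) : FinTrdeg k N := by
  have : Algebra.EssFiniteType k N := IntermediateField.essFiniteType_iff.mpr hN
  infer_instance

theorem exists_ringEquiv_extending {E : Type u} [Field E] [Algebra k E] [FinTrdeg k E]
    [IsAlgClosed Ω] (htr : Cardinal.aleph0 ≤ Algebra.trdeg k Ω) (f g : E →ₐ[k] Ω) :
    ∃ σ : Gal(Ω/k), ∀ x : E, σ (f x) = g x := by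
  have h (f : E →ₐ[k] Ω) : @Algebra.trdeg E Ω _ _ f.toRingHom.toAlgebra = Algebra.trdeg k Ω := by
    let _ : Algebra E Ω := f.toRingHom.toAlgebra
    have : IsScalarTower k E Ω := .of_algebraMap_eq fun x => (f.commutes x).symm
    exact trdeg_eq_of_finTrdeg htr
  obtain ⟨e⟩ := @nonempty_algEquiv_of_trdeg_eq E Ω Ω _ _ _ f.toRingHom.toAlgebra
    g.toRingHom.toAlgebra _ _ ((h f).trans (h g).symm)
  have he (x : E) : e (f x) = g x :=
    @AlgEquiv.commutes E Ω Ω _ _ _ f.toRingHom.toAlgebra g.toRingHom.toAlgebra e x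
  let φ : Ω ≃+* Ω := @AlgEquiv.toRingEquiv E Ω Ω _ _ _ f.toRingHom.toAlgebra
    g.toRingHom.toAlgebra e
  refine ⟨AlgEquiv.ofRingEquiv (f := φ) fun x => ?_, he⟩
  have := he (algebraMap k E x)
  rwa [f.commutes, g.commutes] at this

/-- A finitely generated extension of a finitely generated subfield embeds into `Ω`. -/
theorem nonempty_algHom_of_fg [IsAlgClosed Ω] (htr : Cardinal.aleph0 ≤ Algebra.trdeg k Ω)
    {N : IntermediateField k Ω} (hN : N.FG) {F : Type u} [Field F] [Algebra N F]
    [Algebra.EssFiniteType N F] : Nonempty (F →ₐ[N] Ω) := by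
  have := finTrdeg_of_fg hN
  exact nonempty_algHom_of_aleph0_le_trdeg
    ((trdeg_eq_of_finTrdeg htr : Algebra.trdeg N Ω = Algebra.trdeg k Ω) ▸ htr)

/-- An element of `Ω` outside of `N` is moved by some embedding: a transcendental `x` can be sent to
`x + 1`, an algebraic one to another root of its minimal polynomial, which is separable of degree at
least two. -/
theorem exists_algHom_adjoin_simple_ne [IsAlgClosed Ω] [CharZero Ω] {N : IntermediateField k Ω}
    {x : Ω} (hx : x ∉ N) :
    ∃ f : N⟮x⟯ →ₐ[N] Ω, f ⟨x, IntermediateField.mem_adjoin_simple_self N x⟩ ≠ x := by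
  by_cases ht : Transcendental N x
  · have ht' : Transcendental N (x + 1) := by
      rw [← map_one (algebraMap N Ω)]
      intro h
      apply ht
      have := h.sub (isAlgebraic_algebraMap (R := N) (A := Ω) 1)
      simpa using this
    let f := ((IntermediateField.val N⟮x + 1⟯).comp
      (RatFunc.algEquivOfTranscendental (x + 1) ht').toAlgHom).comp
      (RatFunc.algEquivOfTranscendental x ht).symm.toAlgHom
    refine ⟨f, ?_⟩
    have h1 : (RatFunc.algEquivOfTranscendental x ht) RatFunc.X =
        ⟨x, IntermediateField.mem_adjoin_simple_self N x⟩ := by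
      ext; simp
    have : f ⟨x, IntermediateField.mem_adjoin_simple_self N x⟩ = x + 1 := by
      simp only [f, ← h1]
      simp
    rw [this]; simp
  · have hint : IsIntegral N x := by
      rw [Transcendental, not_not] at ht; exact ht.isIntegral
    have hsep := (minpoly.irreducible hint).separable
    have hdeg : 2 ≤ (minpoly N x).natDegree := by
      rw [minpoly.two_le_natDegree_iff hint]
      rintro ⟨y, rfl⟩
      exact hx y.2
    have hcard := Polynomial.card_rootSet_eq_natDegree (K := Ω) hsep
      (IsAlgClosed.splits _)
    obtain ⟨y, hy, hyx⟩ : ∃ y ∈ (minpoly N x).rootSet Ω, y ≠ x := by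
      by_contra! h
      have : Fintype.card ((minpoly N x).rootSet Ω) ≤ 1 :=
        Fintype.card_le_one_iff.mpr fun a b => Subtype.ext ((h a a.2).trans (h b b.2).symm)
      omega
    let f := (IntermediateField.algHomAdjoinIntegralEquiv N hint (K := Ω)).symm
      ⟨y, by
        rw [Polynomial.mem_aroots]
        exact ⟨minpoly.ne_zero hint, (Polynomial.mem_rootSet.mp hy).2⟩⟩
    refine ⟨f, ?_⟩
    have : f (IntermediateField.AdjoinSimple.gen N x) = y :=
      IntermediateField.algHomAdjoinIntegralEquiv_symm_apply_gen N hint _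
    exact fun h => hyx (this.symm.trans h)

/-- The elements of `Ω` fixed by all automorphisms over a finitely generated subfield `N` lie
in `N`. -/
theorem mem_of_forall_gal [IsAlgClosed Ω] [CharZero Ω]
    (htr : Cardinal.aleph0 ≤ Algebra.trdeg k Ω) {N : IntermediateField k Ω} (hN : N.FG) {x : Ω}
    (hx : ∀ σ : Gal(Ω/k), (∀ y ∈ N, σ y = y) → σ x = x) : x ∈ N := by
  by_contra hxN
  obtain ⟨f, hf⟩ := exists_algHom_adjoin_simple_ne hxN
  have := finTrdeg_of_fg hN
  have : Algebra.EssFiniteType N N⟮x⟯ := IntermediateField.essFiniteType_iff.mpr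
    (by simpa using IntermediateField.fg_adjoin_finset (F := N) {x})
  have : FinTrdeg k N⟮x⟯ := FinTrdeg.trans k N N⟮x⟯
  obtain ⟨σ, hσ⟩ := exists_ringEquiv_extending htr
    ((IntermediateField.val N⟮x⟯).restrictScalars k) (f.restrictScalars k)
  apply hf
  refine (hσ _).symm.trans (hx σ fun y hy => ?_)
  exact (hσ (algebraMap N _ ⟨y, hy⟩)).trans (f.commutes ⟨y, hy⟩)

end FieldTheory

/-! ### Semilinear representations -/

section Semilinear

variable {Γ Ω W : Type*} [Group Γ] [Field Ω] [AddCommGroup W] [Module Ω W]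

/-- An additive action of a group `Γ` on an `Ω`-vector space is semilinear with respect to an
action of `Γ` on the field `Ω`. -/
def IsSemilinear (Ω : Type*) [Field Ω] [MulSemiringAction Γ Ω] [Module Ω W]
    (a : Γ →* AddMonoid.End W) : Prop :=
  ∀ (γ : Γ) (c : Ω) (w : W), a γ (c • w) = (γ • c) • a γ w

lemma act_mul (a : Γ →* AddMonoid.End W) (γ δ : Γ) (w : W) : a (γ * δ) w = a γ (a δ w) := by
  rw [map_mul]; rfl

/-- The vectors fixed by an action. -/
def invariants (a : Γ →* AddMonoid.End W) : AddSubgroup W where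
  carrier := {w | ∀ γ, a γ w = w}
  add_mem' hv hw γ := by rw [map_add, hv γ, hw γ]
  zero_mem' γ := map_zero _
  neg_mem' hv γ := by rw [map_neg, hv γ]

/-- A semilinear action is split if the space is spanned by the fixed vectors. -/
def IsSplit (Ω : Type*) [Field Ω] [Module Ω W] (a : Γ →* AddMonoid.End W) : Prop :=
  Submodule.span Ω (invariants a : Set W) = ⊤

lemma IsSplit.exists_basis {a : Γ →* AddMonoid.End W} (h : IsSplit Ω a) :
    ∃ (ι : Set W) (b : Module.Basis ι Ω W), ∀ i, b i ∈ invariants a := by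
  refine ⟨_, Module.Basis.ofSpan h.ge, fun i => ?_⟩
  exact Module.Basis.ofSpan_subset h.ge ⟨i, rfl⟩

/-- The image of a split representation under an equivariant linear surjection is split. -/
lemma IsSplit.of_surjective {W' : Type*} [AddCommGroup W'] [Module Ω W']
    {a : Γ →* AddMonoid.End W} {a' : Γ →* AddMonoid.End W'} (h : IsSplit Ω a)
    (f : W →ₗ[Ω] W') (hf : Function.Surjective f) (hfa : ∀ γ w, f (a γ w) = a' γ (f w)) :
    IsSplit Ω a' := by
  rw [IsSplit, eq_top_iff, ← LinearMap.range_eq_top.mpr hf, LinearMap.range_eq_map, ← h,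
    Submodule.map_span, Submodule.span_le]
  rintro _ ⟨w, hw, rfl⟩
  exact Submodule.subset_span fun γ => by rw [← hfa, hw γ]

/-- A finite product of split representations is split. -/
lemma IsSplit.pi {ι : Type*} [Finite ι] {W : ι → Type*} [∀ i, AddCommGroup (W i)]
    [∀ i, Module Ω (W i)] {a : ∀ i, Γ →* AddMonoid.End (W i)} (h : ∀ i, IsSplit Ω (a i))
    {a' : Γ →* AddMonoid.End (∀ i, W i)} (ha' : ∀ γ w i, a' γ w i = a i γ (w i)) :
    IsSplit Ω a' := by
  classical
  cases nonempty_fintype ι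
  rw [IsSplit, eq_top_iff]
  intro w _
  rw [← Finset.univ_sum_single w]
  refine Submodule.sum_mem _ fun i _ => ?_
  have : Submodule.span Ω (invariants (a i) : Set (W i)) ≤
      (Submodule.span Ω (invariants a' : Set (∀ i, W i))).comap (LinearMap.single Ω W i) := by
    rw [Submodule.span_le]
    intro x hx
    refine Submodule.subset_span fun γ => ?_
    ext j
    rw [ha']
    by_cases hij : i = j
    · subst hij; simp [hx γ]
    · simp [Pi.single_eq_of_ne' hij]
  exact this ((h i).ge trivial)

variable [MulSemiringAction Γ Ω]

lemma repr_act {a : Γ →* AddMonoid.End W} (ha : IsSemilinear Ω a) {ι : Type*}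
    (b : Module.Basis ι Ω W) (hb : ∀ i, b i ∈ invariants a) (γ : Γ) (w : W) (i : ι) :
    b.repr (a γ w) i = γ • b.repr w i := by
  conv_lhs => rw [← b.linearCombination_repr w, Finsupp.linearCombination_apply, Finsupp.sum,
    map_sum]
  simp_rw [ha γ, hb _ γ]
  rw [map_sum, Finsupp.finsetSum_apply]
  simp only [map_smul, Finsupp.smul_apply, b.repr_self, smul_eq_mul]
  by_cases hi : i ∈ (b.repr w).support
  · rw [Finset.sum_eq_single i]
    · simp
    · intro j _ hj; simp [Finsupp.single_eq_of_ne hj.symm]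
    · exact fun h => absurd hi h
  · rw [Finset.sum_eq_zero, Finsupp.notMem_support_iff.mp hi, smul_zero]
    intro j hj
    rw [Finsupp.single_eq_of_ne (fun h => hi (by rwa [h])), mul_zero]

/-- A stable subspace of a split semilinear representation is spanned by its fixed vectors: a
vector of minimal support, normalised to have a coordinate equal to `1`, is fixed. -/
theorem IsSplit.span_invariants_inter {a : Γ →* AddMonoid.End W} (h : IsSplit Ω a)
    (ha : IsSemilinear Ω a) (P : Submodule Ω W) (hP : ∀ γ, ∀ w ∈ P, a γ w ∈ P) :
    P ≤ Submodule.span Ω (invariants a ∩ P : Set W) := by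
  classical
  obtain ⟨ι, b, hb⟩ := h.exists_basis
  suffices ∀ n : ℕ, ∀ w ∈ P, (b.repr w).support.card = n →
      w ∈ Submodule.span Ω (invariants a ∩ P : Set W) from fun w hw => this _ w hw rfl
  intro n
  induction n using Nat.strong_induction_on with
  | _ n ih =>
  intro w hw hn
  by_cases hw0 : w = 0
  · rw [hw0]; exact zero_mem _
  -- a nonzero vector of `P` of minimal support inside the support of `w`
  let S : Set ℕ := {m | ∃ u ∈ P, u ≠ 0 ∧ (b.repr u).support ⊆ (b.repr w).support ∧
    (b.repr u).support.card = m}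
  have hS : S.Nonempty := ⟨_, w, hw, hw0, subset_rfl, rfl⟩
  obtain ⟨u, huP, hu0, huw, hum⟩ := Nat.sInf_mem hS
  have hmin : ∀ v ∈ P, (b.repr v).support ⊂ (b.repr u).support → v = 0 := by
    intro v hv hvu
    by_contra hv0
    have := Nat.sInf_le (s := S) ⟨v, hv, hv0, hvu.subset.trans huw, rfl⟩
    have := Finset.card_lt_card hvu
    omega
  obtain ⟨j, hj⟩ : (b.repr u).support.Nonempty := by
    rw [Finsupp.support_nonempty_iff]; simpa using hu0
  have hju : b.repr u j ≠ 0 := Finsupp.mem_support_iff.mp hj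
  set u' := (b.repr u j)⁻¹ • u with hu'
  have hu'P : u' ∈ P := P.smul_mem _ huP
  have hu'j : b.repr u' j = 1 := by simp [hu', hju]
  have hu's : (b.repr u').support ⊆ (b.repr u).support := by
    rw [hu', map_smul]; exact Finsupp.support_smul
  -- `γ u' - u'` has smaller support, because the coordinate of `u'` at `j` is `1`
  have hinv : u' ∈ invariants a := by
    intro γ
    rw [← sub_eq_zero]
    apply hmin _ (P.sub_mem (hP γ _ hu'P) hu'P)
    rw [Finset.ssubset_iff_of_subset]
    · refine ⟨j, hj, ?_⟩
      simp [repr_act ha b hb, hu'j]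
    · intro i hi
      apply hu's
      rw [Finsupp.mem_support_iff] at hi ⊢
      intro h0
      apply hi
      simp [repr_act ha b hb, h0]
  have hw' : w - b.repr w j • u' ∈ Submodule.span Ω (invariants a ∩ P : Set W) := by
    refine ih _ ?_ _ (P.sub_mem hw (P.smul_mem _ hu'P)) rfl
    rw [← hn]
    apply Finset.card_lt_card
    rw [Finset.ssubset_iff_of_subset]
    · exact ⟨j, huw hj, by simp [hu'j]⟩
    · intro i hi
      rw [Finsupp.mem_support_iff] at hi ⊢
      intro h0
      have : b.repr u' i = 0 := by
        by_contra h1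
        exact (Finsupp.mem_support_iff.mp (huw (hu's (Finsupp.mem_support_iff.mpr h1)))) h0
      apply hi
      simp [h0, this]
  have := Submodule.add_mem _ hw'
    (Submodule.smul_mem _ (b.repr w j) (Submodule.subset_span ⟨hinv, hu'P⟩))
  simpa using this

/-- The coordinatewise action on finitely supported families of vectors. -/
def finsuppAct (ι : Type*) (a : Γ →* AddMonoid.End W) : Γ →* AddMonoid.End (ι →₀ W) where
  toFun γ := Finsupp.mapRange.addMonoidHom (a γ)
  map_one' := AddMonoidHom.ext fun w => Finsupp.ext fun i => by
    change a 1 (w i) = w i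
    rw [map_one]; rfl
  map_mul' γ δ := AddMonoidHom.ext fun w => Finsupp.ext fun i => by
    change a (γ * δ) (w i) = a γ (a δ (w i))
    rw [map_mul]; rfl

@[simp] lemma finsuppAct_apply {ι : Type*} (a : Γ →* AddMonoid.End W) (γ : Γ) (w : ι →₀ W)
    (i : ι) : finsuppAct ι a γ w i = a γ (w i) := rfl

@[simp] lemma finsuppAct_single {ι : Type*} (a : Γ →* AddMonoid.End W) (γ : Γ) (w : W)
    (i : ι) : finsuppAct ι a γ (Finsupp.single i w) = Finsupp.single i (a γ w) :=
  Finsupp.mapRange_single (hf := map_zero _)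

lemma IsSemilinear.finsupp {a : Γ →* AddMonoid.End W} (ha : IsSemilinear Ω a) {ι : Type*} :
    IsSemilinear Ω (finsuppAct ι a) := by
  intro γ c x
  ext i
  simp [ha γ]

omit [MulSemiringAction Γ Ω] in
lemma IsSplit.finsupp {a : Γ →* AddMonoid.End W} (ha : IsSplit Ω a) {ι : Type*} :
    IsSplit Ω (finsuppAct ι a) := by
  rw [IsSplit, eq_top_iff]
  intro w _
  rw [← w.sum_single]
  refine Submodule.sum_mem _ fun i _ => ?_
  have : Submodule.span Ω (invariants a : Set W) ≤
      (Submodule.span Ω (invariants (finsuppAct ι a) : Set (ι →₀ W))).comap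
        (Finsupp.lsingle i) := by
    rw [Submodule.span_le]
    intro x hx
    refine Submodule.subset_span fun γ => ?_
    change finsuppAct ι a γ (Finsupp.single i x) = Finsupp.single i x
    rw [finsuppAct_single, hx γ]
  exact this (ha.ge trivial)

lemma isSemilinear_self : IsSemilinear Ω (DistribMulAction.toAddMonoidEnd Γ Ω) :=
  fun γ c w => smul_mul' γ c w

lemma isSplit_self : IsSplit Ω (DistribMulAction.toAddMonoidEnd Γ Ω) := by
  exact (Ideal.eq_top_iff_one _).mpr (Submodule.subset_span fun γ => smul_one γ)

/-- Vectors fixed by a semilinear action that are linearly independent over the fixed field are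
linearly independent: the linear relations between them form a stable subspace, which is spanned by
fixed relations, that is, by relations with coefficients in the fixed field. -/
theorem linearIndependent_of_invariants {a : Γ →* AddMonoid.End W} (ha : IsSemilinear Ω a)
    {E : Type*} [Field E] [Algebra E Ω] [Module E W] [IsScalarTower E Ω W]
    (hE : ∀ c : Ω, (∀ γ : Γ, γ • c = c) → c ∈ (algebraMap E Ω).range)
    {ι : Type*} {v : ι → W} (hv : ∀ i, v i ∈ invariants a) (hli : LinearIndependent E v) :
    LinearIndependent Ω v := by
  classical
  let a' : Γ →* AddMonoid.End (ι →₀ Ω) := finsuppAct ι (DistribMulAction.toAddMonoidEnd Γ Ω)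
  have ha'_apply (γ : Γ) (x : ι →₀ Ω) (i : ι) : a' γ x i = γ • x i := rfl
  have ha' : IsSemilinear Ω a' := isSemilinear_self.finsupp
  have hsplit : IsSplit Ω a' := isSplit_self.finsupp
  let P := LinearMap.ker (Finsupp.linearCombination Ω v)
  have hcomb (γ : Γ) (x : ι →₀ Ω) :
      Finsupp.linearCombination Ω v (a' γ x) = a γ (Finsupp.linearCombination Ω v x) := by
    rw [Finsupp.linearCombination_apply, Finsupp.linearCombination_apply, Finsupp.sum, Finsupp.sum,
      map_sum]
    simp_rw [ha γ, hv _ γ]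
    apply Finset.sum_subset_zero_on_sdiff
    · intro i hi
      rw [Finsupp.mem_support_iff] at hi ⊢
      intro h0; exact hi (by rw [ha'_apply, h0, smul_zero])
    · intro i hi
      have : a' γ x i = 0 := Finsupp.notMem_support_iff.mp (Finset.mem_sdiff.mp hi).2
      rw [← ha'_apply, this, zero_smul]
    · intro i _; rfl
  have hP : ∀ γ, ∀ x ∈ P, a' γ x ∈ P := by
    intro γ x hx
    rw [LinearMap.mem_ker] at hx ⊢
    rw [hcomb, hx, map_zero]
  have h := hsplit.span_invariants_inter ha' P hP
  rw [LinearIndependent, ← LinearMap.ker_eq_bot, eq_bot_iff]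
  refine h.trans (Submodule.span_le.mpr ?_)
  rintro x ⟨hx, hxP⟩
  -- a fixed relation has its coefficients in `E`
  have hx' (i : ι) : ∃ e : E, algebraMap E Ω e = x i :=
    hE _ fun γ => by rw [← ha'_apply, hx γ]
  choose e he using hx'
  let y : ι →₀ E := Finsupp.onFinset x.support e fun i hi => by
    rw [Finsupp.mem_support_iff, ← he i]; simpa using hi
  have hy : Finsupp.linearCombination E v y = 0 := by
    rw [← (LinearMap.mem_ker.mp hxP), Finsupp.linearCombination_apply,
      Finsupp.linearCombination_apply, Finsupp.sum, Finsupp.sum]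
    have : y.support ⊆ x.support := Finsupp.support_onFinset_subset
    rw [Finset.sum_subset this]
    · refine Finset.sum_congr rfl fun i _ => ?_
      rw [← he i, algebraMap_smul]; rfl
    · intro i _ hi
      rw [Finsupp.notMem_support_iff.mp hi, zero_smul]
  have hy0 : y = 0 := (linearIndependent_iff.mp hli) y hy
  ext i
  have : e i = 0 := congrArg (fun z : ι →₀ E => z i) hy0
  rw [← he i, this, map_zero]; rfl

/-- A split semilinear representation is the extension of scalars of its space of fixed
vectors. -/
theorem IsSplit.isBaseChange {a : Γ →* AddMonoid.End W} (h : IsSplit Ω a)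
    (ha : IsSemilinear Ω a) {E W₀ : Type*} [Field E] [Algebra E Ω] [Module E W]
    [IsScalarTower E Ω W] (hE : ∀ c : Ω, (∀ γ : Γ, γ • c = c) → c ∈ (algebraMap E Ω).range)
    [AddCommGroup W₀] [Module E W₀] (f : W₀ →ₗ[E] W) (hf : Function.Injective f)
    (hfr : ∀ w, w ∈ Set.range f ↔ w ∈ invariants a) : IsBaseChange Ω f := by
  let b := Module.Basis.ofVectorSpace E W₀
  have hli : LinearIndependent Ω (f ∘ b) :=
    linearIndependent_of_invariants ha hE (fun i => (hfr _).mp ⟨b i, rfl⟩)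
      (b.linearIndependent.map' f (LinearMap.ker_eq_bot.mpr hf))
  have hsp : ⊤ ≤ Submodule.span Ω (Set.range (f ∘ b)) := by
    rw [← h, Submodule.span_le]
    intro w hw
    obtain ⟨x, rfl⟩ := (hfr w).mpr hw
    have hx : x ∈ Submodule.span E (Set.range b) := b.mem_span x
    have : f x ∈ Submodule.span E (Set.range (f ∘ b)) := by
      rw [Set.range_comp, ← Submodule.map_span]
      exact Submodule.mem_map_of_mem hx
    exact Submodule.span_le_restrictScalars E Ω _ this
  let B := Module.Basis.mk hli hsp
  refine IsBaseChange.of_equiv ((Algebra.TensorProduct.basis Ω b).equiv B (Equiv.refl _)) ?_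
  intro x
  let φ : W₀ →ₗ[E] W := ((((Algebra.TensorProduct.basis Ω b).equiv B (Equiv.refl _)) :
    Ω ⊗[E] W₀ →ₗ[Ω] W).restrictScalars E).comp (TensorProduct.mk E Ω W₀ 1)
  have : φ = f := b.ext fun i => by
    have : (1 : Ω) ⊗ₜ[E] b i = Algebra.TensorProduct.basis Ω b i := by simp
    have h2 := (Algebra.TensorProduct.basis Ω b).equiv_apply i B (Equiv.refl _)
    rw [← this, Equiv.refl_apply, Module.Basis.mk_apply] at h2
    exact h2
  exact congrArg (· x) this

/-- A representation that embeds equivariantly into a split one is split. -/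
lemma IsSplit.of_injective {W' : Type*} [AddCommGroup W'] [Module Ω W']
    {a : Γ →* AddMonoid.End W} {a' : Γ →* AddMonoid.End W'} (h : IsSplit Ω a')
    (ha' : IsSemilinear Ω a')
    (f : W →ₗ[Ω] W') (hf : Function.Injective f) (hfa : ∀ γ w, f (a γ w) = a' γ (f w)) :
    IsSplit Ω a := by
  rw [IsSplit, eq_top_iff]
  have hP := h.span_invariants_inter ha' (LinearMap.range f) (by
    rintro γ _ ⟨w, rfl⟩; exact ⟨a γ w, hfa γ w⟩)
  intro w _
  have hw := hP ⟨w, rfl⟩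
  have : Submodule.span Ω (invariants a' ∩ (LinearMap.range f) : Set W') ≤
      (Submodule.span Ω (invariants a : Set W)).map f := by
    rw [Submodule.span_le]
    rintro _ ⟨hw, ⟨x, rfl⟩⟩
    exact ⟨x, Submodule.subset_span fun γ => hf (by rw [hfa, hw γ]), rfl⟩
  obtain ⟨x, hx, hxw⟩ := this hw
  rwa [← hf hxw]

end Semilinear

/-! ### Generic points of algebras of finite type -/

section Generic

variable {k Ω : Type u} [Field k] [Field Ω] [Algebra k Ω] {R : Type u} [CommRing R] [Algebra k R]

/-- The evaluation `A ⊗ R → Ω`, `a ⊗ r ↦ a x(r)`, at an `Ω`-valued point `x` of `R`. -/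
def evalAt (A : Type*) [CommRing A] [Algebra k A] [Algebra A Ω] [IsScalarTower k A Ω]
    (x : R →ₐ[k] Ω) : A ⊗[k] R →ₐ[A] Ω :=
  Algebra.TensorProduct.lift (Algebra.ofId A Ω) x fun _ _ => .all _ _

@[simp] lemma evalAt_tmul (A : Type*) [CommRing A] [Algebra k A] [Algebra A Ω]
    [IsScalarTower k A Ω] (x : R →ₐ[k] Ω) (a : A) (r : R) :
    evalAt A x (a ⊗ₜ r) = algebraMap A Ω a * x r := by
  simp [evalAt, Algebra.ofId_apply]

section

variable (F : Type u) [Field F] [Algebra k F] [Algebra F Ω] [IsScalarTower k F Ω]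

/-- An `Ω`-valued point `x` of `R` is generic over a field `F` if it lies over the generic point
of an irreducible component of `Spec (F ⊗ R)`. -/
def IsGeneric (x : R →ₐ[k] Ω) : Prop :=
  RingHom.ker (evalAt F x) ∈ minimalPrimes (F ⊗[k] R)

end

/-- The minimal primes of a flat algebra lie over minimal primes. -/
lemma comap_mem_minimalPrimes_of_flat {A B : Type*} [CommRing A] [CommRing B] (f : A →+* B)
    (hf : f.Flat) {p : Ideal B} (hp : p ∈ minimalPrimes B) :
    p.comap f ∈ minimalPrimes A := by
  algebraize [f]
  have := hp.1.1
  refine ⟨⟨inferInstance, bot_le⟩, fun q ⟨hq, _⟩ hqp => ?_⟩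
  -- going down for flat algebras
  obtain ⟨P, hPp, hP, hPq⟩ := p.exists_ideal_le_liesOver_of_le (p := q) (q := p.under A) hqp
  have : p ≤ P := hp.2 ⟨hP, bot_le⟩ hPp
  rw [hPq.over]
  exact Ideal.comap_mono this

section

variable {F F' : Type u} [Field F] [Algebra k F] [Algebra F Ω] [IsScalarTower k F Ω]
  [Field F'] [Algebra k F'] [Algebra F' Ω] [IsScalarTower k F' Ω]

lemma IsGeneric.injective [IsDomain R] {x : R →ₐ[k] Ω}
    (h : IsGeneric F x) : Function.Injective x := by
  have hf : (Algebra.TensorProduct.includeRight : R →ₐ[k] F ⊗[k] R).toRingHom.Flat := by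
    have h1 : (algebraMap R (R ⊗[k] F)).Flat := RingHom.flat_algebraMap_iff.mpr inferInstance
    exact h1.comp (RingHom.Flat.of_bijective
      (f := (Algebra.TensorProduct.comm k R F).toAlgHom.toRingHom)
      (Algebra.TensorProduct.comm k R F).bijective)
  have h1 := comap_mem_minimalPrimes_of_flat _ hf h
  rw [IsDomain.minimalPrimes_eq_singleton_bot, Set.mem_singleton_iff] at h1
  rw [injective_iff_map_eq_zero]
  intro r hr
  rw [← Ideal.mem_bot, ← h1, Ideal.mem_comap, RingHom.mem_ker]
  change evalAt F x (1 ⊗ₜ r) = 0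
  rw [evalAt_tmul, hr, mul_zero]

/-- Genericity descends along an embedding of fields `F → F'`, compatible with an automorphism `τ`
of `Ω`: the point `τ ∘ x` over `F'` gives the point `x` over `F`. -/
lemma IsGeneric.of_embedding (i : F →ₐ[k] F') (τ : Gal(Ω/k))
    (hi : ∀ a, algebraMap F' Ω (i a) = τ (algebraMap F Ω a)) {x : R →ₐ[k] Ω}
    (h : IsGeneric F' ((τ : Ω →ₐ[k] Ω).comp x)) : IsGeneric F x := by
  let φ : F ⊗[k] R →ₐ[k] F' ⊗[k] R := Algebra.TensorProduct.map i (AlgHom.id k R)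
  have hφ : φ.toRingHom.Flat := by
    let _ := i.toAlgebra
    have : IsScalarTower k F F' := .of_algebraMap_eq fun x => (i.commutes x).symm
    exact RingHom.Flat.tensorProductMap (S := k) (f := i) (g := AlgHom.id k R)
      (show Module.Flat F F' from inferInstance) (RingHom.Flat.id R)
  have h1 := comap_mem_minimalPrimes_of_flat _ hφ h
  unfold IsGeneric
  convert h1
  have : (τ : Ω →ₐ[k] Ω).comp ((evalAt F x).restrictScalars k) =
      ((evalAt F' ((τ : Ω →ₐ[k] Ω).comp x)).restrictScalars k).comp φ := by
    ext <;> simp [φ, hi]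
  ext y
  rw [RingHom.mem_ker, Ideal.mem_comap, RingHom.mem_ker,
    ← map_eq_zero_iff (τ : Ω →ₐ[k] Ω) τ.injective]
  exact iff_of_eq (congrArg (· = 0) (DFunLike.congr_fun this y))

end

lemma IsGeneric.mono {N N' : IntermediateField k Ω} (hN : N ≤ N') {x : R →ₐ[k] Ω}
    (h : IsGeneric N' x) : IsGeneric N x :=
  IsGeneric.of_embedding (F := N) (F' := N') (IntermediateField.inclusion hN) 1
    (fun _ => rfl) h

lemma IsGeneric.of_map {N : IntermediateField k Ω} {x : R →ₐ[k] Ω} {τ : Gal(Ω/k)}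
    (h : IsGeneric (N.map (τ : Ω →ₐ[k] Ω)) ((τ : Ω →ₐ[k] Ω).comp x)) : IsGeneric N x :=
  IsGeneric.of_embedding (F := N) (N.equivMap (τ : Ω →ₐ[k] Ω)).toAlgHom τ (fun _ => rfl) h

variable [IsAlgClosed Ω] (htr : Cardinal.aleph0 ≤ Algebra.trdeg k Ω)
include htr

section

variable {F : Type u} [Field F] [Algebra k F] [Algebra F Ω] [IsScalarTower k F Ω]
  [Algebra.EssFiniteType k F]

variable (F) in
/-- Generic points exist over fields finitely generated over `k`: the fraction field of the quotient
of `F ⊗ R` by a minimal prime embeds into `Ω`. -/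
theorem exists_isGeneric [Nontrivial R] [Algebra.FiniteType k R] :
    ∃ x : R →ₐ[k] Ω, IsGeneric F x := by
  have : Nontrivial (F ⊗[k] R) := inferInstance
  obtain ⟨⟨p, hp⟩⟩ := Ideal.nonempty_minimalPrimes (I := (⊥ : Ideal (F ⊗[k] R)))
    (bot_ne_top (α := Ideal (F ⊗[k] R)))
  have := hp.1.1
  have : Algebra.EssFiniteType F (FractionRing ((F ⊗[k] R) ⧸ p)) :=
    .comp _ ((F ⊗[k] R) ⧸ p) _
  obtain ⟨f⟩ := nonempty_algHom_of_aleph0_le_trdeg (E := F) (K := Ω)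
    (F := FractionRing ((F ⊗[k] R) ⧸ p)) ((trdeg_eq_of_finTrdeg (E := F) htr).symm ▸ htr)
  let g : F ⊗[k] R →ₐ[F] Ω :=
    (f.comp (IsScalarTower.toAlgHom F _ _)).comp (Ideal.Quotient.mkₐ F p)
  refine ⟨(g.restrictScalars k).comp Algebra.TensorProduct.includeRight, ?_⟩
  have hg : evalAt F ((g.restrictScalars k).comp Algebra.TensorProduct.includeRight) = g := by
    ext r; simp
  rw [IsGeneric, hg]
  convert hp
  ext y
  have : Function.Injective (f.comp (IsScalarTower.toAlgHom F ((F ⊗[k] R) ⧸ p)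
      (FractionRing ((F ⊗[k] R) ⧸ p)))) :=
    f.toRingHom.injective.comp (IsFractionRing.injective _ _)
  rw [RingHom.mem_ker]
  change f.comp (IsScalarTower.toAlgHom F ((F ⊗[k] R) ⧸ p)
      (FractionRing ((F ⊗[k] R) ⧸ p))) (Ideal.Quotient.mk p y) = 0 ↔ _
  rw [map_eq_zero_iff _ this, Ideal.Quotient.eq_zero_iff_mem]

/-- Two points with the same image in `Spec (F ⊗ R)` are conjugate over `F`. -/
theorem exists_gal_of_ker_evalAt_eq [Algebra.FiniteType k R] {x y : R →ₐ[k] Ω}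
    (h : RingHom.ker (evalAt F x) = RingHom.ker (evalAt F y)) :
    ∃ ρ : Gal(Ω/k), (∀ a : F, ρ (algebraMap F Ω a) = algebraMap F Ω a) ∧ ∀ r, ρ (x r) = y r := by
  let p := RingHom.ker (evalAt F x)
  have : p.IsPrime := RingHom.ker_isPrime _
  let B := (F ⊗[k] R) ⧸ p
  have h2 : Algebra.EssFiniteType F (FractionRing B) := .comp _ B _
  have h3 : Algebra.EssFiniteType k (FractionRing B) := .comp _ F _
  have : FinTrdeg k (FractionRing B) := inferInstance
  -- the residue field of the common image point embeds into `Ω` through both points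
  let lft (z : R →ₐ[k] Ω) (hz : p = RingHom.ker (evalAt F z)) :
      ∃ f : FractionRing B →ₐ[k] Ω, ∀ b, f (algebraMap B _ (Ideal.Quotient.mk p b)) =
        evalAt F z b := by
    let f0 : B →ₐ[F] Ω := Ideal.Quotient.liftₐ p (evalAt F z) fun a ha => by
      rwa [hz, RingHom.mem_ker] at ha
    have hf0 : Function.Injective f0 := by
      rw [injective_iff_map_eq_zero]
      intro b hb
      obtain ⟨b, rfl⟩ := Ideal.Quotient.mk_surjective b
      rw [Ideal.Quotient.eq_zero_iff_mem, hz, RingHom.mem_ker]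
      exact hb
    exact ⟨(IsFractionRing.liftAlgHom (K := FractionRing B) hf0).restrictScalars k,
      fun b => IsFractionRing.lift_algebraMap (K := FractionRing B) hf0 _⟩
  obtain ⟨f, hf⟩ := lft x rfl
  obtain ⟨g, hg⟩ := lft y h
  obtain ⟨ρ, hρ⟩ := exists_ringEquiv_extending htr f g
  have key (b : F ⊗[k] R) : ρ (evalAt F x b) = evalAt F y b := by rw [← hf, hρ, hg]
  refine ⟨ρ, fun a => ?_, fun r => ?_⟩
  · simpa using key (a ⊗ₜ 1)
  · simpa using key (1 ⊗ₜ r)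

/-- A function on `Spec (F ⊗ R)` separates the component of a generic point `x` from the other
components, and the generic points of one component are conjugate over `F`. -/
theorem IsGeneric.exists_separating [Algebra.FiniteType k R] {x : R →ₐ[k] Ω}
    (hx : IsGeneric F x) :
    ∃ d : F ⊗[k] R, evalAt F x d ≠ 0 ∧ ∀ y : R →ₐ[k] Ω, IsGeneric F y →
      evalAt F y d = 0 ∨ ∃ ρ : Gal(Ω/k),
        (∀ a : F, ρ (algebraMap F Ω a) = algebraMap F Ω a) ∧ ∀ r, ρ (x r) = y r := by
  have : IsNoetherianRing (F ⊗[k] R) := Algebra.FiniteType.isNoetherianRing F _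
  have hfin := minimalPrimes.finite_of_isNoetherianRing (F ⊗[k] R)
  set p := RingHom.ker (evalAt F x) with hp
  have hpp : p.IsPrime := RingHom.ker_isPrime _
  have h (q : Ideal (F ⊗[k] R)) : ∃ d, d ∉ p ∧ (q ∈ minimalPrimes (F ⊗[k] R) → q ≠ p → d ∈ q) := by
    by_cases hq : q ∈ minimalPrimes (F ⊗[k] R) ∧ q ≠ p
    · obtain ⟨d, hdq, hdp⟩ := SetLike.not_le_iff_exists.mp
        (fun hqp : q ≤ p => hq.2 (le_antisymm hqp (hx.2 hq.1.1 hqp)))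
      exact ⟨d, hdp, fun _ _ => hdq⟩
    · exact ⟨1, fun h1 => hpp.ne_top ((Ideal.eq_top_iff_one _).mpr h1),
        fun h1 h2 => absurd ⟨h1, h2⟩ hq⟩
  -- `d q` lies outside of the kernel `p` at `x`, and inside of `q` if `q ≠ p` is minimal
  choose d hdp hdq using h
  refine ⟨∏ q ∈ hfin.toFinset, d q, ?_, fun y hy => ?_⟩
  · intro h0
    obtain ⟨q, _, hq⟩ := hpp.prod_mem_iff.mp (show ∏ q ∈ hfin.toFinset, d q ∈ p from h0)
    exact hdp q hq
  · by_cases hyp : RingHom.ker (evalAt F y) = p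
    · exact .inr (exists_gal_of_ker_evalAt_eq htr hyp.symm)
    · left
      rw [← RingHom.mem_ker]
      exact Ideal.mem_of_dvd _ (Finset.dvd_prod_of_mem _ (hfin.mem_toFinset.mpr hy))
        (hdq _ hy hyp)

end

omit htr [IsAlgClosed Ω] in
lemma exists_common_denominator {N : IntermediateField k Ω} {x : R →ₐ[k] Ω} {ι : Type*}
    [Finite ι] {c : ι → Ω}
    (hc : ∀ i, ∃ C D : N ⊗[k] R, evalAt N x D ≠ 0 ∧ evalAt N x D * c i = evalAt N x C) :
    ∃ (D : N ⊗[k] R) (C : ι → N ⊗[k] R), evalAt N x D ≠ 0 ∧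
      ∀ i, evalAt N x D * c i = evalAt N x (C i) := by
  classical
  cases nonempty_fintype ι
  choose C D hD hCD using hc
  refine ⟨∏ i, D i, fun i => (∏ j ∈ Finset.univ.erase i, D j) * C i, ?_, fun i => ?_⟩
  · rw [map_prod, Finset.prod_ne_zero_iff]
    exact fun i _ => hD i
  · rw [map_mul, ← hCD, ← mul_assoc, ← map_mul, Finset.prod_erase_mul _ _ (Finset.mem_univ i)]

/-- An element of `Ω` fixed by the automorphisms over `N` that fix the point `x` is a quotient of
values at `x` of functions on `Spec (N ⊗ R)`. -/
theorem exists_fraction_of_fixed [CharZero Ω] [Algebra.FiniteType k R]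
    {N : IntermediateField k Ω} (hN : N.FG) (x : R →ₐ[k] Ω) {c : Ω}
    (hc : ∀ ρ : Gal(Ω/k), (∀ a ∈ N, ρ a = a) → (∀ r, ρ (x r) = x r) → ρ c = c) :
    ∃ C D : N ⊗[k] R, evalAt N x D ≠ 0 ∧ evalAt N x D * c = evalAt N x C := by
  obtain ⟨s, hs⟩ := ‹Algebra.FiniteType k R›.out
  let M := N ⊔ IntermediateField.adjoin k (x '' s)
  have hM : M.FG := IntermediateField.fg_sup hN
    (IntermediateField.fg_adjoin_of_finite (s.finite_toSet.image x))
  let S := ((evalAt N x).restrictScalars k).range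
  have hxS (r : R) : x r ∈ S := ⟨1 ⊗ₜ r, by simp⟩
  -- an automorphism over `M` fixes `N` and the values of `x`, hence `c`
  have hcM : c ∈ M := by
    apply mem_of_forall_gal htr hM
    intro ρ hρ
    refine hc ρ (fun a ha => hρ a ((le_sup_left : N ≤ M) ha)) fun r => ?_
    have hr : r ∈ Algebra.adjoin k (s : Set R) := hs ▸ trivial
    have : (Algebra.adjoin k (s : Set R)) ≤ AlgHom.equalizer ((ρ : Ω →ₐ[k] Ω).comp x) x := by
      rw [Algebra.adjoin_le_iff]
      intro r hr
      exact hρ _ ((le_sup_right : _ ≤ M) (IntermediateField.subset_adjoin _ _ ⟨r, hr, rfl⟩))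
    exact this hr
  have hMS : M ≤ IntermediateField.adjoin k (S : Set Ω) := by
    refine sup_le (fun a ha => IntermediateField.subset_adjoin _ _ ⟨⟨a, ha⟩ ⊗ₜ 1, ?_⟩) ?_
    · change evalAt N x _ = a
      simp
    · rw [IntermediateField.adjoin_le_iff]
      rintro _ ⟨r, _, rfl⟩
      exact IntermediateField.subset_adjoin _ _ (hxS r)
  obtain ⟨a, ha, b, hb, rfl⟩ := IntermediateField.mem_adjoin_iff_div.mp (hMS hcM)
  rw [Algebra.adjoin_eq] at ha hb
  obtain ⟨A, rfl⟩ := ha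
  obtain ⟨B, rfl⟩ := hb
  -- if `B(x) = 0`, the quotient is the junk value `0`
  by_cases hB : evalAt N x B = 0
  · exact ⟨0, 1, by simp, by
      have : ((evalAt N x).restrictScalars k).toRingHom B = 0 := hB
      rw [this, div_zero, mul_zero, map_zero]⟩
  · exact ⟨A, B, hB, mul_div_cancel₀ _ hB⟩

/-- Elements of `Ω` rational over `N` and a generic point `x` are the values at `x` of rational
functions, and their conjugates are the values of the same functions at the conjugates of `x`. A
common denominator can be chosen to vanish, together with the numerators, on the components of
`Spec (N ⊗ R)` not containing `x`. -/
theorem IsGeneric.exists_spread [CharZero Ω] [Algebra.FiniteType k R]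
    {N : IntermediateField k Ω} (hN : N.FG) {x : R →ₐ[k] Ω} (hx : IsGeneric N x)
    {ι : Type*} [Finite ι] {c : ι → Ω}
    (hc : ∀ i, ∀ ρ : Gal(Ω/k), (∀ a ∈ N, ρ a = a) → (∀ r, ρ (x r) = x r) → ρ (c i) = c i) :
    ∃ (D : N ⊗[k] R) (C : ι → N ⊗[k] R), evalAt N x D ≠ 0 ∧
      ∀ y : R →ₐ[k] Ω, IsGeneric N y → (evalAt N y D = 0 ∧ ∀ i, evalAt N y (C i) = 0) ∨
        ∃ ρ : Gal(Ω/k), (∀ a ∈ N, ρ a = a) ∧ (∀ r, ρ (x r) = y r) ∧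
          ∀ i, evalAt N y D * ρ (c i) = evalAt N y (C i) := by
  obtain ⟨D, C, hD, hDC⟩ := exists_common_denominator
    fun i => exists_fraction_of_fixed htr hN x (hc i)
  have : Algebra.EssFiniteType k N := IntermediateField.essFiniteType_iff.mpr hN
  obtain ⟨d, hd, hd'⟩ := hx.exists_separating htr
  refine ⟨d * D, fun i => d * C i, by rw [map_mul]; exact mul_ne_zero hd hD, fun y hy => ?_⟩
  rcases hd' y hy with h | ⟨ρ, hρN, hρ⟩
  · exact .inl ⟨by rw [map_mul, h, zero_mul], fun i => by rw [map_mul, h, zero_mul]⟩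
  · refine .inr ⟨ρ, fun a ha => hρN ⟨a, ha⟩, hρ, fun i => ?_⟩
    have key : (ρ : Ω →ₐ[k] Ω).comp ((evalAt N x).restrictScalars k) =
        (evalAt N y).restrictScalars k := by
      ext a
      · simpa using hρN a
      · simp [hρ]
    have key' (b) : ρ (evalAt N x b) = evalAt N y b := DFunLike.congr_fun key b
    rw [map_mul, map_mul, ← key' D, ← key' (C i), ← hDC, map_mul, mul_assoc]

end Generic

/-! ### Descent of splittings from finitely generated fields -/

section DescentOfSplitting

variable {k Ω : Type u} [Field k] [Field Ω] [Algebra k Ω]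

/-- The `Ω`-valued point of a `k`-subalgebra `R` of `Ω` defined by an automorphism of `Ω`. -/
abbrev galPoint (R : Subalgebra k Ω) (σ : Gal(Ω/k)) : R →ₐ[k] Ω := (σ : Ω →ₐ[k] Ω).comp R.val

/-- A finitely generated subfield is the field of fractions of a finitely generated algebra. -/
lemma exists_subalgebra_of_fg {N : IntermediateField k Ω} (hN : N.FG) :
    ∃ R : Subalgebra k Ω, R.FG ∧ IntermediateField.adjoin k (R : Set Ω) = N := by
  obtain ⟨s, rfl⟩ := hN
  refine ⟨Algebra.adjoin k s, Subalgebra.fg_adjoin_finset s, ?_⟩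
  apply le_antisymm
  · rw [IntermediateField.adjoin_le_iff]
    exact IntermediateField.algebra_adjoin_le_adjoin k _
  · exact IntermediateField.adjoin.mono _ _ _ Algebra.subset_adjoin

lemma mem_fixingSubgroup_adjoin {S : Set Ω} {σ : Gal(Ω/k)} (h : ∀ r ∈ S, σ r = r) :
    σ ∈ (IntermediateField.adjoin k S).fixingSubgroup := by
  rw [← Subgroup.zpowers_le, ← IntermediateField.le_iff_le, IntermediateField.adjoin_le_iff]
  intro r hr
  have : Subgroup.zpowers σ ≤ MulAction.stabilizer Gal(Ω/k) r := by
    rw [Subgroup.zpowers_le]; exact h r hr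
  exact fun g => this g.2

lemma isGeneric_inv_mul {R : Subalgebra k Ω} {N : IntermediateField k Ω} {σ τ : Gal(Ω/k)}
    (hσ : IsGeneric (N.map (τ : Ω →ₐ[k] Ω)) (galPoint R σ)) :
    IsGeneric N (galPoint R (τ⁻¹ * σ)) := by
  refine IsGeneric.of_map (τ := τ) ?_
  have : (τ : Ω →ₐ[k] Ω).comp (galPoint R (τ⁻¹ * σ)) = galPoint R σ :=
    AlgHom.ext fun x => τ.apply_symm_apply (σ x)
  rwa [this]

lemma fg_map {N : IntermediateField k Ω} (hN : N.FG) (τ : Gal(Ω/k)) :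
    (N.map (τ : Ω →ₐ[k] Ω)).FG := by
  obtain ⟨s, rfl⟩ := hN
  rw [IntermediateField.adjoin_map]
  exact IntermediateField.fg_adjoin_of_finite (s.finite_toSet.image _)

lemma exists_isGeneric_gal [IsAlgClosed Ω] (htr : Cardinal.aleph0 ≤ Algebra.trdeg k Ω)
    {R : Subalgebra k Ω} (hR : R.FG) {N : IntermediateField k Ω} (hN : N.FG) :
    ∃ σ : Gal(Ω/k), IsGeneric N (galPoint R σ) := by
  have : Algebra.FiniteType k R := (Subalgebra.fg_iff_finiteType R).mp hR
  have : Algebra.EssFiniteType k N := IntermediateField.essFiniteType_iff.mpr hN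
  obtain ⟨x, hx⟩ := exists_isGeneric (R := R) htr N
  obtain ⟨ρ, hρ⟩ := exists_ringEquiv_extending (E := FractionRing R) htr
    (IsFractionRing.liftAlgHom (K := FractionRing R) (g := R.val)
      Subtype.val_injective)
    (IsFractionRing.liftAlgHom (K := FractionRing R) (g := x) hx.injective)
  refine ⟨ρ, ?_⟩
  convert hx
  ext r
  have h := hρ (algebraMap R _ r)
  have h1 := IsFractionRing.lift_algebraMap (K := FractionRing R)
    (g := R.val.toRingHom) Subtype.val_injective r
  have h2 := IsFractionRing.lift_algebraMap (K := FractionRing R) (g := x.toRingHom) hx.injective r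
  exact (congrArg ρ h1).symm.trans (h.trans h2)

variable {R : Subalgebra k Ω} {J : Type*} (r : Module.Basis J k R)
  {W : Type*} [AddCommGroup W] [Module Ω W]

/-- The evaluation at `σ` of an element `∑ w_j ⊗ r_j` of `W ⊗ R`, where `R` is a subalgebra of
`Ω` with basis `r`: it is `∑ σ(r_j) w_j`. -/
def evalVec (σ : Gal(Ω/k)) : (J →₀ W) →ₗ[Ω] W :=
  Finsupp.lsum Ω fun j => (σ (r j) : Ω) • LinearMap.id

@[simp] lemma evalVec_single (σ : Gal(Ω/k)) (j : J) (w : W) :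
    evalVec r σ (Finsupp.single j w) = σ (r j) • w := by
  simp [evalVec]

lemma act_evalVec {a : Gal(Ω/k) →* AddMonoid.End W} (ha : IsSemilinear Ω a) (τ σ : Gal(Ω/k))
    (w : J →₀ W) : a τ (evalVec r σ w) = evalVec r (τ * σ) (finsuppAct J a τ w) := by
  induction w using Finsupp.induction_linear with
  | zero => simp
  | add f g hf hg => rw [map_add, map_add, hf, hg, map_add, map_add]
  | single j w =>
    rw [evalVec_single, ha, finsuppAct_single, evalVec_single]
    rfl

lemma map_evalVec {W' : Type*} [AddCommGroup W'] [Module Ω W'] (f : W →ₗ[Ω] W') (σ : Gal(Ω/k))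
    (w : J →₀ W) : f (evalVec r σ w) = evalVec r σ (Finsupp.mapRange.linearMap f w) := by
  induction w using Finsupp.induction_linear with
  | zero => simp
  | add v w hv hw => rw [map_add, map_add, hv, hw, map_add, map_add]
  | single j w => simp

lemma exists_evalVec_eq (N : IntermediateField k Ω) (c : N ⊗[k] R) :
    ∃ b : J →₀ Ω, ∀ σ : Gal(Ω/k), evalAt N (galPoint R σ) c = evalVec r σ b := by
  induction c with
  | zero => exact ⟨0, fun σ => by simp⟩
  | add x y hx hy =>
    obtain ⟨b, hb⟩ := hx
    obtain ⟨c, hc⟩ := hy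
    exact ⟨b + c, fun σ => by rw [map_add, map_add, hb, hc]⟩
  | tmul a x =>
    refine ⟨(a : Ω) • (r.repr x).mapRange (algebraMap k Ω) (map_zero _), fun σ => ?_⟩
    rw [evalAt_tmul, map_smul, smul_eq_mul]
    congr 1
    conv_lhs => rw [← r.linearCombination_repr x]
    generalize r.repr x = y
    induction y using Finsupp.induction_linear with
    | zero => simp
    | add f g hf hg =>
      rw [map_add, map_add, hf, hg, Finsupp.mapRange_add (map_add _), map_add]
    | single j c => simp [Algebra.smul_def, mul_comm]

variable [IsAlgClosed Ω] [CharZero Ω] (htr : Cardinal.aleph0 ≤ Algebra.trdeg k Ω)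
include htr

lemma mem_range_algebraMap_of_forall_gal {x : Ω} (hx : ∀ σ : Gal(Ω/k), σ x = x) :
    x ∈ (algebraMap k Ω).range := by
  have : x ∈ (⊥ : IntermediateField k Ω) := mem_of_forall_gal htr
    (IntermediateField.fg_bot) fun σ _ => hx σ
  exact IntermediateField.mem_bot.mp this

/-- A vector with coefficients in `R` that vanishes at all sufficiently generic points is zero: for
scalars, such vectors form a stable subspace, which is spanned by elements of `R`. -/
theorem eq_zero_of_evalVec_eq_zero (hR : R.FG) {w : J →₀ W} {N : IntermediateField k Ω}
    (hN : N.FG) (h : ∀ σ : Gal(Ω/k), IsGeneric N (galPoint R σ) → evalVec r σ w = 0) : w = 0 := by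
  -- the scalar-valued vectors that vanish generically
  let P : Submodule Ω (J →₀ Ω) :=
    { carrier := {b | ∃ N : IntermediateField k Ω, N.FG ∧
        ∀ σ : Gal(Ω/k), IsGeneric N (galPoint R σ) → evalVec r σ b = 0}
      add_mem' := by
        rintro b c ⟨N, hN, hb⟩ ⟨N', hN', hc⟩
        refine ⟨N ⊔ N', IntermediateField.fg_sup hN hN', fun σ hσ => ?_⟩
        rw [map_add, hb σ (hσ.mono le_sup_left), hc σ (hσ.mono le_sup_right), add_zero]
      zero_mem' := ⟨⊥, IntermediateField.fg_bot, fun σ _ => map_zero _⟩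
      smul_mem' := by
        rintro c b ⟨N, hN, hb⟩
        exact ⟨N, hN, fun σ hσ => by rw [map_smul, hb σ hσ, smul_zero]⟩ }
  have hP : P = ⊥ := by
    rw [eq_bot_iff]
    refine ((isSplit_self (Γ := Gal(Ω/k)) (Ω := Ω)).finsupp.span_invariants_inter
      isSemilinear_self.finsupp P ?_).trans ?_
    -- `P` is stable
    · rintro τ b ⟨N, hN, hb⟩
      refine ⟨N.map (τ : Ω →ₐ[k] Ω), fg_map hN τ, fun σ hσ => ?_⟩
      have h1 := isGeneric_inv_mul hσ
      have h2 := act_evalVec r (isSemilinear_self (Γ := Gal(Ω/k)) (Ω := Ω)) τ (τ⁻¹ * σ) b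
      rw [hb _ h1, map_zero, mul_inv_cancel_left] at h2
      exact h2.symm
    · rw [Submodule.span_le]
      -- a fixed `b` has coefficients in `k`, so it is an element of `R`, and a generic point is
      -- injective on `R`
      rintro b ⟨hbi, N, hN, hb⟩
      obtain ⟨σ, hσ⟩ := exists_isGeneric_gal htr hR hN
      have h1 (j : J) : ∃ e : k, algebraMap k Ω e = b j :=
        mem_range_algebraMap_of_forall_gal htr fun σ => DFunLike.congr_fun (hbi σ) j
      choose e he using h1
      let y : J →₀ k := Finsupp.onFinset b.support e fun i hi => by
        rw [Finsupp.mem_support_iff, ← he i]; simpa using hi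
      have hy : b = y.mapRange (algebraMap k Ω) (map_zero _) := by
        ext j
        exact (he j).symm
      have h2 (y : J →₀ k) : evalVec r σ (y.mapRange (algebraMap k Ω) (map_zero _)) =
          galPoint R σ (Finsupp.linearCombination k r y) := by
        induction y using Finsupp.induction_linear with
        | zero => simp
        | add f g hf hg =>
          rw [map_add, map_add, ← hf, ← hg, Finsupp.mapRange_add (map_add _), map_add]
        | single j c => simp [Algebra.smul_def, mul_comm]
      have h3 := hb σ hσ
      rw [hy, h2, map_eq_zero_iff _ (σ.injective.comp Subtype.val_injective :
        Function.Injective (galPoint R σ))] at h3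
      rw [hy, linearIndependent_iff.mp r.linearIndependent _ h3]
      simp
  let e := Module.Basis.ofVectorSpace Ω W
  ext j
  apply e.repr.injective
  ext i
  have h1 : Finsupp.mapRange.linearMap (e.coord i) w ∈ P := ⟨N, hN, fun σ hσ => by
    rw [← map_evalVec, h σ hσ, map_zero]⟩
  rw [hP, Submodule.mem_bot] at h1
  simpa using DFunLike.congr_fun h1 j

/-- A semilinear representation of `Gal(Ω/k)` is split as soon as it is split over a finitely
generated extension of `k`. If `w` is fixed over `L = Frac R`, then `σ(w)` depends only on the
point `σ` of `Spec R`, and generically it is a rational function of it, with values in `W`. Its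
possible denominators form a stable subspace of `Ω ⊗ R`, hence one of them, `d₀`, lies in `R`;
then `σ ↦ σ(d₀) σ(w)` is the evaluation of an element of `W ⊗ R`, necessarily fixed, and
evaluation at the identity shows that `d₀ w` is a combination of fixed vectors. -/
theorem IsSplit.of_fg {a : Gal(Ω/k) →* AddMonoid.End W} (ha : IsSemilinear Ω a)
    {L : IntermediateField k Ω} (hL : L.FG)
    (h : IsSplit Ω (a.comp L.fixingSubgroup.subtype)) : IsSplit Ω a := by
  obtain ⟨R, hR, rfl⟩ := exists_subalgebra_of_fg hL
  set L := IntermediateField.adjoin k (R : Set Ω) with hLR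
  have : Algebra.FiniteType k R := (Subalgebra.fg_iff_finiteType R).mp hR
  obtain ⟨J, ⟨r⟩⟩ : ∃ J : Set R, Nonempty (Module.Basis J k R) :=
    ⟨_, ⟨Module.Basis.ofVectorSpace k R⟩⟩
  rw [IsSplit, eq_top_iff, ← h, Submodule.span_le]
  intro w hw
  -- the conjugate of `w` under `σ` only depends on the point of `R` defined by `σ`
  have hw' (σ τ : Gal(Ω/k)) (hστ : ∀ x ∈ R, σ x = τ x) : a σ w = a τ w := by
    have h1 : σ⁻¹ * τ ∈ L.fixingSubgroup := mem_fixingSubgroup_adjoin fun x hx => by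
      rw [AlgEquiv.mul_apply, ← hστ x hx]; exact σ.symm_apply_apply x
    have h2 : a (σ⁻¹ * τ) w = w := hw ⟨_, h1⟩
    calc a σ w = a σ (a (σ⁻¹ * τ) w) := by rw [h2]
      _ = a τ w := by rw [← act_mul, mul_inv_cancel_left]
  -- the denominators of the generic rational function `σ ↦ a σ w`
  let P : Submodule Ω (J →₀ Ω) :=
    { carrier := {b | ∃ (v : _ →₀ W) (N : IntermediateField k Ω), N.FG ∧
        ∀ σ : Gal(Ω/k), IsGeneric N (galPoint R σ) → evalVec r σ v = evalVec r σ b • a σ w}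
      add_mem' := by
        rintro b c ⟨v, N, hN, hb⟩ ⟨v', N', hN', hc⟩
        refine ⟨v + v', N ⊔ N', IntermediateField.fg_sup hN hN', fun σ hσ => ?_⟩
        rw [map_add, hb σ (hσ.mono le_sup_left), hc σ (hσ.mono le_sup_right), map_add, add_smul]
      zero_mem' := ⟨0, ⊥, IntermediateField.fg_bot, fun σ _ => by simp⟩
      smul_mem' := by
        rintro c b ⟨v, N, hN, hb⟩
        exact ⟨c • v, N, hN, fun σ hσ => by
          rw [map_smul, hb σ hσ, map_smul, smul_smul, smul_eq_mul]⟩ }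
  have hPst (τ : Gal(Ω/k)) (b) (hb : b ∈ P) :
      finsuppAct J (DistribMulAction.toAddMonoidEnd _ Ω) τ b ∈ P := by
    obtain ⟨v, N, hN, hb⟩ := hb
    refine ⟨finsuppAct J a τ v, N.map (τ : Ω →ₐ[k] Ω), fg_map hN τ, fun σ hσ => ?_⟩
    have h2 := act_evalVec r ha τ (τ⁻¹ * σ) v
    have h3 := act_evalVec r (isSemilinear_self (Γ := Gal(Ω/k)) (Ω := Ω)) τ (τ⁻¹ * σ) b
    rw [hb _ (isGeneric_inv_mul hσ), ha, mul_inv_cancel_left, ← act_mul, mul_inv_cancel_left] at h2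
    rw [mul_inv_cancel_left] at h3
    rw [← h2, ← h3]
    rfl
  -- the coordinates of a generic conjugate of `w` in a basis fixed over `L` are rational functions
  -- of the point, and their common denominator lies in `P`
  have hP0 : P ≠ ⊥ := by
    obtain ⟨σ₀, hσ₀⟩ := exists_isGeneric_gal htr hR hL
    obtain ⟨ι, e, he⟩ := h.exists_basis
    have he' (i) {ρ : Gal(Ω/k)} (hρ : ∀ y ∈ L, ρ y = y) : a ρ (e i) = e i :=
      he i ⟨ρ, (IntermediateField.mem_fixingSubgroup_iff _ _).mpr hρ⟩
    let c : (e.repr (a σ₀ w)).support → Ω := fun i => e.repr (a σ₀ w) i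
    obtain ⟨D, C, hD, hDC⟩ := hσ₀.exists_spread htr hL (c := c) (fun i ρ hρL hρ => by
      have h1 : a ρ (a σ₀ w) = a σ₀ w := by
        rw [← act_mul]
        exact hw' _ _ fun x hx => hρ ⟨x, hx⟩
      have h2 := repr_act (Γ := L.fixingSubgroup) (a := a.comp L.fixingSubgroup.subtype)
        (fun γ c w => ha γ c w) e he
        ⟨ρ, (IntermediateField.mem_fixingSubgroup_iff _ _).mpr hρL⟩ (a σ₀ w) i
      change e.repr (a ρ (a σ₀ w)) i = ρ (c i) at h2
      rw [← h2, h1])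
    obtain ⟨b, hb⟩ := exists_evalVec_eq r L D
    choose b' hb' using fun i => exists_evalVec_eq r L (C i)
    refine fun hP => hD ?_
    have hbP : b ∈ P := by
      refine ⟨∑ i : (e.repr (a σ₀ w)).support, Finsupp.mapRange.linearMap
        (LinearMap.toSpanSingleton Ω W (e i)) (b' i), L, hL, fun σ hσ => ?_⟩
      rw [map_sum]
      simp_rw [← map_evalVec, ← hb, ← hb', LinearMap.toSpanSingleton_apply]
      rcases hDC _ hσ with ⟨h1, h2⟩ | ⟨ρ, hρL, hρ, h2⟩
      · simp [h1, h2]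
      · have h3 : a σ w = a ρ (a σ₀ w) := by
          rw [← act_mul]
          exact hw' _ _ fun x hx => (hρ ⟨x, hx⟩).symm
        have h4 : a ρ (a σ₀ w) = ∑ i, ρ (c i) • e i := by
          conv_lhs => rw [← e.linearCombination_repr (a σ₀ w), Finsupp.linearCombination_apply,
            Finsupp.sum, map_sum, ← Finset.sum_coe_sort]
          refine Finset.sum_congr rfl fun i _ => ?_
          rw [ha, he' _ hρL]
          rfl
        rw [h3, h4, Finset.smul_sum]
        refine Finset.sum_congr rfl fun i _ => ?_
        rw [smul_smul, h2]
    rw [hP, Submodule.mem_bot] at hbP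
    rw [hb, hbP, map_zero]
  -- a nonzero fixed denominator `b`, and the corresponding numerator `v`
  obtain ⟨b, ⟨hbi, v, N, hN, hv⟩, hb0⟩ : ∃ b ∈ (invariants (finsuppAct J
      (DistribMulAction.toAddMonoidEnd Gal(Ω/k) Ω)) ∩ P : Set (J →₀ Ω)), b ≠ 0 := by
    by_contra! hcon
    apply hP0
    rw [eq_bot_iff]
    refine ((isSplit_self (Γ := Gal(Ω/k)) (Ω := Ω)).finsupp.span_invariants_inter
      isSemilinear_self.finsupp P hPst).trans ?_
    rw [Submodule.span_le]
    exact fun b hb => hcon b hb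
  -- `v` and its conjugates define the same function at generic points
  have hvinv : v ∈ invariants (finsuppAct J a) := by
    intro τ
    rw [← sub_eq_zero]
    refine eq_zero_of_evalVec_eq_zero r htr hR
      (IntermediateField.fg_sup hN (fg_map hN τ)) fun σ hσ => ?_
    have h2 := act_evalVec r ha τ (τ⁻¹ * σ) v
    have h3 := act_evalVec r (isSemilinear_self (Γ := Gal(Ω/k)) (Ω := Ω)) τ (τ⁻¹ * σ) b
    rw [hv _ (isGeneric_inv_mul (hσ.mono le_sup_right)), ha, mul_inv_cancel_left, ← act_mul,
      mul_inv_cancel_left] at h2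
    rw [mul_inv_cancel_left, hbi τ] at h3
    rw [map_sub, ← h2, hv σ (hσ.mono le_sup_left), ← h3]
    exact sub_self _
  -- the fixed `b` vanishes everywhere if it vanishes at the identity
  have hb1 : evalVec r 1 b ≠ 0 := by
    intro h0
    apply hb0
    refine eq_zero_of_evalVec_eq_zero r htr hR hN fun σ _ => ?_
    have h3 := act_evalVec r (isSemilinear_self (Γ := Gal(Ω/k)) (Ω := Ω)) σ 1 b
    rw [h0, map_zero, mul_one, hbi σ] at h3
    exact h3.symm
  -- the identity need not be generic; the relation is transported from a generic `σ` by `σ⁻¹`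
  have hev1 : evalVec r 1 v = evalVec r 1 b • w := by
    obtain ⟨σ, hσ⟩ := exists_isGeneric_gal htr hR hN
    have h2 := act_evalVec r ha σ⁻¹ σ v
    have h3 := act_evalVec r (isSemilinear_self (Γ := Gal(Ω/k)) (Ω := Ω)) σ⁻¹ σ b
    rw [inv_mul_cancel, hvinv σ⁻¹, hv σ hσ, ha, ← act_mul, inv_mul_cancel, map_one] at h2
    rw [inv_mul_cancel, hbi σ⁻¹] at h3
    rw [← h2, ← h3]
    rfl
  have hwv : w = (evalVec r 1 b)⁻¹ • evalVec r 1 v := by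
    rw [hev1, smul_smul, inv_mul_cancel₀ hb1, one_smul]
  rw [SetLike.mem_coe, hwv]
  refine Submodule.smul_mem _ _ ?_
  rw [← v.sum_single, Finsupp.sum, map_sum]
  refine Submodule.sum_mem _ fun j _ => ?_
  rw [evalVec_single]
  exact Submodule.smul_mem _ _ (Submodule.subset_span fun τ => DFunLike.congr_fun (hvinv τ) j)

end DescentOfSplitting

/-! ### Glueing of quotients -/

section Glueing

/-- A compatible family of quotients `q_j : Y_j → F_j` of the members of a directed family of open
subschemes `Y_j` of a scheme `X` glues to a quotient of `X`. -/
theorem exists_glued_quotient {X : Scheme.{u}} {J : Type u} [Preorder J] (Y F : J ⥤ Scheme.{u})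
    (v : ∀ j, Y.obj j ⟶ X) [∀ j, IsOpenImmersion (v j)]
    (hv : ∀ {i j : J} (h : i ⟶ j), Y.map h ≫ v j = v i) (q : Y ⟶ F)
    (hq : ∀ {i j : J} (h : i ⟶ j), IsPullback (Y.map h) (q.app i) (q.app j) (F.map h))
    (hqs : ∀ j, Function.Surjective (q.app j))
    (hF : ∀ {i j : J} (h : i ⟶ j), IsOpenImmersion (F.map h))
    (hcov : ∀ x : X, ∃ j y, v j y = x)
    (hdir : ∀ (i j : J) (y : Y.obj i) (y' : Y.obj j), v i y = v j y' →
      ∃ (l : J) (hi : l ⟶ i) (hj : l ⟶ j) (z : Y.obj l), Y.map hi z = y ∧ Y.map hj z = y') :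
    ∃ (X₀ : Scheme.{u}) (ι : ∀ j, F.obj j ⟶ X₀) (p : X ⟶ X₀),
      (∀ j, IsOpenImmersion (ι j)) ∧ (∀ x, ∃ j y, ι j y = x) ∧
      (∀ j, IsPullback (q.app j) (v j) (ι j) p) ∧
      (∀ (T : Scheme.{u}) (t : ∀ j, F.obj j ⟶ T),
        (∀ {i j : J} (h : i ⟶ j), F.map h ≫ t j = t i) → ∃ f : X₀ ⟶ T, ∀ j, ι j ≫ f = t j) := by
  -- the quotients of the intersections of the `Y_j` are the intersections of the quotients `F_j`
  have hFl : (F ⋙ Scheme.forget).IsLocallyDirected := by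
    constructor
    intro i j m fi fj xi xj hx
    obtain ⟨yi, rfl⟩ := hqs i xi
    have h1 : q.app m (Y.map fi yi) = F.map fj xj := by
      rw [← Scheme.Hom.comp_apply, q.naturality, Scheme.Hom.comp_apply]
      exact hx
    obtain ⟨z, hz, rfl⟩ := Scheme.exists_preimage_of_isPullback (hq fj) (Y.map fi yi) xj h1
    obtain ⟨l, hi, hj, y, rfl, rfl⟩ := hdir i j yi z (by
      rw [← hv fi, ← hv fj, Scheme.Hom.comp_apply, Scheme.Hom.comp_apply, hz])
    refine ⟨l, hi, hj, q.app l y, ?_, ?_⟩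
    · change F.map hi (q.app l y) = _
      rw [← Scheme.Hom.comp_apply, ← q.naturality, Scheme.Hom.comp_apply]
    · change F.map hj (q.app l y) = _
      rw [← Scheme.Hom.comp_apply, ← q.naturality, Scheme.Hom.comp_apply]
  -- the `Y_j` form a locally directed open cover of `X`
  let 𝒰 : X.OpenCover :=
    { I₀ := J
      X := Y.obj
      f := v
      mem₀ := by
        rw [Scheme.presieve₀_mem_precoverage_iff]
        exact ⟨fun x => by obtain ⟨j, y, h⟩ := hcov x; exact ⟨j, y, h⟩, inferInstance⟩ }
  let _ : Category 𝒰.I₀ := inferInstanceAs (Category J)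
  have hYo {i j : J} (h : i ⟶ j) : IsOpenImmersion (Y.map h) := by
    have : IsOpenImmersion (Y.map h ≫ v j) := by rw [hv]; infer_instance
    exact .of_comp _ (v j)
  let _ : 𝒰.LocallyDirected :=
    { trans h := Y.map h
      trans_id i := Y.map_id i
      trans_comp f g := Y.map_comp f g
      w h := hv h
      directed {i j} x := by
        obtain ⟨l, hi, hj, z, h1, h2⟩ := hdir i j (pullback.fst (v i) (v j) x)
          (pullback.snd (v i) (v j) x) (by
            rw [← Scheme.Hom.comp_apply, ← Scheme.Hom.comp_apply, pullback.condition])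
        refine ⟨l, hi, hj, z, ?_⟩
        apply (pullback.fst (v i) (v j)).isOpenEmbedding.injective
        rw [← Scheme.Hom.comp_apply, pullback.lift_fst, h1]
      property_trans h := hYo h }
  let p : X ⟶ colimit F := 𝒰.glueMorphismsOfLocallyDirected
    (fun j : J => q.app j ≫ colimit.ι F j) (by
      intro i j h
      change Y.map h ≫ q.app j ≫ colimit.ι F j = _
      rw [q.naturality_assoc, colimit.w])
  have hp (j : J) : v j ≫ p = q.app j ≫ colimit.ι F j :=
    𝒰.map_glueMorphismsOfLocallyDirected _ _ j
  -- the quotient is the colimit of the `F_j`, which exists for locally directed diagrams of open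
  -- immersions
  refine ⟨colimit F, colimit.ι F, p, inferInstance,
    fun x => Scheme.IsLocallyDirected.ι_jointly_surjective F x, fun j => ?_, fun T t ht => ?_⟩
  · refine IsOpenImmersion.isPullback _ _ _ _ (hp j) ?_
    apply le_antisymm
    · rintro x ⟨y, hy⟩
      obtain ⟨i, z, rfl⟩ := hcov x
      rw [← Scheme.Hom.comp_apply, hp, Scheme.Hom.comp_apply,
        Scheme.IsLocallyDirected.ι_eq_ι_iff] at hy
      -- two points with the same image in the colimit come from a common `F_l`
      obtain ⟨l, fj, fi, y', h1, h2⟩ := hy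
      obtain ⟨w, rfl, -⟩ := Scheme.exists_preimage_of_isPullback (hq fi) z y' h2.symm
      refine ⟨Y.map fj w, ?_⟩
      rw [← Scheme.Hom.comp_apply, ← Scheme.Hom.comp_apply, hv, hv]
    · rintro _ ⟨y, rfl⟩
      refine ⟨q.app j y, ?_⟩
      rw [← Scheme.Hom.comp_apply, ← Scheme.Hom.comp_apply, hp]
  · exact ⟨colimit.desc F ⟨T, { app := t, naturality := fun i j h => by simpa using ht h }⟩,
      fun j => colimit.ι_desc _ _⟩

end Glueing

/-! ### Semilinear actions on schemes and their quotients -/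

section Sections

variable {A : Type u} [CommRing A] {X : Scheme.{u}}

lemma le_preimage_top {X Y : Scheme.{u}} (f : X ⟶ Y) (U : X.Opens) : U ≤ f ⁻¹ᵁ ⊤ := le_top

/-- The structure map `A → Γ(X, U)` of an open subscheme of a scheme over `A`. -/
def sectHom (f : X ⟶ Spec (.of A)) (U : X.Opens) : CommRingCat.of A ⟶ Γ(X, U) :=
  (Scheme.ΓSpecIso (.of A)).inv ≫ f.appLE ⊤ U (le_preimage_top f U)

lemma sectHom_appLE {B : Type u} [CommRing B] {Y : Scheme.{u}} {f : X ⟶ Spec (.of A)}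
    {g : Y ⟶ Spec (.of B)} {φ : CommRingCat.of A ⟶ CommRingCat.of B} {h : Y ⟶ X}
    (hh : h ≫ f = g ≫ Spec.map φ) {U : X.Opens} {V : Y.Opens} (e : V ≤ h ⁻¹ᵁ U) :
    sectHom f U ≫ h.appLE U V e = φ ≫ sectHom g V := by
  have h0 (g₁ g₂ : Y ⟶ Spec (.of A)) (hg : g₁ = g₂) : g₁.appLE ⊤ V (le_preimage_top g₁ V) =
      g₂.appLE ⊤ V (le_preimage_top g₂ V) := by rw [hg]
  have h1 : f.appLE ⊤ U (le_preimage_top f U) ≫ h.appLE U V e =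
      (Spec.map φ).appTop ≫ g.appLE ⊤ V (le_preimage_top g V) :=
    (Scheme.Hom.appLE_comp_appLE h f ⊤ U V _ _).trans
      ((h0 _ _ hh).trans (Scheme.Hom.comp_appLE g (Spec.map φ) ⊤ V _))
  rw [sectHom, Category.assoc, h1, sectHom, Scheme.ΓSpecIso_inv_naturality_assoc]

lemma sectHom_map {f : X ⟶ Spec (.of A)} {U V : X.Opens} (i : op U ⟶ op V) :
    sectHom f U ≫ X.presheaf.map i = sectHom f V := by
  rw [sectHom, Category.assoc, Scheme.Hom.appLE_map, sectHom]

lemma fromSpec_comp {f : X ⟶ Spec (.of A)} {U : X.Opens} (hU : IsAffineOpen U) :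
    hU.fromSpec ≫ f = Spec.map (sectHom f U) := by
  rw [sectHom, Spec.map_comp, ← (isAffineOpen_top (Spec (.of A))).SpecMap_appLE_fromSpec f hU
      (le_preimage_top f U),
    IsAffineOpen.fromSpec_top, Scheme.isoSpec_Spec_inv]

/-- The sections of a scheme over `A`, considered as an `A`-algebra. -/
def Sect (_ : X ⟶ Spec (.of A)) (U : X.Opens) : Type u := Γ(X, U)

instance (f : X ⟶ Spec (.of A)) (U : X.Opens) : CommRing (Sect f U) :=
  inferInstanceAs (CommRing Γ(X, U))

instance (f : X ⟶ Spec (.of A)) (U : X.Opens) : Algebra A (Sect f U) :=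
  RingHom.toAlgebra (S := Sect f U) (sectHom f U).hom

/-- The restriction of sections. -/
def resSect (f : X ⟶ Spec (.of A)) {U V : X.Opens} (h : V ≤ U) : Sect f U →ₐ[A] Sect f V :=
  { (X.presheaf.map (homOfLE h).op).hom with
    commutes' := fun a => congr($(sectHom_map (f := f) (homOfLE h).op).hom a) }

end Sections

section Action

variable {Γ : Type*} [Group Γ] {Ω : Type u} [Field Ω] [MulSemiringAction Γ Ω]

variable (Ω) in
/-- The endomorphism of `Spec Ω` defined by an element of a group acting on `Ω`. -/
abbrev specAct (γ : Γ) : Spec (.of Ω) ⟶ Spec (.of Ω) :=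
  Spec.map (CommRingCat.ofHom (MulSemiringAction.toRingHom Γ Ω γ))

/-- A semilinear action of a group `Γ` on a scheme over `Ω`: automorphisms of the scheme over the
automorphisms of `Spec Ω` defined by the elements of `Γ`. As `Spec` reverses arrows, it is an action
from the right. -/
structure SchemeAction (Γ : Type*) [Group Γ] [MulSemiringAction Γ Ω] {X : Scheme.{u}}
    (f : X ⟶ Spec (.of Ω)) where
  /-- The automorphism defined by an element of `Γ`. -/
  hom : Γ → (X ⟶ X)
  hom_one : hom 1 = 𝟙 X
  hom_comp (γ δ : Γ) : hom γ ≫ hom δ = hom (γ * δ)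
  hom_over (γ : Γ) : hom γ ≫ f = f ≫ specAct Ω γ

namespace SchemeAction

variable {X : Scheme.{u}} {f : X ⟶ Spec (.of Ω)} (ρ : SchemeAction Γ f)

/-- The restriction of an action to a subgroup. -/
def restrict (H : Subgroup Γ) : SchemeAction H f where
  hom γ := ρ.hom γ
  hom_one := ρ.hom_one
  hom_comp γ δ := ρ.hom_comp γ δ
  hom_over γ := ρ.hom_over γ

instance (γ : Γ) : IsIso (ρ.hom γ) :=
  ⟨ρ.hom γ⁻¹, by rw [ρ.hom_comp, mul_inv_cancel, ρ.hom_one],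
    by rw [ρ.hom_comp, inv_mul_cancel, ρ.hom_one]⟩

/-- An open subset is stable if it is mapped to itself by the action. -/
def Stable (U : X.Opens) : Prop := ∀ γ, ρ.hom γ ⁻¹ᵁ U = U

variable {ρ}

lemma stable_of_le {U : X.Opens} (h : ∀ γ, U ≤ ρ.hom γ ⁻¹ᵁ U) : ρ.Stable U := by
  intro γ
  refine le_antisymm ?_ (h γ)
  intro x hx
  have h1 : ρ.hom γ⁻¹ (ρ.hom γ x) ∈ U := h γ⁻¹ hx
  rw [← Scheme.Hom.comp_apply, ρ.hom_comp, mul_inv_cancel, ρ.hom_one] at h1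
  exact h1

lemma Stable.inf {U V : X.Opens} (hU : ρ.Stable U) (hV : ρ.Stable V) : ρ.Stable (U ⊓ V) :=
  fun γ => by rw [Scheme.Hom.preimage_inf, hU γ, hV γ]

/-- The action of an element of `Γ` on the sections over a stable open subset. -/
def actHom {U : X.Opens} (hU : ρ.Stable U) (γ : Γ) : Sect f U →+* Sect f U :=
  ((ρ.hom γ).appLE U U (hU γ).ge).hom

/-- The semilinear action on the sections over a stable open subset. -/
def act {U : X.Opens} (hU : ρ.Stable U) : Γ →* AddMonoid.End (Sect f U) where
  toFun γ := (actHom hU γ).toAddMonoidHom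
  map_one' := by
    ext s
    have h (g : X ⟶ X) (hg : g = 𝟙 X) (e : U ≤ g ⁻¹ᵁ U) : g.appLE U U e = 𝟙 _ := by
      subst hg
      rw [Scheme.Hom.appLE, Scheme.Hom.id_app]
      exact (Category.id_comp _).trans (X.presheaf.map_id _)
    exact congr($(h _ ρ.hom_one (hU 1).ge).hom s)
  map_mul' γ δ := by
    ext s
    have : (ρ.hom δ).appLE U U (hU δ).ge ≫ (ρ.hom γ).appLE U U (hU γ).ge =
        (ρ.hom (γ * δ)).appLE U U (hU _).ge := by
      rw [Scheme.Hom.appLE_comp_appLE]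
      congr 1
      exact ρ.hom_comp γ δ
    exact congr($(this).hom s).symm

lemma act_apply {U : X.Opens} (hU : ρ.Stable U) (γ : Γ) (s : Sect f U) :
    act hU γ s = actHom hU γ s := rfl

lemma isSemilinear_act {U : X.Opens} (hU : ρ.Stable U) : IsSemilinear Ω (act hU) := by
  intro γ c s
  rw [act_apply, Algebra.smul_def, map_mul, Algebra.smul_def]
  congr 1
  exact congr($(sectHom_appLE (ρ.hom_over γ) (hU γ).ge).hom c)

lemma resSect_act {U V : X.Opens} (hU : ρ.Stable U) (hV : ρ.Stable V) (h : V ≤ U) (γ : Γ)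
    (s : Sect f U) : resSect f h (act hU γ s) = act hV γ (resSect f h s) := by
  have : (ρ.hom γ).appLE U U (hU γ).ge ≫ X.presheaf.map (homOfLE h).op =
      X.presheaf.map (homOfLE h).op ≫ (ρ.hom γ).appLE V V (hV γ).ge := by
    rw [Scheme.Hom.appLE_map, Scheme.Hom.map_appLE]
  exact congr($(this).hom s)

/-- The invariant sections over a stable open subset. -/
def invRing {U : X.Opens} (hU : ρ.Stable U) : Subring (Sect f U) where
  carrier := {s | ∀ γ, actHom hU γ s = s}
  mul_mem' h h' γ := by rw [map_mul, h γ, h' γ]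
  one_mem' γ := map_one _
  add_mem' h h' γ := by rw [map_add, h γ, h' γ]
  zero_mem' γ := map_zero _
  neg_mem' h γ := by rw [map_neg, h γ]

lemma resSect_mem_invRing {U V : X.Opens} (hU : ρ.Stable U) (hV : ρ.Stable V) (h : V ≤ U)
    {s : Sect f U} (hs : s ∈ invRing hU) : resSect f h s ∈ invRing hV := fun γ => by
  have := resSect_act hU hV h γ s
  rw [act_apply, hs γ] at this
  exact this.symm

variable (ρ) in
/-- An open subset is good if it is affine and stable, and its ring of functions is spanned by
invariant functions. -/
structure Good (U : X.Opens) : Prop where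
  affine : IsAffineOpen U
  stable : ρ.Stable U
  split : IsSplit Ω (act stable)

/-- The functions on the intersection of two affine open subsets of a separated scheme are sums of
products of functions on the two subsets. -/
lemma exists_sum_of_isSeparated [IsSeparated f] {U V : X.Opens} (hU : IsAffineOpen U)
    (hV : IsAffineOpen V) (s : Sect f (U ⊓ V)) :
    ∃ t : Sect f U ⊗[Ω] Sect f V, Algebra.TensorProduct.lift (resSect f inf_le_left)
      (resSect f (inf_le_right : U ⊓ V ≤ V)) (fun _ _ => .all _ _) t = s := by
  have : X.IsSeparated := ⟨by
    rw [← terminal.comp_from f]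
    have : IsSeparated (terminal.from (Spec (.of Ω))) := inferInstance
    infer_instance⟩
  have hW : IsAffineOpen (U ⊓ V) := hU.inf hV
  let φ := Algebra.TensorProduct.lift (resSect f inf_le_left)
      (resSect f (inf_le_right : U ⊓ V ≤ V)) (fun _ _ => .all _ _)
  let i₁ : Spec Γ(X, U ⊓ V) ⟶ Spec Γ(X, U) := Spec.map (X.presheaf.map (homOfLE inf_le_left).op)
  let i₂ : Spec Γ(X, U ⊓ V) ⟶ Spec Γ(X, V) := Spec.map (X.presheaf.map (homOfLE inf_le_right).op)
  have hi₁ : i₁ ≫ hU.fromSpec = hW.fromSpec := hU.map_fromSpec hW _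
  have hi₂ : i₂ ≫ hV.fromSpec = hW.fromSpec := hV.map_fromSpec hW _
  have : IsOpenImmersion i₁ := by
    have : IsOpenImmersion (i₁ ≫ hU.fromSpec) := by rw [hi₁]; infer_instance
    exact .of_comp _ hU.fromSpec
  -- `U ⊓ V` is the fibre product of `U` and `V` over `X`
  have hpb : IsPullback i₁ i₂ hU.fromSpec hV.fromSpec := by
    refine (IsOpenImmersion.isPullback i₂ i₁ hV.fromSpec hU.fromSpec (hi₁.trans hi₂.symm) ?_).flip
    ext x
    constructor
    · intro hx
      have h1 : hU.fromSpec x ∈ hW.fromSpec.opensRange := by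
        rw [hW.opensRange_fromSpec]
        exact ⟨hU.opensRange_fromSpec.le ⟨x, rfl⟩, hV.opensRange_fromSpec.le hx⟩
      obtain ⟨y, hy⟩ := h1
      refine ⟨y, hU.fromSpec.isOpenEmbedding.injective ?_⟩
      rw [← Scheme.Hom.comp_apply, hi₁, hy]
    · rintro ⟨y, rfl⟩
      refine ⟨i₂ y, ?_⟩
      rw [← Scheme.Hom.comp_apply, ← Scheme.Hom.comp_apply, hi₁, hi₂]
  let φ' : CommRingCat.of (Sect f U ⊗[Ω] Sect f V) ⟶ Γ(X, U ⊓ V) :=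
    CommRingCat.ofHom (S := Γ(X, U ⊓ V)) φ.toRingHom
  -- `U ×[X] V → U ×[Ω] V` is a base change of the diagonal of `X`
  have hcl : IsClosedImmersion (Spec.map φ') := by
    let m := pullback.mapDesc hU.fromSpec hV.fromSpec f
    let c : pullback (hU.fromSpec ≫ f) (hV.fromSpec ≫ f) ≅
      pullback (Spec.map (sectHom f U)) (Spec.map (sectHom f V)) :=
      pullback.congrHom (fromSpec_comp hU) (fromSpec_comp hV)
    let e : pullback (Spec.map (sectHom f U)) (Spec.map (sectHom f V)) ≅
      Spec (.of (Sect f U ⊗[Ω] Sect f V)) := pullbackSpecIso Ω (Sect f U) (Sect f V)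
    have h : Spec.map φ' ≫ e.inv = hpb.isoPullback.hom ≫ m ≫ c.hom := by
      apply pullback.hom_ext
      · have h1 : (hpb.isoPullback.hom ≫ m ≫ c.hom) ≫ pullback.fst _ _ = i₁ := by
          have hm : m ≫ pullback.fst _ _ = pullback.fst _ _ :=
            (pullback.lift_fst _ _ _).trans (Category.comp_id _)
          have hc : c.hom ≫ pullback.fst _ _ = pullback.fst _ _ :=
            (pullback.lift_fst _ _ _).trans (Category.comp_id _)
          rw [Category.assoc, Category.assoc, hc, hm, hpb.isoPullback_hom_fst]
        let ψ : Γ(X, U) ⟶ .of (Sect f U ⊗[Ω] Sect f V) :=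
          CommRingCat.ofHom (R := Γ(X, U)) (algebraMap (Sect f U) (Sect f U ⊗[Ω] Sect f V))
        have h2 : e.inv ≫ pullback.fst (Spec.map (sectHom f U)) (Spec.map (sectHom f V)) =
            Spec.map ψ := pullbackSpecIso_inv_fst ..
        rw [h1, Category.assoc, h2, ← Spec.map_comp]
        congr 1
        ext s
        have h3 (s : Sect f U) : φ (s ⊗ₜ 1) = resSect f inf_le_left s := by
          rw [Algebra.TensorProduct.lift_tmul, map_one, mul_one]
        exact h3 s
      · have h1 : (hpb.isoPullback.hom ≫ m ≫ c.hom) ≫ pullback.snd _ _ = i₂ := by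
          have hm : m ≫ pullback.snd _ _ = pullback.snd _ _ :=
            (pullback.lift_snd _ _ _).trans (Category.comp_id _)
          have hc : c.hom ≫ pullback.snd _ _ = pullback.snd _ _ :=
            (pullback.lift_snd _ _ _).trans (Category.comp_id _)
          rw [Category.assoc, Category.assoc, hc, hm, hpb.isoPullback_hom_snd]
        let ψ : Γ(X, V) ⟶ .of (Sect f U ⊗[Ω] Sect f V) :=
          CommRingCat.ofHom (R := Γ(X, V)) (Algebra.TensorProduct.includeRight :
              Sect f V →ₐ[Ω] Sect f U ⊗[Ω] Sect f V).toRingHom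
        have h2 : e.inv ≫ pullback.snd (Spec.map (sectHom f U)) (Spec.map (sectHom f V)) =
            Spec.map ψ := pullbackSpecIso_inv_snd ..
        rw [h1, Category.assoc, h2, ← Spec.map_comp]
        congr 1
        ext s
        have h3 (s : Sect f V) : φ (1 ⊗ₜ s) = resSect f inf_le_right s := by
          rw [Algebra.TensorProduct.lift_tmul, map_one, one_mul]
        exact h3 s
    have hm : IsClosedImmersion m := inferInstance
    have : IsClosedImmersion (Spec.map φ' ≫ e.inv) := by rw [h]; infer_instance
    exact .of_comp _ e.inv
  have hs := (IsClosedImmersion.isAffine_surjective_of_isAffine (Spec.map φ')).2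
  have hs' : Function.Surjective φ' := by
    have h1 := Scheme.ΓSpecIso_inv_naturality φ'
    have h2 : φ' = (Scheme.ΓSpecIso _).inv ≫ (Spec.map φ').appTop ≫ (Scheme.ΓSpecIso _).hom := by
      rw [← Category.assoc, ← h1, Category.assoc, Iso.inv_hom_id, Category.comp_id]
    rw [h2]
    exact (ConcreteCategory.bijective_of_isIso (Scheme.ΓSpecIso _).hom).2.comp
      (hs.comp (ConcreteCategory.bijective_of_isIso (Scheme.ΓSpecIso _).inv).2)
  exact hs' s

/-- The intersection of two good open subsets of a separated scheme is good: the tensor product of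
the rings of functions maps onto the ring of functions of the intersection. -/
lemma Good.inf [IsSeparated f] {U V : X.Opens} (hU : ρ.Good U) (hV : ρ.Good V) :
    ρ.Good (U ⊓ V) where
  affine := by
    have : X.IsSeparated := ⟨by
      rw [← terminal.comp_from f]
      have : IsSeparated (terminal.from (Spec (.of Ω))) := inferInstance
      infer_instance⟩
    exact hU.affine.inf hV.affine
  stable := hU.stable.inf hV.stable
  split := by
    rw [IsSplit, eq_top_iff]
    intro s _
    obtain ⟨t, rfl⟩ := exists_sum_of_isSeparated hU.affine hV.affine s
    set P := Submodule.span Ω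
      (invariants (act (hU.stable.inf hV.stable)) : Set (Sect f (U ⊓ V)))
    -- the span of the invariant functions is closed under products
    have hP (a b : Sect f (U ⊓ V)) (ha : a ∈ P) (hb : b ∈ P) : a * b ∈ P := by
      have : P = Subalgebra.toSubmodule (Algebra.adjoin Ω
          (invRing (hU.stable.inf hV.stable) : Set (Sect f (U ⊓ V)))) := by
        rw [Algebra.adjoin_eq_span]
        exact congrArg
          (fun M : Submonoid (Sect f (U ⊓ V)) => Submodule.span Ω (M : Set (Sect f (U ⊓ V))))
          (Submonoid.closure_eq (invRing (hU.stable.inf hV.stable)).toSubmonoid).symm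
      rw [this, Subalgebra.mem_toSubmodule] at ha hb ⊢
      exact mul_mem ha hb
    have hres {W : X.Opens} (hW : ρ.Good W) (h : U ⊓ V ≤ W) (s : Sect f W) :
        resSect f h s ∈ P := by
      have h1 : s ∈ Submodule.span Ω (invariants (act hW.stable) : Set (Sect f W)) :=
        hW.split.ge trivial
      have h2 : Submodule.span Ω (invariants (act hW.stable) : Set (Sect f W)) ≤
          P.comap (resSect f h).toLinearMap := by
        rw [Submodule.span_le]
        exact fun x hx => Submodule.subset_span
          (resSect_mem_invRing hW.stable (hU.stable.inf hV.stable) h hx)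
      exact h2 h1
    induction t with
    | zero => simp
    | add x y hx hy => rw [map_add]; exact add_mem (hx trivial) (hy trivial)
    | tmul a b =>
      rw [Algebra.TensorProduct.lift_tmul]
      exact hP _ _ (hres hU _ a) (hres hV _ b)

variable {E : Type u} [Field E] [Algebra E Ω]

/-- The invariant functions on a stable open subset, as an algebra over the fixed field. -/
def invAlg (hE : ∀ (c : E) (γ : Γ), γ • algebraMap E Ω c = algebraMap E Ω c) {U : X.Opens}
    (hU : ρ.Stable U) : E →+* invRing hU :=
  ((algebraMap Ω (Sect f U)).comp (algebraMap E Ω)).codRestrict _ fun c γ => by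
    rw [RingHom.comp_apply]
    refine congr($(sectHom_appLE (ρ.hom_over γ) (hU γ).ge).hom (algebraMap E Ω c)).trans ?_
    exact congrArg (algebraMap Ω (Sect f U)) (hE c γ)

/-- A good affine open subset is the base change of the spectrum of its ring of invariant
functions. -/
lemma Good.isPullback {U : X.Opens} (hU : ρ.Good U)
    (hE : ∀ (c : E) (γ : Γ), γ • algebraMap E Ω c = algebraMap E Ω c)
    (hE' : ∀ c : Ω, (∀ γ : Γ, γ • c = c) → c ∈ (algebraMap E Ω).range) :
    IsPullback (Spec.map (CommRingCat.ofHom (S := Γ(X, U)) (invRing hU.stable).subtype))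
      (Spec.map (sectHom f U)) (Spec.map (CommRingCat.ofHom (invAlg hE hU.stable)))
      (specAlg E Ω) := by
  let _ : Algebra E (invRing hU.stable) := (invAlg hE hU.stable).toAlgebra
  let _ : Algebra E (Sect f U) := ((algebraMap Ω (Sect f U)).comp (algebraMap E Ω)).toAlgebra
  have : IsScalarTower E Ω (Sect f U) := .of_algebraMap_eq' rfl
  have : IsScalarTower E (invRing hU.stable) (Sect f U) := .of_algebraMap_eq' rfl
  have h1 : IsBaseChange Ω
      (IsScalarTower.toAlgHom E (invRing hU.stable) (Sect f U)).toLinearMap := by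
    refine hU.split.isBaseChange (isSemilinear_act hU.stable) hE' _ Subtype.val_injective
      fun w => ?_
    exact ⟨fun ⟨x, hx⟩ => hx ▸ x.2, fun h => ⟨⟨w, h⟩, rfl⟩⟩
  have h2 : Algebra.IsPushout E Ω (invRing hU.stable) (Sect f U) := ⟨h1⟩
  have := (CommRingCat.isPushout_of_isPushout E Ω (invRing hU.stable) (Sect f U))
  exact (isPullback_SpecMap_of_isPushout _ _ _ _ this).flip

end SchemeAction

/-- A square is a pullback square if it is so over the members of an open cover of the target. -/
lemma isPullback_of_forall_isPullback {X X₀ S S₀ : Scheme.{u}} {p : X ⟶ X₀} {f : X ⟶ S}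
    {f₀ : X₀ ⟶ S₀} {s : S ⟶ S₀} {J : Type u} {Y F : J → Scheme.{u}} (ι : ∀ j, F j ⟶ X₀)
    (hι : ∀ j, IsOpenImmersion (ι j)) (hcov : ∀ x, ∃ j y, ι j y = x) (q : ∀ j, Y j ⟶ F j)
    (v : ∀ j, Y j ⟶ X) (h₁ : ∀ j, IsPullback (q j) (v j) (ι j) p)
    (h₂ : ∀ j, IsPullback (q j) (v j ≫ f) (ι j ≫ f₀) s) : IsPullback p f f₀ s := by
  let 𝒰 : X₀.OpenCover :=
    { I₀ := J
      X := F
      f := ι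
      mem₀ := by
        rw [Scheme.presieve₀_mem_precoverage_iff]
        exact ⟨fun x => by obtain ⟨j, y, h⟩ := hcov x; exact ⟨j, y, h⟩, hι⟩ }
  refine Scheme.isPullback_of_openCover _ _ _ _ 𝒰 fun j => ?_
  refine (h₂ j).of_iso (h₁ j).flip.isoPullback (.refl _) (.refl _) (.refl _) ?_ ?_ ?_ ?_
  · exact (Category.comp_id _).trans ((h₁ j).flip.isoPullback_hom_snd).symm
  · refine (Category.comp_id _).trans ?_
    exact (congrArg (· ≫ f) ((h₁ j).flip.isoPullback_hom_fst)).symm.trans (Category.assoc _ _ _)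
  · simp [𝒰]
  · simp

/-- A separated scheme over `Ω` with a semilinear action of `Γ` that is covered by good open
subsets is the base change of a scheme over the fixed field `E` of `Γ`. -/
theorem SchemeAction.exists_quotient {E : Type u} [Field E] [Algebra E Ω] {X : Scheme.{u}}
    {f : X ⟶ Spec (.of Ω)} [IsSeparated f] (ρ : SchemeAction Γ f)
    (hE : ∀ (c : E) (γ : Γ), γ • algebraMap E Ω c = algebraMap E Ω c)
    (hE' : ∀ c : Ω, (∀ γ : Γ, γ • c = c) → c ∈ (algebraMap E Ω).range)
    (hcov : ∀ x, ∃ U, ρ.Good U ∧ x ∈ U) :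
    ∃ (X₀ : Scheme.{u}) (f₀ : X₀ ⟶ Spec (.of E)) (p : X ⟶ X₀),
      IsPullback p f f₀ (specAlg E Ω) ∧ ∀ γ, ρ.hom γ ≫ p = p := by
  -- the good open subsets are closed under intersections; `Y` is the diagram of their inclusions,
  -- and `F` the diagram of the spectra of their rings of invariants
  let J := {U : X.Opens // ρ.Good U}
  have leU {i j : J} (h : i ⟶ j) : i.1 ≤ j.1 := leOfHom h
  let ri {i j : J} (h : i ⟶ j) : invRing j.2.stable →+* invRing i.2.stable :=
    ((resSect f (leU h)).toRingHom.comp (invRing j.2.stable).subtype).codRestrict _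
      fun s => resSect_mem_invRing j.2.stable i.2.stable (leU h) s.2
  let Y : J ⥤ Scheme.{u} :=
    { obj j := Spec Γ(X, j.1)
      map h := Spec.map (X.presheaf.map (homOfLE (leU h)).op)
      map_id j := by
        refine Eq.trans ?_ (Spec.map_id _)
        exact congrArg Spec.map (X.presheaf.map_id _)
      map_comp g h := by
        rw [← Spec.map_comp, ← X.presheaf.map_comp]
        rfl }
  let F : J ⥤ Scheme.{u} :=
    { obj j := Spec (.of (invRing j.2.stable))
      map h := Spec.map (CommRingCat.ofHom (ri h))
      map_id j := by
        refine Eq.trans ?_ (Spec.map_id _)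
        congr 1
        ext s
        exact congr($(X.presheaf.map_id (op j.1)).hom s.1)
      map_comp {i j l} g h := by
        rw [← Spec.map_comp, ← CommRingCat.ofHom_comp]
        congr 2
        ext s
        exact congr($(X.presheaf.map_comp (homOfLE (leU h)).op (homOfLE (leU g)).op).hom s.1) }
  let qq (j : J) : Y.obj j ⟶ F.obj j :=
    Spec.map (CommRingCat.ofHom (S := Γ(X, j.1)) (invRing j.2.stable).subtype)
  let q : Y ⟶ F :=
    { app := qq
      naturality i j h := by
        refine (Spec.map_comp _ _).symm.trans (Eq.trans ?_ (Spec.map_comp _ _))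
        rfl }
  let v (j : J) : Y.obj j ⟶ X := j.2.affine.fromSpec
  have hv {i j : J} (h : i ⟶ j) : Y.map h ≫ v j = v i :=
    j.2.affine.map_fromSpec i.2.affine _
  have hsq (j : J) : IsPullback (qq j) (v j ≫ f)
      (Spec.map (CommRingCat.ofHom (invAlg hE j.2.stable))) (specAlg E Ω) := by
    rw [fromSpec_comp j.2.affine]
    exact j.2.isPullback hE hE'
  have hFf {i j : J} (h : i ⟶ j) : F.map h ≫ Spec.map (CommRingCat.ofHom (invAlg hE j.2.stable)) =
      Spec.map (CommRingCat.ofHom (invAlg hE i.2.stable)) := by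
    refine (Spec.map_comp _ _).symm.trans (congrArg Spec.map ?_)
    ext c
    exact (resSect f (leU h)).commutes (algebraMap E Ω c)
  have hq {i j : J} (h : i ⟶ j) : IsPullback (Y.map h) (q.app i) (q.app j) (F.map h) := by
    have h1 : IsPullback (qq i) (Y.map h ≫ v j ≫ f)
        (F.map h ≫ Spec.map (CommRingCat.ofHom (invAlg hE j.2.stable))) (specAlg E Ω) := by
      rw [hFf h, ← Category.assoc, hv h]
      exact hsq i
    exact (IsPullback.of_right h1.flip (q.naturality h) (hsq j).flip)
  have hqs (j : J) : Function.Surjective (q.app j) := by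
    have : Surjective (qq j) :=
      MorphismProperty.of_isPullback (P := @Surjective) (hsq j).flip inferInstance
    exact this.1
  have hqf (j : J) : Flat (qq j) :=
      MorphismProperty.of_isPullback (P := @Flat) (hsq j).flip inferInstance
  -- being an open immersion descends along the faithfully flat morphism `Y j ⟶ F j`
  have hF {i j : J} (h : i ⟶ j) : IsOpenImmersion (F.map h) := by
    have : IsOpenImmersion (Y.map h) := by
      have : IsOpenImmersion (Y.map h ≫ v j) := by rw [hv]; infer_instance
      exact .of_comp _ (v j)
    refine MorphismProperty.of_isPullback_of_descendsAlong (P := IsOpenImmersion)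
      (Q := @Surjective ⊓ @Flat ⊓ @QuasiCompact) (hq h) ⟨⟨⟨hqs j⟩, hqf j⟩, ?_⟩ this
    infer_instance
  obtain ⟨X₀, ι, p, hι, hs, hpb, hdesc⟩ := exists_glued_quotient Y F v hv q hq hqs hF
    (fun x => by
      obtain ⟨U, hU, hx⟩ := hcov x
      have : x ∈ hU.affine.fromSpec.opensRange := hU.affine.opensRange_fromSpec.ge hx
      obtain ⟨y, hy⟩ := this
      exact ⟨⟨U, hU⟩, y, hy⟩)
    (fun i j y y' hyy => by
      let l : J := ⟨i.1 ⊓ j.1, i.2.inf j.2⟩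
      have hx : v i y ∈ l.1 := ⟨i.2.affine.opensRange_fromSpec.le ⟨y, rfl⟩,
        hyy ▸ j.2.affine.opensRange_fromSpec.le ⟨y', rfl⟩⟩
      obtain ⟨z, hz⟩ : v i y ∈ (v l).opensRange := l.2.affine.opensRange_fromSpec.ge hx
      have hl₁ : l ≤ i := (inf_le_left : i.1 ⊓ j.1 ≤ i.1)
      have hl₂ : l ≤ j := (inf_le_right : i.1 ⊓ j.1 ≤ j.1)
      refine ⟨l, homOfLE hl₁, homOfLE hl₂, z, ?_, ?_⟩
      · apply (v i).isOpenEmbedding.injective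
        rw [← Scheme.Hom.comp_apply, hv, hz]
      · apply (v j).isOpenEmbedding.injective
        rw [← Scheme.Hom.comp_apply, hv, hz, hyy])
  obtain ⟨f₀, hf₀⟩ := hdesc _ (fun j => Spec.map (CommRingCat.ofHom (invAlg hE j.2.stable))) hFf
  refine ⟨X₀, f₀, p, ?_, ?_⟩
  · refine isPullback_of_forall_isPullback ι hι hs qq v hpb fun j => ?_
    rw [hf₀]
    exact hsq j
  · intro γ
    apply Scheme.hom_ext_of_forall
    intro x
    obtain ⟨U, hU, hx⟩ := hcov x
    refine ⟨U, hx, ?_⟩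
    let j : J := ⟨U, hU⟩
    have h1 : v j ≫ ρ.hom γ = Spec.map ((ρ.hom γ).appLE U U (hU.stable γ).ge) ≫ v j :=
      (hU.affine.SpecMap_appLE_fromSpec (ρ.hom γ) hU.affine (hU.stable γ).ge).symm
    have h2 : v j ≫ ρ.hom γ ≫ p = v j ≫ p := by
      rw [← Category.assoc, h1, Category.assoc, ← (hpb j).w, ← Category.assoc]
      congr 1
      refine (Spec.map_comp _ _).symm.trans (congrArg Spec.map ?_)
      ext s
      exact s.2 γ
    rw [← hU.affine.isoSpec_hom_fromSpec, Category.assoc, Category.assoc]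
    exact congrArg (hU.affine.isoSpec.hom ≫ ·) h2

end Action

/-! ### Good open subsets -/

section BasicOpen

lemma mem_basicOpen_iff {X : Scheme.{u}} {U : X.Opens} {x : X} (hx : x ∈ U) (s : Γ(X, U)) :
    x ∈ X.basicOpen s ↔ IsUnit (X.presheaf.germ U x hx s) := X.mem_basicOpen s x hx

lemma basicOpen_appLE {X Y : Scheme.{u}} (h : X ⟶ Y) {U : Y.Opens} {V : X.Opens}
    (e : V ≤ h ⁻¹ᵁ U) (s : Γ(Y, U)) :
    X.basicOpen ((h.appLE U V e).hom s) = V ⊓ h ⁻¹ᵁ Y.basicOpen s := by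
  rw [Scheme.preimage_basicOpen, ← X.basicOpen_res _ (homOfLE e).op]
  rfl

/-- The functions on `U` that do not vanish only at points of `O`. -/
def supportedIn {A : Type u} [CommRing A] {X : Scheme.{u}} (f : X ⟶ Spec (.of A)) (U O : X.Opens) :
    Ideal (Sect f U) where
  carrier := {s | X.basicOpen (U := U) s ≤ O}
  add_mem' {s t} hs ht := by
    intro x hx
    have hxU : x ∈ U := X.basicOpen_le _ hx
    have := (mem_basicOpen_iff hxU _).mp hx
    erw [map_add] at this
    rcases IsLocalRing.isUnit_or_isUnit_of_isUnit_add this with h | h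
    · exact hs ((mem_basicOpen_iff hxU _).mpr h)
    · exact ht ((mem_basicOpen_iff hxU _).mpr h)
  zero_mem' := by
    have : X.basicOpen (0 : Γ(X, U)) = ⊥ := X.basicOpen_zero U
    exact this.le.trans bot_le
  smul_mem' s t ht := by
    have : X.basicOpen (U := U) (s * t) = X.basicOpen (U := U) s ⊓ X.basicOpen (U := U) t :=
      X.basicOpen_mul (U := U) s t
    exact (this.le.trans inf_le_right).trans ht

lemma mem_supportedIn {A : Type u} [CommRing A] {X : Scheme.{u}} {f : X ⟶ Spec (.of A)}
    {U O : X.Opens} {s : Sect f U} : s ∈ supportedIn f U O ↔ X.basicOpen (U := U) s ≤ O := Iff.rfl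

/-- The functions on `U` vanishing at a point of `U` form a proper ideal. -/
def vanishingAt {A : Type u} [CommRing A] {X : Scheme.{u}} (f : X ⟶ Spec (.of A)) (U : X.Opens)
    (x : X) : Ideal (Sect f U) where
  carrier := {s | x ∉ X.basicOpen (U := U) s}
  add_mem' {s t} hs ht hx := by
    have hxU : x ∈ U := X.basicOpen_le _ hx
    have := (mem_basicOpen_iff hxU _).mp hx
    erw [map_add] at this
    rcases IsLocalRing.isUnit_or_isUnit_of_isUnit_add this with h | h
    · exact hs ((mem_basicOpen_iff hxU _).mpr h)
    · exact ht ((mem_basicOpen_iff hxU _).mpr h)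
  zero_mem' := by
    have : X.basicOpen (0 : Γ(X, U)) = ⊥ := X.basicOpen_zero U
    exact fun hx => (this.le hx)
  smul_mem' s t ht hx := by
    have : X.basicOpen (U := U) (s * t) = X.basicOpen (U := U) s ⊓ X.basicOpen (U := U) t :=
      X.basicOpen_mul (U := U) s t
    exact ht (this.le hx).2

end BasicOpen

namespace SchemeAction

variable {Γ : Type*} [Group Γ] {Ω : Type u} [Field Ω] [MulSemiringAction Γ Ω]
variable {X : Scheme.{u}} {f : X ⟶ Spec (.of Ω)} {ρ : SchemeAction Γ f}

/-- The action defined by a homomorphism of groups. -/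
def comap {Γ' : Type*} [Group Γ'] [MulSemiringAction Γ' Ω] (ρ : SchemeAction Γ f)
    (φ : Γ' →* Γ) (h : ∀ γ (c : Ω), φ γ • c = γ • c) : SchemeAction Γ' f where
  hom γ := ρ.hom (φ γ)
  hom_one := by rw [map_one, ρ.hom_one]
  hom_comp γ δ := by rw [map_mul, ρ.hom_comp]
  hom_over γ := by
    have : MulSemiringAction.toRingHom Γ Ω (φ γ) = MulSemiringAction.toRingHom Γ' Ω γ :=
      RingHom.ext (h γ)
    rw [ρ.hom_over, specAct, specAct, this]

/-- Open subsets remain good for an action through fewer automorphisms. -/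
lemma Good.of_forall_exists {Γ' : Type*} [Group Γ'] [MulSemiringAction Γ' Ω]
    {ρ' : SchemeAction Γ' f} (h : ∀ γ', ∃ γ, ρ'.hom γ' = ρ.hom γ) {U : X.Opens} (hU : ρ.Good U) :
    ρ'.Good U where
  affine := hU.affine
  stable γ' := by
    obtain ⟨γ, hγ⟩ := h γ'
    rw [hγ, hU.stable]
  split := by
    rw [IsSplit, eq_top_iff, ← hU.split]
    refine Submodule.span_mono fun s hs γ' => ?_
    obtain ⟨γ, hγ⟩ := h γ'
    have h0 (g g' : X ⟶ X) (hg : g = g') (e : U ≤ g ⁻¹ᵁ U) (e' : U ≤ g' ⁻¹ᵁ U) :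
        g.appLE U U e = g'.appLE U U e' := by subst hg; rfl
    exact (congr($(h0 _ _ hγ _ (hU.stable γ).ge).hom s)).trans (hs γ)

lemma preimage_basicOpen {U : X.Opens} (hU : ρ.Stable U) (γ : Γ) (s : Sect f U) :
    ρ.hom γ ⁻¹ᵁ X.basicOpen (U := U) s = X.basicOpen (U := U) (actHom hU γ s) := by
  have := basicOpen_appLE (ρ.hom γ) (hU γ).ge s
  rw [inf_eq_right.mpr] at this
  · exact this.symm
  · conv_rhs => rw [← hU γ]
    exact Scheme.Hom.preimage_mono _ (X.basicOpen_le _)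

/-- A stable open subset is covered by the complements of zero sets of invariant functions. -/
lemma Good.exists_basicOpen_le {U : X.Opens} (hU : ρ.Good U) {O : X.Opens} (hO : ρ.Stable O) {x : X}
    (hxU : x ∈ U) (hxO : x ∈ O) :
    ∃ a ∈ invRing hU.stable, x ∈ X.basicOpen (U := U) a ∧ X.basicOpen (U := U) a ≤ O := by
  by_contra! hcon
  obtain ⟨s, hs, hxs⟩ := hU.affine.exists_basicOpen_le ⟨x, hxO⟩ hxU
  -- the functions supported in the stable set `O` are spanned by invariant ones, which all vanish
  -- at `x` by assumption
  have h1 := hU.split.span_invariants_inter (isSemilinear_act hU.stable)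
    ((supportedIn f U O).restrictScalars Ω) (by
      intro γ s hs
      rw [Submodule.restrictScalars_mem, mem_supportedIn] at hs ⊢
      rw [act_apply, ← preimage_basicOpen, ← hO γ]
      exact Scheme.Hom.preimage_mono _ hs)
  have h2 : Submodule.span Ω (invariants (act hU.stable) ∩ (supportedIn f U O).restrictScalars Ω :
      Set (Sect f U)) ≤ (vanishingAt f U x).restrictScalars Ω := by
    rw [Submodule.span_le]
    exact fun a ha hx => hcon a ha.1 hx ha.2
  exact h2 (h1 (x := (s : Sect f U)) hs) hxs

/-- The complement of the zero set of an invariant function on a good open subset is good. -/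
lemma Good.basicOpen {U : X.Opens} (hU : ρ.Good U) {a : Sect f U} (ha : a ∈ invRing hU.stable) :
    ρ.Good (X.basicOpen (U := U) a) where
  affine := hU.affine.basicOpen a
  stable γ := by rw [preimage_basicOpen hU.stable, ha γ]
  split := by
    have hst : ρ.Stable (X.basicOpen (U := U) a) := fun γ => by
      rw [preimage_basicOpen hU.stable, ha γ]
    have hle : X.basicOpen (U := U) a ≤ U := X.basicOpen_le _
    have hua : IsUnit (resSect f hle a) := X.toRingedSpace.isUnit_res_basicOpen (U := U) a
    obtain ⟨v, hv⟩ := hua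
    have hai := resSect_mem_invRing hU.stable hst hle ha
    -- `a⁻¹` is invariant, and every function on the basic open set is `a⁻ⁿ b` with `b` a function
    -- on `U`
    have hvi : ((v⁻¹ : (Sect f (X.basicOpen (U := U) a))ˣ) : Sect f _) ∈ invRing hst := by
      intro γ
      have h1 : actHom hst γ v⁻¹.val * v = 1 := by
        conv_lhs => rw [hv, ← hai γ, ← hv]
        rw [← map_mul, Units.inv_mul, map_one]
      rw [← mul_one (actHom hst γ _), ← v.mul_inv, ← mul_assoc, h1, one_mul]
    rw [IsSplit, eq_top_iff]
    intro s _
    have := hU.affine.isLocalization_basicOpen a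
    obtain ⟨⟨b, ⟨_, n, rfl⟩⟩, hb⟩ := @IsLocalization.surj _ _ _ _ _
      (X.presheaf.map (homOfLE hle).op).hom.toAlgebra this s
    have hb' : s * (v : Sect f _) ^ n = resSect f hle b := by
      rw [hv, ← map_pow]
      exact hb
    have hs : s = (v⁻¹ : (Sect f (X.basicOpen (U := U) a))ˣ) ^ n * resSect f hle b := by
      rw [← hb', mul_comm s, ← mul_assoc, ← mul_pow, Units.inv_mul, one_pow, one_mul]
    rw [hs]
    have h1 : b ∈ Submodule.span Ω (invariants (act hU.stable) : Set (Sect f U)) :=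
      hU.split.ge trivial
    have h2 : Submodule.span Ω (invariants (act hU.stable) : Set (Sect f U)) ≤
        (Submodule.span Ω (invariants (act hst) : Set (Sect f _))).comap
          ((LinearMap.mulLeft Ω ((v⁻¹ : (Sect f (X.basicOpen (U := U) a))ˣ) ^ n :
            Sect f (X.basicOpen (U := U) a))).comp (resSect f hle).toLinearMap) := by
      rw [Submodule.span_le]
      intro c hc
      refine Submodule.subset_span ?_
      exact (invRing hst).mul_mem ((invRing hst).pow_mem hvi n)
        (resSect_mem_invRing hU.stable hst hle hc)
    exact h2 h1

/-- The representation on the functions on a quasi-compact stable open subset of a scheme covered by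
good open subsets is split. -/
lemma isSplit_of_isCompact (hcov : ∀ x, ∃ U, ρ.Good U ∧ x ∈ U) {O : X.Opens} (hO : ρ.Stable O)
    (hc : IsCompact (O : Set X)) : IsSplit Ω (act hO) := by
  -- `O` is covered by finitely many good open subsets `D x`, and functions on `O` embed
  -- equivariantly into the product of the rings of functions on the `D x`
  have hx (x : O) : ∃ D : X.Opens, ρ.Good D ∧ x.1 ∈ D ∧ D ≤ O := by
    obtain ⟨U, hU, hx⟩ := hcov x
    obtain ⟨a, ha, hxa, hle⟩ := hU.exists_basicOpen_le hO hx x.2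
    exact ⟨_, hU.basicOpen ha, hxa, hle⟩
  choose D hD hxD hDO using hx
  obtain ⟨t, ht⟩ := hc.elim_finite_subcover (fun x => (D x : Set X)) (fun x => (D x).2)
    (fun x hx => Set.mem_iUnion.mpr ⟨⟨x, hx⟩, hxD _⟩)
  let a' : Γ →* AddMonoid.End (∀ x : t, Sect f (D x)) :=
    { toFun γ := AddMonoidHom.pi fun x => (act (hD x).stable γ).comp (Pi.evalAddMonoidHom _ x)
      map_one' := by
        ext w x
        change act (hD x).stable 1 (w x) = w x
        rw [map_one]; rfl
      map_mul' γ δ := by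
        ext w x
        change act (hD x).stable (γ * δ) (w x) = act (hD x).stable γ (act (hD x).stable δ (w x))
        rw [map_mul]; rfl }
  have ha' : IsSplit Ω a' := .pi (a := fun x : t => act (hD x).stable)
    (fun x => (hD x).split) fun γ w x => rfl
  refine ha'.of_injective ?_ (LinearMap.pi fun x : t => (resSect f (hDO x)).toLinearMap) ?_ ?_
  · intro γ c w
    ext x
    exact isSemilinear_act (hD x).stable γ c (w x)
  · intro s s' hss
    refine TopCat.Sheaf.eq_of_locally_eq' X.sheaf (fun x : t => D x) O (fun x => homOfLE (hDO x))
      ?_ s s' fun x => ?_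
    · intro x hx
      obtain ⟨i, hi, hxi⟩ := Set.mem_iUnion₂.mp (ht hx)
      exact TopologicalSpace.Opens.mem_iSup.mpr ⟨⟨i, hi⟩, hxi⟩
    · exact congrFun hss x
  · intro γ s
    ext x
    exact resSect_act hO (hD x).stable (hDO x) γ s

end SchemeAction

section Galois

variable {k Ω : Type u} [Field k] [Field Ω] [Algebra k Ω]
variable {X : Scheme.{u}} {f : X ⟶ Spec (.of Ω)}

/-- An affine open subset that is stable under the Galois group is good, provided that the scheme
is covered by open subsets that are good for the action of the group of a finitely generated
extension. -/
theorem SchemeAction.good_of_stable [IsAlgClosed Ω] [CharZero Ω]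
    (htr : Cardinal.aleph0 ≤ Algebra.trdeg k Ω) {ρ : SchemeAction Gal(Ω/k) f}
    {L : IntermediateField k Ω} (hL : L.FG)
    (hcov : ∀ x, ∃ U, (ρ.restrict L.fixingSubgroup).Good U ∧ x ∈ U) {O : X.Opens}
    (hO : ρ.Stable O) (hOa : IsAffineOpen O) : ρ.Good O where
  affine := hOa
  stable := hO
  split := by
    have hO' : (ρ.restrict L.fixingSubgroup).Stable O := fun γ => hO γ
    exact .of_fg htr (isSemilinear_act hO) hL (isSplit_of_isCompact hcov hO' hOa.isCompact)

end Galois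

section Quotient

variable {Γ : Type*} [Group Γ] {Ω : Type u} [Field Ω] [MulSemiringAction Γ Ω]
variable {E : Type u} [Field E] [Algebra E Ω]
variable {X X₀ : Scheme.{u}} {f : X ⟶ Spec (.of Ω)} {f₀ : X₀ ⟶ Spec (.of E)} {p : X ⟶ X₀}

/-- The functions on the inverse image of an affine open subset under an extension of scalars. -/
lemma isBaseChange_sect (hp : IsPullback p f f₀ (specAlg E Ω)) {W : X₀.Opens}
    (hW : IsAffineOpen W) :
    IsPushout (sectHom f₀ W) (CommRingCat.ofHom (algebraMap E Ω))
      (p.app W) (sectHom f (p ⁻¹ᵁ W)) := by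
  have h1 := (isIso_pushoutSection_iff hp (US := ⊤) (UT := ⊤) (UX := W) (UY := p ⁻¹ᵁ W)
    le_top le_top (by simp)).mp (isIso_pushoutSection_of_isAffineOpen hp _ _ _
      (isAffineOpen_top _) (isAffineOpen_top _) hW)
  refine h1.of_iso (Scheme.ΓSpecIso _) (.refl _) (Scheme.ΓSpecIso _) (.refl _) ?_ ?_ ?_ ?_
  · simp [sectHom]
  · have : (specAlg E Ω).appLE ⊤ ⊤ le_top = (specAlg E Ω).appTop :=
      (Scheme.Hom.app_eq_appLE _).symm
    rw [this]
    exact Scheme.ΓSpecIso_naturality _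
  · simp [Scheme.Hom.app_eq_appLE]
  · simp [sectHom]

/-- The functions on the inverse image of an affine open subset under an extension of scalars have
a basis consisting of functions on that subset. -/
lemma isBaseChange_app (hp : IsPullback p f f₀ (specAlg E Ω)) {W : X₀.Opens}
    (hW : IsAffineOpen W) :
    ∃ (g : Sect f₀ W →+* Sect f (p ⁻¹ᵁ W)) (_ : ∀ s, g s = (p.app W).hom s)
      (ι : Type u) (b₀ : Module.Basis ι E (Sect f₀ W))
      (b : Module.Basis ι Ω (Sect f (p ⁻¹ᵁ W))), (∀ i, b i = g (b₀ i)) ∧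
        ∀ (c : E) s, algebraMap E Ω c • g s = g (c • s) := by
  let g : Sect f₀ W →+* Sect f (p ⁻¹ᵁ W) := (p.app W).hom
  let _ : Algebra E (Sect f (p ⁻¹ᵁ W)) :=
    ((algebraMap Ω (Sect f (p ⁻¹ᵁ W))).comp (algebraMap E Ω)).toAlgebra
  have : IsScalarTower E Ω (Sect f (p ⁻¹ᵁ W)) := .of_algebraMap_eq' rfl
  let _ : Algebra (Sect f₀ W) (Sect f (p ⁻¹ᵁ W)) := g.toAlgebra
  have : IsScalarTower E (Sect f₀ W) (Sect f (p ⁻¹ᵁ W)) :=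
    .of_algebraMap_eq fun c => congr($((isBaseChange_sect hp hW).w).hom c).symm
  have h : IsPushout (CommRingCat.ofHom (algebraMap E (Sect f₀ W)))
      (CommRingCat.ofHom (algebraMap E Ω))
      (CommRingCat.ofHom (algebraMap (Sect f₀ W) (Sect f (p ⁻¹ᵁ W))))
      (CommRingCat.ofHom (algebraMap Ω (Sect f (p ⁻¹ᵁ W)))) := isBaseChange_sect hp hW
  have h' : Algebra.IsPushout E Ω (Sect f₀ W) (Sect f (p ⁻¹ᵁ W)) :=
    CommRingCat.isPushout_iff_isPushout.mp h.flip
  let b₀ := Module.Basis.ofVectorSpace E (Sect f₀ W)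
  refine ⟨g, fun _ => rfl, _, b₀, h'.out.basis b₀, fun i => h'.out.basis_apply b₀ i,
    fun c s => ?_⟩
  rw [Algebra.smul_def, Algebra.smul_def, map_mul]
  congr 1
  exact congr($((isBaseChange_sect hp hW).w).hom c).symm

variable {ρ : SchemeAction Γ f}

lemma SchemeAction.stable_preimage (hρ : ∀ γ, ρ.hom γ ≫ p = p) (W : X₀.Opens) :
    ρ.Stable (p ⁻¹ᵁ W) := fun γ => by
  rw [← Scheme.Hom.comp_preimage, hρ]

lemma app_mem_invRing (hρ : ∀ γ, ρ.hom γ ≫ p = p) (W : X₀.Opens) (s : Γ(X₀, W)) :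
    (p.app W).hom s ∈ SchemeAction.invRing (SchemeAction.stable_preimage hρ W) := fun γ => by
  have : p.appLE W (p ⁻¹ᵁ W) le_rfl ≫ (ρ.hom γ).appLE (p ⁻¹ᵁ W) (p ⁻¹ᵁ W)
      (SchemeAction.stable_preimage hρ W γ).ge = p.appLE W (p ⁻¹ᵁ W) le_rfl := by
    rw [Scheme.Hom.appLE_comp_appLE]
    congr 1
    exact hρ γ
  rw [← Scheme.Hom.app_eq_appLE] at this
  exact congr($(this).hom s)

/-- If `X` is the base change of `X₀` and `Γ` acts trivially on `X₀`, then the inverse images of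
affine open subsets are good. -/
lemma good_preimage (hp : IsPullback p f f₀ (specAlg E Ω)) (hρ : ∀ γ, ρ.hom γ ≫ p = p)
    {W : X₀.Opens} (hW : IsAffineOpen W) : ρ.Good (p ⁻¹ᵁ W) where
  affine := by
    have : IsAffineHom p := MorphismProperty.of_isPullback (P := @IsAffineHom) hp.flip inferInstance
    exact hW.preimage p
  stable := SchemeAction.stable_preimage hρ W
  split := by
    obtain ⟨g, hg, ι, b₀, b, hb, -⟩ := isBaseChange_app hp hW
    rw [IsSplit, eq_top_iff, ← b.span_eq]
    refine Submodule.span_mono ?_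
    rintro _ ⟨i, rfl⟩ γ
    rw [hb, hg]
    exact app_mem_invRing hρ W (b₀ i) γ

/-- The invariant functions on the inverse image of an affine open subset are the functions on that
subset: the coordinates of an invariant function in an invariant basis are invariant. -/
lemma exists_app_eq_of_mem_invRing (hp : IsPullback p f f₀ (specAlg E Ω))
    (hρ : ∀ γ, ρ.hom γ ≫ p = p)
    (hE' : ∀ c : Ω, (∀ γ : Γ, γ • c = c) → c ∈ (algebraMap E Ω).range)
    {W : X₀.Opens} (hW : IsAffineOpen W) {s : Sect f (p ⁻¹ᵁ W)}
    (hs : s ∈ SchemeAction.invRing (SchemeAction.stable_preimage hρ W)) :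
    ∃ s₀ : Γ(X₀, W), (p.app W).hom s₀ = s := by
  obtain ⟨g, hg, ι, b₀, b, hb, hgl⟩ := isBaseChange_app hp hW
  have hst := SchemeAction.stable_preimage hρ W
  have hc (i : ι) : ∃ e : E, algebraMap E Ω e = b.repr s i := by
    refine hE' _ fun γ => ?_
    rw [← repr_act (SchemeAction.isSemilinear_act hst) b (fun i γ => ?_)]
    · exact congrArg (fun t => b.repr t i) (hs γ)
    · rw [hb, hg]
      exact app_mem_invRing hρ W (b₀ i) γ
  choose e he using hc
  refine ⟨(∑ i ∈ (b.repr s).support, e i • b₀ i : Sect f₀ W), ?_⟩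
  rw [← hg, map_sum]
  conv_rhs => rw [← b.linearCombination_repr s, Finsupp.linearCombination_apply, Finsupp.sum]
  refine Finset.sum_congr rfl fun i _ => ?_
  rw [← hgl, he, hb]

/-- A stable open subset of the base change of `X₀` is the inverse image of an open subset
of `X₀`. -/
theorem exists_preimage_eq_of_stable (hp : IsPullback p f f₀ (specAlg E Ω))
    (hρ : ∀ γ, ρ.hom γ ≫ p = p)
    (hE' : ∀ c : Ω, (∀ γ : Γ, γ • c = c) → c ∈ (algebraMap E Ω).range)
    {O : X.Opens} (hO : ρ.Stable O) : ∃ O₀ : X₀.Opens, p ⁻¹ᵁ O₀ = O := by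
  -- the largest open subset with inverse image contained in `O`
  refine ⟨sSup {O' | p ⁻¹ᵁ O' ≤ O}, ?_⟩
  apply le_antisymm
  · intro x hx
    obtain ⟨O', hO', hx⟩ := TopologicalSpace.Opens.mem_sSup.mp (show p x ∈ sSup _ from hx)
    exact hO' hx
  · intro x hx
    obtain ⟨_, ⟨W, hW, rfl⟩, hxW, -⟩ :=
      X₀.isBasis_affineOpens.exists_subset_of_mem_open (Set.mem_univ (p x)) isOpen_univ
    -- the invariant function cutting out a neighbourhood of `x` is defined on `X₀`
    obtain ⟨a, ha, hxa, hle⟩ := (good_preimage hp hρ hW).exists_basicOpen_le hO hxW hx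
    obtain ⟨a₀, rfl⟩ := exists_app_eq_of_mem_invRing hp hρ hE' hW ha
    have h1 := Scheme.preimage_basicOpen p a₀
    refine TopologicalSpace.Opens.mem_sSup.mpr ⟨X₀.basicOpen a₀, h1.le.trans hle, ?_⟩
    exact h1.ge hxa

end Quotient

/-! ### Families of conjugates of an open subset -/

section Family

variable {k Ω : Type u} [Field k] [Field Ω] [Algebra k Ω]
variable {X : Scheme.{u}} (f : X ⟶ Spec (.of Ω)) (R : Subalgebra k Ω)

/-- The product over `k` of a scheme over `Ω` with the spectrum of a subalgebra `R` of `Ω`. -/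
abbrev Fam : Scheme.{u} :=
  pullback (f ≫ specAlg k Ω) (Spec.map (CommRingCat.ofHom (algebraMap k R)))

/-- The projection to the scheme over `Ω`. -/
abbrev Fam.fst : Fam f R ⟶ X := pullback.fst _ _

/-- The projection to the spectrum of `R`. -/
abbrev Fam.snd : Fam f R ⟶ Spec (.of R) := pullback.snd _ _

variable {R}

lemma specMap_comp_algebraMap (x : R →ₐ[k] Ω) :
    Spec.map (CommRingCat.ofHom x.toRingHom) ≫ Spec.map (CommRingCat.ofHom (algebraMap k R)) =
      specAlg k Ω := by
  rw [← Spec.map_comp, ← CommRingCat.ofHom_comp]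
  congr 2
  exact x.comp_algebraMap

/-- The inclusion of the fibre over an `Ω`-valued point `x` of `R`. -/
def Fam.fibre (x : R →ₐ[k] Ω) : X ⟶ Fam f R :=
  pullback.lift (𝟙 X) (f ≫ Spec.map (CommRingCat.ofHom x.toRingHom)) (by
    rw [Category.id_comp, Category.assoc, specMap_comp_algebraMap])

@[simp] lemma Fam.fibre_fst (x : R →ₐ[k] Ω) :
    fibre f x ≫ fst f R = 𝟙 X := pullback.lift_fst _ _ _

@[simp] lemma Fam.fibre_snd (x : R →ₐ[k] Ω) :
    fibre f x ≫ snd f R = f ≫ Spec.map (CommRingCat.ofHom x.toRingHom) := pullback.lift_snd _ _ _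

variable {f} (ρ : SchemeAction Gal(Ω/k) f)

lemma specAct_comp_specAlg (τ : Gal(Ω/k)) : specAct Ω τ ≫ specAlg k Ω = specAlg k Ω :=
  specAut_comp_specAlg τ

variable (R) in
/-- The automorphism of the family induced by the action on the scheme and the trivial action
on `R`. -/
def Fam.actionHom (τ : Gal(Ω/k)) : Fam f R ⟶ Fam f R :=
  pullback.lift (fst f R ≫ ρ.hom τ) (snd f R) (by
    rw [Category.assoc, ← Category.assoc (ρ.hom τ), ρ.hom_over, Category.assoc,
      specAct_comp_specAlg, pullback.condition])

@[simp] lemma Fam.actionHom_fst (τ : Gal(Ω/k)) :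
    actionHom R ρ τ ≫ fst f R = fst f R ≫ ρ.hom τ := pullback.lift_fst _ _ _

@[simp] lemma Fam.actionHom_snd (τ : Gal(Ω/k)) :
    actionHom R ρ τ ≫ snd f R = snd f R := pullback.lift_snd _ _ _

variable (R) in
/-- The action on the family induced by the action on the scheme and the trivial action on `R`. -/
@[simps] def Fam.action : SchemeAction Gal(Ω/k) (fst f R ≫ f) where
  hom τ := actionHom R ρ τ
  hom_one := by
    apply pullback.hom_ext <;> simp [ρ.hom_one]
  hom_comp σ τ := by
    apply pullback.hom_ext
    · simp [← ρ.hom_comp, reassoc_of% actionHom_fst (R := R) ρ]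
    · simp
  hom_over τ := by
    rw [reassoc_of% actionHom_fst ρ, Category.assoc, ρ.hom_over]

/-- An automorphism maps the fibre over `x` to the fibre over the conjugate of `x`. -/
lemma Fam.fibre_action (τ : Gal(Ω/k)) (x : R →ₐ[k] Ω) :
    fibre f ((τ : Ω →ₐ[k] Ω).comp x) ≫ actionHom R ρ τ = ρ.hom τ ≫ fibre f x := by
  apply pullback.hom_ext
  · rw [Category.assoc, actionHom_fst, reassoc_of% fibre_fst, Category.assoc, fibre_fst,
      Category.comp_id]
  · rw [Category.assoc, actionHom_snd, fibre_snd, Category.assoc, fibre_snd, ← Category.assoc,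
      ρ.hom_over, Category.assoc, ← Spec.map_comp]
    rfl

variable (f) in
lemma Fam.le_fibre_preimage (x : R →ₐ[k] Ω) (W : X.Opens) :
    W ≤ fibre f x ⁻¹ᵁ (fst f R ⁻¹ᵁ W) := by
  rw [← Scheme.Hom.comp_preimage, fibre_fst]
  exact le_rfl

variable (f) in
/-- The restriction of functions to the fibre over `x`. -/
def Fam.res (x : R →ₐ[k] Ω) (W : X.Opens) :
    Sect (fst f R ≫ f) (fst f R ⁻¹ᵁ W) →+* Sect f W :=
  ((fibre f x).appLE (fst f R ⁻¹ᵁ W) W (le_fibre_preimage f x W)).hom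

variable (f R) in
/-- The inverse images of functions under the first projection. -/
def Fam.pull (W : X.Opens) : Sect f W →+* Sect (fst f R ≫ f) (fst f R ⁻¹ᵁ W) :=
  ((fst f R).app W).hom

variable (f) in
lemma Fam.res_pull (x : R →ₐ[k] Ω) (W : X.Opens) (s : Sect f W) :
    res f x W (pull f R W s) = s := by
  have : (fst f R).appLE W (fst f R ⁻¹ᵁ W) le_rfl ≫
      (fibre f x).appLE (fst f R ⁻¹ᵁ W) W (le_fibre_preimage f x W) = 𝟙 _ := by
    rw [Scheme.Hom.appLE_comp_appLE]
    have h (g : X ⟶ X) (hg : g = 𝟙 X) (e : W ≤ g ⁻¹ᵁ W) : g.appLE W W e = 𝟙 _ := by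
      subst hg
      rw [Scheme.Hom.appLE, Scheme.Hom.id_app]
      exact (Category.id_comp _).trans (X.presheaf.map_id _)
    exact h _ (fibre_fst f x) _
  rw [← Scheme.Hom.app_eq_appLE] at this
  exact congr($(this).hom s)

variable (f) in
/-- An element of `N ⊗ R` defines a function on the family, whose restrictions to the fibres are
constants. -/
lemma Fam.exists_res_eq {N : IntermediateField k Ω} (c : N ⊗[k] R) (W : X.Opens) :
    ∃ θ, ∀ x : R →ₐ[k] Ω, res f x W θ = algebraMap Ω (Sect f W) (evalAt N x c) := by
  induction c with
  | zero => exact ⟨0, fun x => by simp⟩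
  | add a b ha hb =>
    obtain ⟨s, hs⟩ := ha
    obtain ⟨t, ht⟩ := hb
    exact ⟨s + t, fun x => by rw [map_add, hs, ht, map_add, map_add]⟩
  | tmul a r =>
    refine ⟨algebraMap Ω (Sect (fst f R ≫ f) _) a *
      (show Sect (fst f R ≫ f) _ from (sectHom (snd f R) (fst f R ⁻¹ᵁ W)).hom r), fun x => ?_⟩
    rw [map_mul, evalAt_tmul, map_mul]
    congr 1
    · have h1 : fibre f x ≫ fst f R ≫ f = f ≫ Spec.map (𝟙 (CommRingCat.of Ω)) := by
        rw [reassoc_of% fibre_fst, Spec.map_id, Category.comp_id]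
      exact congr($(sectHom_appLE h1 (le_fibre_preimage f x W)).hom a)
    · exact congr($(sectHom_appLE (fibre_snd f x) (le_fibre_preimage f x W)).hom r)

/-- The conjugates of an open subset stable over `L = Frac R` only depend on the points of `R`
defined by the automorphisms. -/
lemma preimage_eq_of_agree {L : IntermediateField k Ω}
    (hRL : IntermediateField.adjoin k (R : Set Ω) = L) {U : X.Opens}
    (hU : (ρ.restrict L.fixingSubgroup).Stable U) {σ σ' : Gal(Ω/k)} (h : ∀ r : R, σ r = σ' r) :
    ρ.hom σ ⁻¹ᵁ U = ρ.hom σ' ⁻¹ᵁ U := by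
  have h1 : σ⁻¹ * σ' ∈ L.fixingSubgroup := by
    rw [← hRL]
    exact mem_fixingSubgroup_adjoin fun r hr => by
      change σ.symm (σ' r) = r
      rw [← h ⟨r, hr⟩]
      exact σ.symm_apply_apply r
  have h2 : ρ.hom σ ≫ ρ.hom (σ⁻¹ * σ') = ρ.hom σ' := by
    rw [ρ.hom_comp, mul_inv_cancel_left]
  rw [← h2, Scheme.Hom.comp_preimage]
  exact congrArg (ρ.hom σ ⁻¹ᵁ ·) (hU ⟨_, h1⟩).symm

variable [IsAlgClosed Ω] [CharZero Ω]

/-- Near a point of the conjugate `σ⁻¹ U`, with `σ` generic over `L`, there is an open subset of the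
family that is contained in `σ'⁻¹ U` for all generic `σ'`: it is the complement of the zero set of a
function on the family that restricts to an equation for the complement of `σ⁻¹ U`. -/
lemma exists_local_family (htr : Cardinal.aleph0 ≤ Algebra.trdeg k Ω) (hR : R.FG)
    {L : IntermediateField k Ω} (hL : L.FG) (hRL : IntermediateField.adjoin k (R : Set Ω) = L)
    {U W : X.Opens} (hU : (ρ.restrict L.fixingSubgroup).Stable U)
    (hW : (ρ.restrict L.fixingSubgroup).Good W) {σ : Gal(Ω/k)} (hσ : IsGeneric L (galPoint R σ))
    {v : X} (hvW : v ∈ W) (hvU : v ∈ ρ.hom σ ⁻¹ᵁ U) :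
    ∃ O : (Fam f R).Opens, Fam.fibre f (galPoint R σ) v ∈ O ∧
      ∀ σ' : Gal(Ω/k), IsGeneric L (galPoint R σ') →
        Fam.fibre f (galPoint R σ') ⁻¹ᵁ O ≤ ρ.hom σ' ⁻¹ᵁ U := by
  classical
  have : Algebra.FiniteType k R := (Subalgebra.fg_iff_finiteType R).mp hR
  -- the automorphisms fixing `L` and the point `σ` of `R`
  let H : Subgroup Gal(Ω/k) :=
    { carrier := {τ | (∀ a ∈ L, τ a = a) ∧ ∀ r : R, τ (σ r) = σ r}
      mul_mem' := fun {a b} ha hb => ⟨fun x hx => by rw [AlgEquiv.mul_apply, hb.1 x hx, ha.1 x hx],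
        fun r => by rw [AlgEquiv.mul_apply, hb.2, ha.2]⟩
      one_mem' := ⟨fun _ _ => rfl, fun _ => rfl⟩
      inv_mem' := fun {a} ha => ⟨fun x hx => by
        conv_lhs => rw [← ha.1 x hx]
        exact a.symm_apply_apply x, fun r => by
        conv_lhs => rw [← ha.2 r]
        exact a.symm_apply_apply _⟩ }
  have hWH : (ρ.restrict H).Good W := hW.of_forall_exists fun τ =>
    ⟨⟨τ, (IntermediateField.mem_fixingSubgroup_iff _ _).mpr τ.2.1⟩, rfl⟩
  have hUH : (ρ.restrict H).Stable (ρ.hom σ ⁻¹ᵁ U) := fun τ => by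
    change ρ.hom τ ⁻¹ᵁ (ρ.hom σ ⁻¹ᵁ U) = _
    rw [← Scheme.Hom.comp_preimage, ρ.hom_comp]
    exact preimage_eq_of_agree ρ hRL hU fun r => τ.2.2 r
  -- an `H`-invariant function `a` on `W`, nonzero at `v` and supported in `σ⁻¹ U`
  obtain ⟨a, ha, hva, hle⟩ := hWH.exists_basicOpen_le hUH hvW hvU
  obtain ⟨ι, e, he⟩ := hW.split.exists_basis
  have hsemi := SchemeAction.isSemilinear_act hW.stable
  have hsum : a = ∑ i ∈ (e.repr a).support, e.repr a i • e i := by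
    conv_lhs => rw [← e.linearCombination_repr a, Finsupp.linearCombination_apply, Finsupp.sum]
  -- the coordinates of `a` in an `L`-rational basis are rational functions of the point `σ`
  obtain ⟨D, C, hD, hDC⟩ := hσ.exists_spread htr hL (ι := (e.repr a).support)
    (c := fun i => e.repr a i) (by
      intro i τ hτL hτR
      have h1 := repr_act hsemi e he ⟨τ, (IntermediateField.mem_fixingSubgroup_iff _ _).mpr hτL⟩ a i
      exact h1.symm.trans (congrArg (fun t => e.repr t i) (ha ⟨τ, hτL, hτR⟩)))
  choose θ hθ using fun i => Fam.exists_res_eq f (C i) W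
  -- the function on the family with the numerators as coordinates
  let b : Sect (Fam.fst f R ≫ f) (Fam.fst f R ⁻¹ᵁ W) :=
    ∑ i : (e.repr a).support, Fam.pull f R W (e i) * θ i
  have hb (x : R →ₐ[k] Ω) : Fam.res f x W b = ∑ i : (e.repr a).support, evalAt L x (C i) • e i := by
    rw [map_sum]
    refine Finset.sum_congr rfl fun i _ => ?_
    rw [map_mul, hθ, Fam.res_pull, mul_comm, Algebra.smul_def]
  have hbO (x : R →ₐ[k] Ω) := basicOpen_appLE (Fam.fibre f x) (Fam.le_fibre_preimage f x W) b
  have hle' (x : R →ₐ[k] Ω) : Fam.fibre f x ⁻¹ᵁ (Fam f R).basicOpen b =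
      X.basicOpen (U := W) (Fam.res f x W b) := by
    refine Eq.trans (Eq.symm ?_) (hbO x).symm
    rw [inf_eq_right]
    refine (Scheme.Hom.preimage_mono _ ((Fam f R).basicOpen_le _)).trans ?_
    rw [← Scheme.Hom.comp_preimage, Fam.fibre_fst]
    exact le_rfl
  -- on the fibres over the conjugates `τ σ` of `σ` over `L`, the function `b` is a multiple of the
  -- conjugate `τ a`
  have key {x : R →ₐ[k] Ω} {τ : Gal(Ω/k)} (hτ : ∀ a ∈ L, τ a = a)
      (h : ∀ i : (e.repr a).support, evalAt L x D * τ (e.repr a i) = evalAt L x (C i)) :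
      Fam.res f x W b = evalAt L x D • SchemeAction.actHom hW.stable
        ⟨τ, (IntermediateField.mem_fixingSubgroup_iff _ _).mpr hτ⟩ a := by
    rw [hb]
    conv_rhs => rw [hsum, map_sum, Finset.smul_sum, ← Finset.sum_coe_sort]
    refine Finset.sum_congr rfl fun i _ => ?_
    rw [← h, mul_smul]
    congr 1
    refine Eq.trans ?_ (hsemi _ _ _).symm
    rw [he]
    rfl
  refine ⟨(Fam f R).basicOpen b, ?_, fun σ' hσ' => ?_⟩
  · suffices h : v ∈ Fam.fibre f (galPoint R σ) ⁻¹ᵁ (Fam f R).basicOpen b from h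
    rw [hle']
    rcases hDC _ hσ with ⟨h, -⟩ | ⟨τ, hτ, hτR, h⟩
    · exact absurd h hD
    · rw [key hτ h]
      have h1 : SchemeAction.actHom hW.stable
        ⟨τ, (IntermediateField.mem_fixingSubgroup_iff _ _).mpr hτ⟩ a = a := ha ⟨τ, hτ, hτR⟩
      rw [h1, Algebra.smul_def]
      refine (X.basicOpen_mul (U := W) _ _).ge ⟨?_, hva⟩
      have h2 : IsUnit (algebraMap Ω (Sect f W) (evalAt L (galPoint R σ) D)) :=
        (IsUnit.mk0 _ hD).map _
      exact (X.basicOpen_of_isUnit (U := W) h2).ge hvW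
  · rw [hle']
    rcases hDC _ hσ' with ⟨-, h⟩ | ⟨τ, hτ, hτR, h⟩
    -- `σ'` lies on another component than `σ`, where `b` vanishes
    · have : Fam.res f (galPoint R σ') W b = 0 := by
        rw [hb]
        exact Finset.sum_eq_zero fun i _ => by rw [h, zero_smul]
      rw [this]
      exact (X.basicOpen_zero W).le.trans bot_le
    · rw [key hτ h, Algebra.smul_def]
      refine (X.basicOpen_mul (U := W) _ _).le.trans (inf_le_right.trans ?_)
      refine (SchemeAction.preimage_basicOpen hW.stable _ a).ge.trans ?_
      refine (Scheme.Hom.preimage_mono _ hle).trans ?_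
      change ρ.hom τ ⁻¹ᵁ (ρ.hom σ ⁻¹ᵁ U) ≤ _
      rw [← Scheme.Hom.comp_preimage, ρ.hom_comp]
      exact (preimage_eq_of_agree ρ hRL hU (σ := τ * σ) (σ' := σ') fun r => hτR r).le

variable (R) in
/-- The open subsets of the family whose fibres at all sufficiently generic points are contained in
the conjugates of `U`. -/
def SubFamily (U : X.Opens) : Set (Fam f R).Opens :=
  {O | ∃ N : IntermediateField k Ω, N.FG ∧ ∀ σ : Gal(Ω/k), IsGeneric N (galPoint R σ) →
    Fam.fibre f (galPoint R σ) ⁻¹ᵁ O ≤ ρ.hom σ ⁻¹ᵁ U}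

omit [IsAlgClosed Ω] [CharZero Ω] in
lemma SubFamily.preimage {U : X.Opens} {O : (Fam f R).Opens} (hO : O ∈ SubFamily R ρ U)
    (τ : Gal(Ω/k)) : Fam.actionHom R ρ τ ⁻¹ᵁ O ∈ SubFamily R ρ U := by
  obtain ⟨N, hN, hO⟩ := hO
  refine ⟨N.map (τ : Ω →ₐ[k] Ω), fg_map hN _, fun σ hσ => ?_⟩
  have h1 := hO _ (isGeneric_inv_mul hσ)
  have h2 : galPoint R σ = (τ : Ω →ₐ[k] Ω).comp (galPoint R (τ⁻¹ * σ)) :=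
    AlgHom.ext fun r => (τ.apply_symm_apply (σ r)).symm
  rw [h2, ← Scheme.Hom.comp_preimage, Fam.fibre_action, Scheme.Hom.comp_preimage]
  refine (Scheme.Hom.preimage_mono _ h1).trans ?_
  rw [← Scheme.Hom.comp_preimage, ρ.hom_comp, mul_inv_cancel_left]

omit [IsAlgClosed Ω] [CharZero Ω] in
lemma SubFamily.sSup_stable (U : X.Opens) :
    (Fam.action R ρ).Stable (sSup (SubFamily R ρ U)) := by
  refine SchemeAction.stable_of_le fun τ => sSup_le fun O hO => ?_
  have h1 : (Fam.action R ρ).hom τ ⁻¹ᵁ (Fam.actionHom R ρ τ⁻¹ ⁻¹ᵁ O) = O := by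
    rw [← Fam.action_hom, ← Scheme.Hom.comp_preimage, SchemeAction.hom_comp, mul_inv_cancel,
      SchemeAction.hom_one, Scheme.Hom.id_preimage]
  exact h1.ge.trans (Scheme.Hom.preimage_mono _ (le_sSup (SubFamily.preimage ρ hO τ⁻¹)))

omit [IsAlgClosed Ω] [CharZero Ω] in
/-- As the family is noetherian, the union is attained by finitely many members. -/
lemma SubFamily.sSup_mem [CompactSpace (Fam f R)] [IsLocallyNoetherian (Fam f R)] (U : X.Opens) :
    sSup (SubFamily R ρ U) ∈ SubFamily R ρ U := by
  have : IsNoetherian (Fam f R) := {}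
  obtain ⟨O, hO, hle⟩ : ∃ O ∈ SubFamily R ρ U, sSup (SubFamily R ρ U) ≤ O := by
    have hc : IsCompact ((sSup (SubFamily R ρ U) : (Fam f R).Opens) : Set (Fam f R)) :=
      TopologicalSpace.NoetherianSpace.isCompact _
    refine hc.induction_on
      (p := fun s => ∃ O ∈ SubFamily R ρ U, s ⊆ (O : Set (Fam f R))) ?_ ?_ ?_ ?_
    · refine ⟨⊥, ⟨⊥, IntermediateField.fg_bot, fun σ _ x hx => ?_⟩, Set.empty_subset _⟩
      exact absurd hx (Set.notMem_empty _)
    · exact fun s t hst ⟨O, hO, ht⟩ => ⟨O, hO, hst.trans ht⟩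
    · rintro s t ⟨O, ⟨N, hN, hO⟩, hs⟩ ⟨O', ⟨N', hN', hO'⟩, ht⟩
      refine ⟨O ⊔ O', ⟨N ⊔ N', IntermediateField.fg_sup hN hN', fun σ hσ => ?_⟩, ?_⟩
      · rintro x (hx | hx)
        · exact hO σ (hσ.mono le_sup_left) hx
        · exact hO' σ (hσ.mono le_sup_right) hx
      · rintro x (hx | hx)
        · exact Or.inl (hs hx)
        · exact Or.inr (ht hx)
    · intro x hx
      obtain ⟨O, hO, hx⟩ := TopologicalSpace.Opens.mem_sSup.mp hx
      exact ⟨O, mem_nhdsWithin_of_mem_nhds (O.2.mem_nhds hx), O, hO, subset_rfl⟩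
  obtain ⟨N, hN, h⟩ := hO
  exact ⟨N, hN, fun σ hσ => (Scheme.Hom.preimage_mono _ hle).trans (h σ hσ)⟩

/-- The conjugates of an open subset `U` that is stable under the Galois group over `L` are the
fibres at the generic points of a stable open subset of the family over a model of `L`. -/
theorem exists_family (htr : Cardinal.aleph0 ≤ Algebra.trdeg k Ω) (hR : R.FG)
    {L : IntermediateField k Ω} (hL : L.FG) (hRL : IntermediateField.adjoin k (R : Set Ω) = L)
    [LocallyOfFiniteType f] [QuasiCompact f]
    (hcov : ∀ x, ∃ U, (ρ.restrict L.fixingSubgroup).Good U ∧ x ∈ U)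
    {U : X.Opens} (hU : (ρ.restrict L.fixingSubgroup).Stable U) :
    ∃ 𝒰 : (Fam f R).Opens, (Fam.action R ρ).Stable 𝒰 ∧ ∃ N : IntermediateField k Ω, N.FG ∧ L ≤ N ∧
      ∀ σ : Gal(Ω/k), IsGeneric N (galPoint R σ) →
        Fam.fibre f (galPoint R σ) ⁻¹ᵁ 𝒰 = ρ.hom σ ⁻¹ᵁ U := by
  have : Algebra.FiniteType k R := (Subalgebra.fg_iff_finiteType R).mp hR
  have : LocallyOfFiniteType (Spec.map (CommRingCat.ofHom (algebraMap k R))) := by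
    rw [HasRingHomProperty.Spec_iff (P := @LocallyOfFiniteType)]
    exact RingHom.finiteType_algebraMap.mpr ‹_›
  have : IsLocallyNoetherian (Fam f R) :=
    LocallyOfFiniteType.isLocallyNoetherian (Fam.fst f R ≫ f)
  have : CompactSpace (Fam f R) := QuasiCompact.compactSpace_of_compactSpace (Fam.fst f R ≫ f)
  -- the union of all open subsets of the family with generic fibres contained in the conjugates of
  -- `U` is stable, and its generic fibres are the full conjugates by `exists_local_family`
  obtain ⟨N, hN, h⟩ := SubFamily.sSup_mem (R := R) ρ U
  refine ⟨sSup (SubFamily R ρ U), SubFamily.sSup_stable ρ U, N ⊔ L, IntermediateField.fg_sup hN hL,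
    le_sup_right, fun σ hσ => ?_⟩
  refine le_antisymm (h σ (hσ.mono le_sup_left)) fun v hv => ?_
  obtain ⟨W, hW, hvW⟩ := hcov v
  obtain ⟨O, hvO, hO⟩ := exists_local_family ρ htr hR hL hRL hU hW (hσ.mono le_sup_right) hvW hv
  exact TopologicalSpace.Opens.mem_sSup.mpr ⟨O, ⟨L, hL, hO⟩, hvO⟩

end Family

/-! ### Specialization to algebraic points -/

section Specialization

/-- A constructible set containing the generic point of an irreducible component contains a
neighbourhood of it. -/
lemma exists_basicOpen_subset_of_isConstructible {B : Type*} [CommRing B] [IsNoetherianRing B]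
    {p : PrimeSpectrum B} (hp : p.asIdeal ∈ minimalPrimes B) {S : Set (PrimeSpectrum B)}
    (hS : Topology.IsConstructible S) (hpS : p ∈ S) :
    ∃ s ∉ p.asIdeal, (PrimeSpectrum.basicOpen s : Set (PrimeSpectrum B)) ⊆ S := by
  classical
  have hfin := minimalPrimes.finite_of_isNoetherianRing B
  have h (q : Ideal B) : ∃ d, d ∉ p.asIdeal ∧ (q ∈ minimalPrimes B → q ≠ p.asIdeal → d ∈ q) := by
    by_cases hq : q ∈ minimalPrimes B ∧ q ≠ p.asIdeal
    · obtain ⟨d, hdq, hdp⟩ := SetLike.not_le_iff_exists.mp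
        (fun hqp : q ≤ p.asIdeal => hq.2 (le_antisymm hqp (hp.2 hq.1.1 hqp)))
      exact ⟨d, hdp, fun _ _ => hdq⟩
    · exact ⟨1, p.asIdeal.ne_top_iff_one.mp p.2.ne_top, fun h1 h2 => absurd ⟨h1, h2⟩ hq⟩
  choose d hdp hdq using h
  -- `s` vanishes on all other components
  let s := ∏ q ∈ hfin.toFinset, d q
  have hs : s ∉ p.asIdeal := fun hs => by
    obtain ⟨q, -, hq⟩ := (Ideal.IsPrime.prod_mem_iff (hp := p.2)).mp hs
    exact hdp q hq
  obtain ⟨T, rfl⟩ := PrimeSpectrum.exists_constructibleSetData_iff.mpr hS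
  obtain ⟨C, hC, hpC⟩ := Set.mem_iUnion₂.mp hpS
  refine ⟨C.f * s, fun h => ?_, fun q hq => Set.mem_iUnion₂.mpr ⟨C, hC, ?_⟩⟩
  · rcases p.2.mem_or_mem h with h | h
    · exact hpC.2 (by simpa using h)
    · exact hs h
  · have hq' : C.f * s ∉ q.asIdeal := hq
    obtain ⟨m, hm, hmq⟩ := Ideal.exists_minimalPrimes_le (I := ⊥) (J := q.asIdeal) bot_le
    have hmp : m = p.asIdeal := by
      by_contra hne
      refine hq' (Ideal.mul_mem_left _ _ (hmq ?_))
      exact Ideal.mem_of_dvd _ (Finset.dvd_prod_of_mem d (hfin.mem_toFinset.mpr hm)) (hdq m hm hne)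
    refine ⟨fun x hx => hmq (hmp ▸ hpC.1 hx), fun h => hq' (Ideal.mul_mem_right _ _ ?_)⟩
    simpa using h

variable {k Ω : Type u} [Field k] [Field Ω] [Algebra k Ω] [IsAlgClosed Ω]

/-- A Jacobson domain has maximal ideals in every nonempty open subset of its spectrum. -/
lemma exists_isMaximal_mem {R : Type*} [CommRing R] [IsDomain R] [IsJacobsonRing R]
    {O : Set (PrimeSpectrum R)} (hO : IsOpen O) (hne : O.Nonempty) {a : R} (ha : a ≠ 0) :
    ∃ m : PrimeSpectrum R, m.asIdeal.IsMaximal ∧ a ∉ m.asIdeal ∧ m ∈ O := by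
  obtain ⟨x, hx⟩ := hne
  obtain ⟨_, ⟨g, rfl⟩, hxg, hg⟩ :=
    PrimeSpectrum.isTopologicalBasis_basic_opens.exists_subset_of_mem_open hx hO
  have hg0 : g ≠ 0 := fun h => hxg (h ▸ x.asIdeal.zero_mem)
  by_contra! hcon
  -- otherwise `a g` lies in all maximal ideals
  have : a * g ∈ (⊥ : Ideal R).jacobson := by
    rw [Ideal.jacobson, Ideal.mem_sInf]
    intro m ⟨_, hm⟩
    by_contra h
    refine hcon ⟨m, hm.isPrime⟩ hm (fun h' => h (m.mul_mem_right _ h')) (hg fun h' => ?_)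
    exact h (m.mul_mem_left _ h')
  rw [IsJacobsonRing.out' _ (Ideal.IsPrime.isRadical (Ideal.isPrime_bot)), Ideal.mem_bot] at this
  exact mul_ne_zero ha hg0 this

/-- The projection `Spec (A ⊗ R) → Spec R` over a field is open. -/
lemma isOpenMap_comap_includeRight {k A R : Type*} [Field k] [CommRing A] [CommRing R] [Algebra k A]
    [Algebra k R] : IsOpenMap (PrimeSpectrum.comap (R := R) (S := A ⊗[k] R)
      (Algebra.TensorProduct.includeRight : R →ₐ[k] A ⊗[k] R).toRingHom) := by
  have h1 := PrimeSpectrum.isOpenMap_comap_algebraMap_tensorProduct_of_field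
    (K := k) (A := R) (B := A)
  let e : R ⊗[k] A ≃+* A ⊗[k] R := (Algebra.TensorProduct.comm k R A).toRingEquiv
  exact h1.comp (PrimeSpectrum.homeomorphOfRingEquiv e).symm.isOpenMap

/-- A homomorphism to `Ω` from an algebra of finite type over a finitely generated field `L` that
contains a conjugate of `R`, generic over `L`, can be chosen such that the images of the elements
of `R` are algebraic over `k`. The image of `Spec C` in `Spec (L ⊗ R)` contains a neighbourhood of
the point `x`, whose image in `Spec R` is open, hence contains a closed point. -/
theorem exists_algebraic_specialization [CharZero Ω] (htr : Cardinal.aleph0 ≤ Algebra.trdeg k Ω)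
    {R : Type u} [CommRing R] [IsDomain R] [Algebra k R] [Algebra.FiniteType k R]
    {L : IntermediateField k Ω} (hL : L.FG) {x : R →ₐ[k] Ω} (hx : IsGeneric L x)
    {C : Subalgebra L Ω} (hC : C.FG) (hxC : ∀ r, x r ∈ C) {a : R} (ha : a ≠ 0) :
    ∃ c : C →ₐ[L] Ω, c ⟨x a, hxC a⟩ ≠ 0 ∧ ∀ r, IsAlgebraic k (c ⟨x r, hxC r⟩) := by
  let φ : L ⊗[k] R →ₐ[L] C := (evalAt L x).codRestrict C fun b => by
    induction b with
    | zero => rw [map_zero]; exact C.zero_mem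
    | add b b' hb hb' => rw [map_add]; exact C.add_mem hb hb'
    | tmul b r => rw [evalAt_tmul]; exact C.mul_mem (C.algebraMap_mem b) (hxC r)
  have hφ (b : L ⊗[k] R) : (φ b : Ω) = evalAt L x b := rfl
  have : Algebra.FiniteType L C := (Subalgebra.fg_iff_finiteType C).mp hC
  have : IsNoetherianRing (L ⊗[k] R) := Algebra.FiniteType.isNoetherianRing L (L ⊗[k] R)
  have hφf : @RingHom.FinitePresentation (L ⊗[k] R) C _ _ φ.toRingHom := by
    refine RingHom.FinitePresentation.of_finiteType.mp ?_
    refine RingHom.FiniteType.of_comp_finiteType (f := algebraMap L (L ⊗[k] R)) ?_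
    have : φ.toRingHom.comp (algebraMap L (L ⊗[k] R)) = algebraMap L C := φ.comp_algebraMap
    rw [this]
    exact RingHom.finiteType_algebraMap.mpr ‹_›
  let p : PrimeSpectrum (L ⊗[k] R) := ⟨RingHom.ker (evalAt L x), hx.1.1⟩
  have hp : p.asIdeal ∈ minimalPrimes (L ⊗[k] R) := hx
  -- by Chevalley's theorem the image of `Spec C` is constructible, and it contains `x`
  obtain ⟨s, hs, hsS⟩ := exists_basicOpen_subset_of_isConstructible
    (B := L ⊗[k] R) (p := p) hp
    (PrimeSpectrum.isConstructible_range_comap hφf) ⟨⊥, by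
      ext b
      rw [PrimeSpectrum.comap_asIdeal]
      change φ b ∈ (⊥ : Ideal C) ↔ evalAt L x b = 0
      rw [Ideal.mem_bot, ← hφ, ZeroMemClass.coe_eq_zero]⟩
  let ι := (Algebra.TensorProduct.includeRight : R →ₐ[k] L ⊗[k] R).toRingHom
  have hι : IsOpenMap (PrimeSpectrum.comap (R := R) (S := L ⊗[k] R) ι) :=
    isOpenMap_comap_includeRight
  have : IsJacobsonRing R := isJacobsonRing_of_finiteType (A := k)
  obtain ⟨m, hm, ham, b, hb, rfl⟩ := exists_isMaximal_mem (hι _ (PrimeSpectrum.basicOpen s).isOpen)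
    ⟨_, p, hs, rfl⟩ ha
  obtain ⟨q, rfl⟩ := hsS hb
  have hq (r : R) : ι r ∈ (PrimeSpectrum.comap φ.toRingHom q).asIdeal ↔
      (⟨x r, hxC r⟩ : C) ∈ q.asIdeal := by
    have : φ (ι r) = ⟨x r, hxC r⟩ := Subtype.ext (by rw [hφ]; simp [ι])
    rw [← this]; rfl
  have : Algebra.EssFiniteType L (FractionRing (C ⧸ q.asIdeal)) := .comp _ (C ⧸ q.asIdeal) _
  -- `q` is a point of `Spec C` over the closed point `m` of `Spec R`; its residue field embeds into
  -- `Ω` over `L`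
  obtain ⟨c⟩ := nonempty_algHom_of_fg htr hL (F := FractionRing (C ⧸ q.asIdeal))
  let c' : C →ₐ[L] Ω := (c.comp (IsScalarTower.toAlgHom L (C ⧸ q.asIdeal) _)).comp
    (Ideal.Quotient.mkₐ L q.asIdeal)
  have hc' (y : C) : c' y = 0 ↔ y ∈ q.asIdeal := by
    change c (algebraMap (C ⧸ q.asIdeal) _ (Ideal.Quotient.mk _ y)) = 0 ↔ _
    rw [map_eq_zero_iff c c.injective, map_eq_zero_iff _ (IsFractionRing.injective _ _),
      Ideal.Quotient.eq_zero_iff_mem]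
  refine ⟨c', fun h => ham ((hq a).mpr ((hc' _).mp h)), fun r => ?_⟩
  set m : Ideal R := (PrimeSpectrum.comap ι (PrimeSpectrum.comap φ.toRingHom q)).asIdeal
  let _ := Ideal.Quotient.field m
  -- the residue field of the closed point is finite over `k`
  have : Module.Finite k (R ⧸ m) := finite_of_finite_type_of_isJacobsonRing k (R ⧸ m)
  obtain ⟨P, hP, hPr⟩ := (Algebra.IsIntegral.isIntegral (R := k) (Ideal.Quotient.mk m r))
  refine ⟨P, hP.ne_zero, ?_⟩
  have h1 : Polynomial.aeval r P ∈ m := by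
    rw [← Ideal.Quotient.eq_zero_iff_mem, ← hPr]
    exact (Polynomial.aeval_algHom_apply (Ideal.Quotient.mkₐ k m) r P).symm
  have h2 : Polynomial.aeval (c' ⟨x r, hxC r⟩) P = c' ⟨x (Polynomial.aeval r P), hxC _⟩ := by
    let g : R →ₐ[k] Ω := (c'.restrictScalars k).comp
      (x.codRestrict (C.restrictScalars k) hxC)
    exact Polynomial.aeval_algHom_apply g r P
  rw [h2, hc', ← hq]
  exact h1

end Specialization

/-! ### Affineness at a finite level -/

section FiniteLevel

variable (E Ω : Type u) [Field E] [Field Ω] [Algebra E Ω]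

/-- The directed set of finitely generated subalgebras. -/
abbrev FGSubalg : Type u := {C : Subalgebra E Ω // C.FG}

instance : Nonempty (FGSubalg E Ω) := ⟨⟨⊥, Subalgebra.fg_bot⟩⟩

instance : IsDirectedOrder (FGSubalg E Ω) :=
  ⟨fun C C' => ⟨⟨C.1 ⊔ C'.1, C.2.sup C'.2⟩, le_sup_left (a := C.1), le_sup_right (a := C.1)⟩⟩

/-- The diagram of the finitely generated subalgebras. -/
def fgDiagram : FGSubalg E Ω ⥤ CommRingCat.{u} where
  obj C := .of C.1
  map h := CommRingCat.ofHom (Subalgebra.inclusion (leOfHom h)).toRingHom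

/-- The cocone over the finitely generated subalgebras with vertex the algebra itself. -/
def fgCocone : Cocone (fgDiagram E Ω) where
  pt := .of Ω
  ι := { app C := CommRingCat.ofHom C.1.val.toRingHom }

/-- An algebra is the colimit of its finitely generated subalgebras. -/
def isColimitFGCocone : IsColimit (fgCocone E Ω) := by
  classical
  let A (s : Finset Ω) : FGSubalg E Ω :=
    ⟨Algebra.adjoin E (s : Set Ω), Subalgebra.fg_adjoin_finset s⟩
  have hA (s : Finset Ω) (x : Ω) (h : x ∈ s) : x ∈ (A s).1 := Algebra.subset_adjoin h
  -- the value of a cocone at `x` can be computed in any subalgebra containing `x`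
  have hcompat (s : Cocone (fgDiagram E Ω)) (x : Ω) (C C' : FGSubalg E Ω) (h : x ∈ C.1)
      (h' : x ∈ C'.1) : (s.ι.app C).hom ⟨x, h⟩ = (s.ι.app C').hom ⟨x, h'⟩ := by
    have h1 (C : FGSubalg E Ω) (h : x ∈ C.1) : (s.ι.app (A {x})).hom
        ⟨x, hA _ x (Finset.mem_singleton_self x)⟩ = (s.ι.app C).hom ⟨x, h⟩ := by
      have hle : A {x} ≤ C := by
        refine Algebra.adjoin_le ?_
        simpa using h
      exact (congr($(s.w (homOfLE hle)).hom ⟨x, hA _ x (Finset.mem_singleton_self x)⟩)).symm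
    rw [← h1 C h, ← h1 C' h']
  let φ (s : Cocone (fgDiagram E Ω)) : Ω →+* s.pt :=
    { toFun x := (s.ι.app (A {x})).hom ⟨x, hA _ x (Finset.mem_singleton_self x)⟩
      map_one' := map_one (s.ι.app (A {1})).hom
      map_zero' := map_zero (s.ι.app (A {0})).hom
      map_mul' x y := by
        have hx := hA {x, y} x (by simp)
        have hy := hA {x, y} y (by simp)
        rw [hcompat s x _ _ _ hx, hcompat s y _ _ _ hy,
          hcompat s (x * y) _ _ _ ((A {x, y}).1.mul_mem hx hy)]
        exact map_mul (s.ι.app (A {x, y})).hom (⟨x, hx⟩ : (A {x, y}).1) (⟨y, hy⟩ : (A {x, y}).1)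
      map_add' x y := by
        have hx := hA {x, y} x (by simp)
        have hy := hA {x, y} y (by simp)
        rw [hcompat s x _ _ _ hx, hcompat s y _ _ _ hy,
          hcompat s (x + y) _ _ _ ((A {x, y}).1.add_mem hx hy)]
        exact map_add (s.ι.app (A {x, y})).hom (⟨x, hx⟩ : (A {x, y}).1) (⟨y, hy⟩ : (A {x, y}).1) }
  exact
    { desc s := CommRingCat.ofHom (φ s)
      fac s C := by
        ext x
        exact hcompat s x.1 _ _ _ x.2
      uniq s m hm := by
        ext x
        exact congr($(hm (A {x})).hom ⟨x, hA _ x (Finset.mem_singleton_self x)⟩) }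

variable {E Ω}
variable {X X₀ : Scheme.{u}} {f : X ⟶ Spec (.of Ω)} (f₀ : X₀ ⟶ Spec (.of E)) {p : X ⟶ X₀}

/-- The base change of a scheme over `E` to a subalgebra of `Ω`. -/
abbrev Level (C : Subalgebra E Ω) : Scheme.{u} :=
  pullback f₀ (Spec.map (CommRingCat.ofHom (algebraMap E C)))

/-- The transition morphisms between the base changes to subalgebras. -/
def Level.map {C C' : Subalgebra E Ω} (h : C ≤ C') : Level f₀ C' ⟶ Level f₀ C :=
  pullback.lift (pullback.fst _ _)
    (pullback.snd _ _ ≫ Spec.map (CommRingCat.ofHom (Subalgebra.inclusion h).toRingHom)) (by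
    rw [pullback.condition, Category.assoc, ← Spec.map_comp]
    rfl)

@[simp] lemma Level.map_fst {C C' : Subalgebra E Ω} (h : C ≤ C') :
    map f₀ h ≫ pullback.fst _ _ = pullback.fst _ _ := pullback.lift_fst _ _ _

@[simp] lemma Level.map_snd {C C' : Subalgebra E Ω} (h : C ≤ C') :
    map f₀ h ≫ pullback.snd _ _ = pullback.snd _ _ ≫
      Spec.map (CommRingCat.ofHom (Subalgebra.inclusion h).toRingHom) := pullback.lift_snd _ _ _

instance isAffineHom_map {C C' : Subalgebra E Ω} (h : C ≤ C') : IsAffineHom (Level.map f₀ h) := by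
  have h1 : IsPullback (Level.map f₀ h) (pullback.snd _ _) (pullback.snd _ _)
      (Spec.map (CommRingCat.ofHom (Subalgebra.inclusion h).toRingHom)) := by
    refine IsPullback.of_right (h₁₂ := pullback.fst _ _) (h₂₂ :=
      Spec.map (CommRingCat.ofHom (algebraMap E C))) (v₁₃ := f₀) ?_ (Level.map_snd f₀ h)
      (.of_hasPullback _ _)
    rw [Level.map_fst, ← Spec.map_comp]
    exact .of_hasPullback _ _
  exact MorphismProperty.of_isPullback (P := @IsAffineHom) h1.flip inferInstance

lemma specMap_subalgebra_comp {C : Subalgebra E Ω} (c : C →ₐ[E] Ω) :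
    Spec.map (CommRingCat.ofHom c.toRingHom) ≫
      Spec.map (CommRingCat.ofHom (algebraMap E C)) = specAlg E Ω := by
  rw [← Spec.map_comp, ← CommRingCat.ofHom_comp]
  congr 2
  exact c.comp_algebraMap

/-- The morphism to the base change to a subalgebra defined by a homomorphism from the
subalgebra to `Ω`. -/
def toLevel (hw : p ≫ f₀ = f ≫ specAlg E Ω) {C : Subalgebra E Ω} (c : C →ₐ[E] Ω) :
    X ⟶ Level f₀ C :=
  pullback.lift p (f ≫ Spec.map (CommRingCat.ofHom c.toRingHom)) (by
    rw [hw, Category.assoc, specMap_subalgebra_comp])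

@[simp] lemma toLevel_fst (hw : p ≫ f₀ = f ≫ specAlg E Ω) {C : Subalgebra E Ω}
    (c : C →ₐ[E] Ω) : toLevel f₀ hw c ≫ pullback.fst _ _ = p := pullback.lift_fst _ _ _

@[simp] lemma toLevel_snd (hw : p ≫ f₀ = f ≫ specAlg E Ω) {C : Subalgebra E Ω}
    (c : C →ₐ[E] Ω) : toLevel f₀ hw c ≫ pullback.snd _ _ =
      f ≫ Spec.map (CommRingCat.ofHom c.toRingHom) := pullback.lift_snd _ _ _

lemma toLevel_map (hw : p ≫ f₀ = f ≫ specAlg E Ω) {C C' : Subalgebra E Ω} (h : C ≤ C')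
    (c : C' →ₐ[E] Ω) : toLevel f₀ hw c ≫ Level.map f₀ h =
      toLevel f₀ hw (c.comp (Subalgebra.inclusion h)) := by
  apply pullback.hom_ext
  · simp
  · rw [Category.assoc, Level.map_snd, reassoc_of% toLevel_snd f₀ hw, toLevel_snd, ← Spec.map_comp]
    rfl

lemma toLevel_val_map (hw : p ≫ f₀ = f ≫ specAlg E Ω) {C C' : Subalgebra E Ω} (h : C ≤ C') :
    toLevel f₀ hw C'.val ≫ Level.map f₀ h = toLevel f₀ hw C.val :=
  (toLevel_map f₀ hw h _).trans (congrArg (toLevel f₀ hw) (AlgHom.ext fun _ => rfl))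

lemma isAffineHom_toLevel (hp : IsPullback p f f₀ (specAlg E Ω)) {C : Subalgebra E Ω}
    (c : C →ₐ[E] Ω) : IsAffineHom (toLevel f₀ hp.w c) := by
  have h1 : IsPullback (toLevel f₀ hp.w c) f (pullback.snd _ _)
      (Spec.map (CommRingCat.ofHom c.toRingHom)) := by
    refine IsPullback.of_right (h₁₂ := pullback.fst _ _) (h₂₂ :=
      Spec.map (CommRingCat.ofHom (algebraMap E C))) (v₁₃ := f₀) ?_ (toLevel_snd f₀ hp.w c)
      (.of_hasPullback _ _)
    rw [toLevel_fst, specMap_subalgebra_comp]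
    exact hp
  exact MorphismProperty.of_isPullback (P := @IsAffineHom) h1.flip inferInstance

lemma Level.map_comp {C C' C'' : Subalgebra E Ω} (h : C' ≤ C'') (h' : C ≤ C') :
    map f₀ h ≫ map f₀ h' = map f₀ (h'.trans h) := by
  apply pullback.hom_ext
  · simp
  · rw [Category.assoc, Level.map_snd, reassoc_of% Level.map_snd f₀, Level.map_snd, ← Spec.map_comp]
    rfl

/-- The diagram of the base changes to finitely generated subalgebras. -/
def levelDiagram : (FGSubalg E Ω)ᵒᵖ ⥤ Scheme.{u} where
  obj C := Level f₀ C.unop.1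
  map h := Level.map f₀ (leOfHom h.unop)
  map_id C := by
    apply pullback.hom_ext
    · simp
    · rw [Level.map_snd, Category.id_comp]
      exact (congrArg _ (Spec.map_id _)).trans (Category.comp_id _)
  map_comp g h :=
    (Level.map_comp f₀ (leOfHom g.unop) (leOfHom h.unop)).symm

/-- The cone over the diagram of the base changes to finitely generated subalgebras. -/
def levelCone (hw : p ≫ f₀ = f ≫ specAlg E Ω) : Cone (levelDiagram (Ω := Ω) f₀) where
  pt := X
  π :=
    { app C := toLevel f₀ hw C.unop.1.val
      naturality C C' h := by
        refine (Category.id_comp _).trans ?_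
        exact (toLevel_val_map f₀ hw (leOfHom h.unop)).symm }

/-- A scheme over `Ω` that is the base change of a scheme over `E` is the limit of the base
changes to finitely generated subalgebras. -/
def isLimitLevelCone (hp : IsPullback p f f₀ (specAlg E Ω)) : IsLimit (levelCone f₀ hp.w) := by
  let hlim : IsLimit (Scheme.Spec.mapCone (fgCocone E Ω).op) :=
    isLimitOfPreserves Scheme.Spec (isColimitFGCocone E Ω).op
  let scone (s : Cone (levelDiagram (Ω := Ω) f₀)) : Cone ((fgDiagram E Ω).op ⋙ Scheme.Spec) :=
    { pt := s.pt
      π :=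
        { app C := s.π.app C ≫ pullback.snd _ _
          naturality C C' h := by
            refine (Category.id_comp _).trans ?_
            rw [← s.w h]
            exact (Category.assoc _ _ _).trans ((congrArg (s.π.app C ≫ ·)
              (Level.map_snd f₀ (leOfHom h.unop))).trans (Category.assoc _ _ _).symm) } }
  let b : (FGSubalg E Ω)ᵒᵖ := op ⟨⊥, Subalgebra.fg_bot⟩
  -- the components of a cone in `X₀` agree, since they agree with the one at `⊥`
  have hfst (s : Cone (levelDiagram (Ω := Ω) f₀)) (C : (FGSubalg E Ω)ᵒᵖ) :
      s.π.app C ≫ pullback.fst f₀ _ = s.π.app b ≫ pullback.fst f₀ _ := by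
    have hle : b.unop ≤ C.unop := (bot_le : (⊥ : Subalgebra E Ω) ≤ C.unop.1)
    rw [← s.w (homOfLE hle).op]
    exact ((Category.assoc _ _ _).trans (congrArg (s.π.app C ≫ ·)
      (Level.map_fst f₀ hle))).symm
  have hfac (s : Cone (levelDiagram (Ω := Ω) f₀)) (C : (FGSubalg E Ω)ᵒᵖ) :
      hlim.lift (scone s) ≫ Spec.map (CommRingCat.ofHom C.unop.1.val.toRingHom) =
        s.π.app C ≫ pullback.snd f₀ _ := hlim.fac (scone s) C
  have hcomm (s : Cone (levelDiagram (Ω := Ω) f₀)) :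
      (s.π.app b ≫ pullback.fst f₀ _) ≫ f₀ = hlim.lift (scone s) ≫ specAlg E Ω := by
    rw [← specMap_subalgebra_comp b.unop.1.val]
    refine (Category.assoc _ _ _).trans ?_
    refine (congrArg (s.π.app b ≫ ·) pullback.condition).trans ?_
    refine (Category.assoc _ _ _).symm.trans ?_
    exact (congrArg (· ≫ Spec.map _) (hfac s b).symm).trans (Category.assoc _ _ _)
  exact
    { lift s := hp.lift (s.π.app b ≫ pullback.fst f₀ _) (hlim.lift (scone s)) (hcomm s)
      fac s C := by
        apply pullback.hom_ext
        · refine (Category.assoc _ _ _).trans ?_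
          refine (congrArg (hp.lift _ _ (hcomm s) ≫ ·) (toLevel_fst f₀ hp.w _)).trans ?_
          exact (hp.lift_fst _ _ _).trans (hfst s C).symm
        · refine (Category.assoc _ _ _).trans ?_
          refine (congrArg (hp.lift _ _ (hcomm s) ≫ ·) (toLevel_snd f₀ hp.w _)).trans ?_
          refine (Category.assoc _ _ _).symm.trans ?_
          exact (congrArg (· ≫ Spec.map _) (hp.lift_snd _ _ _)).trans (hfac s C)
      uniq s m hm := by
        apply hp.hom_ext
        · refine Eq.trans ?_ (hp.lift_fst _ _ _).symm
          refine Eq.trans ?_ (congrArg (· ≫ pullback.fst f₀ _) (hm b))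
          exact ((Category.assoc _ _ _).trans (congrArg (m ≫ ·) (toLevel_fst f₀ hp.w _))).symm
        · refine Eq.trans ?_ (hp.lift_snd _ _ _).symm
          refine hlim.hom_ext fun C => ?_
          refine Eq.trans ?_ (hlim.fac (scone s) C).symm
          change (m ≫ f) ≫ Spec.map (CommRingCat.ofHom C.unop.1.val.toRingHom) =
            s.π.app C ≫ pullback.snd f₀ _
          refine Eq.trans ?_ (congrArg (· ≫ pullback.snd f₀ _) (hm C))
          exact (Category.assoc _ _ _).trans
            ((Category.assoc _ _ _).trans (congrArg (m ≫ ·) (toLevel_snd f₀ hp.w _))).symm }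

lemma isNoetherian_level [LocallyOfFiniteType f₀] [QuasiCompact f₀] {C : Subalgebra E Ω}
    (hC : C.FG) : IsNoetherian (Level f₀ C) := by
  have : Algebra.FiniteType E C := (Subalgebra.fg_iff_finiteType C).mp hC
  have : IsNoetherianRing C := Algebra.FiniteType.isNoetherianRing E C
  have : IsLocallyNoetherian (Level f₀ C) :=
    LocallyOfFiniteType.isLocallyNoetherian (pullback.snd f₀ _)
  have : CompactSpace (Level f₀ C) :=
    QuasiCompact.compactSpace_of_compactSpace (pullback.snd f₀ _)
  exact {}

lemma quasiSeparatedSpace_of_isNoetherian (Y : Scheme.{u}) [IsNoetherian Y] :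
    QuasiSeparatedSpace Y := inferInstance

/-- An open subset of the base change to a finitely generated subalgebra whose inverse image in the
base change to `Ω` is affine becomes affine over a larger finitely generated subalgebra. -/
theorem exists_isAffineOpen_level [LocallyOfFiniteType f₀] [QuasiCompact f₀]
    (hp : IsPullback p f f₀ (specAlg E Ω)) {C : Subalgebra E Ω} (hC : C.FG)
    {U : (Level f₀ C).Opens} (hU : IsAffineOpen (toLevel f₀ hp.w C.val ⁻¹ᵁ U)) :
    ∃ (C' : Subalgebra E Ω) (_ : C'.FG) (h : C ≤ C'), IsAffineOpen (Level.map f₀ h ⁻¹ᵁ U) := by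
  have (C : (FGSubalg E Ω)ᵒᵖ) : QuasiSeparatedSpace ((levelDiagram (Ω := Ω) f₀).obj C) := by
    have := isNoetherian_level f₀ C.unop.2
    exact quasiSeparatedSpace_of_isNoetherian (Level f₀ C.unop.1)
  have (C C' : (FGSubalg E Ω)ᵒᵖ) (h : C ⟶ C') : IsAffineHom ((levelDiagram (Ω := Ω) f₀).map h) :=
    isAffineHom_map f₀ (leOfHom h.unop)
  -- the affine open subset comes from an affine open subset at a finite level, which agrees with
  -- `U` over a larger finitely generated subalgebra
  obtain ⟨C₁, O, hO, hOU⟩ : ∃ (C₁ : (FGSubalg E Ω)ᵒᵖ) (O : (Level f₀ C₁.unop.1).Opens),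
      IsAffineOpen O ∧ toLevel f₀ hp.w C₁.unop.1.val ⁻¹ᵁ O = toLevel f₀ hp.w C.val ⁻¹ᵁ U :=
    exists_isAffineOpen_preimage_eq (levelDiagram (Ω := Ω) f₀) _ (isLimitLevelCone f₀ hp) _ hU
  obtain ⟨C₂, h1, h2⟩ := exists_ge_ge C₁.unop ⟨C, hC⟩
  replace h1 : C₁.unop.1 ≤ C₂.1 := h1
  replace h2 : C ≤ C₂.1 := h2
  have := isNoetherian_level f₀ C₂.2
  have hcpt (W : (Level f₀ C₂.1).Opens) : IsCompact (W : Set (Level f₀ C₂.1)) :=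
    TopologicalSpace.NoetherianSpace.isCompact _
  have h12 : toLevel f₀ hp.w C₂.1.val ⁻¹ᵁ (Level.map f₀ h1 ⁻¹ᵁ O) =
      toLevel f₀ hp.w C₂.1.val ⁻¹ᵁ (Level.map f₀ h2 ⁻¹ᵁ U) := by
    rw [← Scheme.Hom.comp_preimage, ← Scheme.Hom.comp_preimage, toLevel_val_map, toLevel_val_map]
    exact hOU
  obtain ⟨C₃, h3, h4⟩ := exists_map_preimage_eq_map_preimage (levelDiagram (Ω := Ω) f₀) _
    (isLimitLevelCone f₀ hp) (i := op C₂) (hcpt _) (hcpt _) h12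
  have h3' : C₂.1 ≤ C₃.unop.1 := leOfHom h3.unop
  have h5 : Level.map f₀ h3' ⁻¹ᵁ (Level.map f₀ h1 ⁻¹ᵁ O) =
    Level.map f₀ h3' ⁻¹ᵁ (Level.map f₀ h2 ⁻¹ᵁ U) := h4
  refine ⟨C₃.unop.1, C₃.unop.2, h2.trans h3', ?_⟩
  rw [← Level.map_comp f₀ h3' h2, Scheme.Hom.comp_preimage, ← h5]
  exact (hO.preimage _).preimage _

end FiniteLevel

/-! ### Affine fibres at algebraic points -/

section FiniteTypeDescent

variable {E Ω : Type u} [Field E] [Field Ω] [Algebra E Ω] {X X₀ : Scheme.{u}}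
  {f : X ⟶ Spec (.of Ω)} {f₀ : X₀ ⟶ Spec (.of E)} {p : X ⟶ X₀}

lemma locallyOfFiniteType_of_isPullback (hp : IsPullback p f f₀ (specAlg E Ω))
    [LocallyOfFiniteType f] : LocallyOfFiniteType f₀ :=
  MorphismProperty.of_isPullback_of_descendsAlong (P := @LocallyOfFiniteType)
    (Q := @Surjective ⊓ @Flat ⊓ @QuasiCompact) hp.flip
    ⟨⟨inferInstance, inferInstance⟩, inferInstance⟩ ‹_›

lemma surjective_of_isPullback (hp : IsPullback p f f₀ (specAlg E Ω)) : Surjective p :=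
  MorphismProperty.of_isPullback (P := @Surjective) hp.flip inferInstance

lemma quasiCompact_of_isPullback (hp : IsPullback p f f₀ (specAlg E Ω))
    [QuasiCompact f] : QuasiCompact f₀ := by
  have := surjective_of_isPullback hp
  have : CompactSpace X := QuasiCompact.compactSpace_of_compactSpace f
  have : CompactSpace X₀ := p.surjective.compactSpace p.continuous
  rw [quasiCompact_iff_compactSpace]
  exact this

end FiniteTypeDescent

section Specialization

variable {k Ω : Type u} [Field k] [Field Ω] [Algebra k Ω] {X : Scheme.{u}} {f : X ⟶ Spec (.of Ω)}

/-- The values of a point of a finitely generated algebra lie in a finitely generated subalgebra. -/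
lemma exists_fg_subalgebra {L : IntermediateField k Ω} {R : Subalgebra k Ω} (hR : R.FG)
    (x : R →ₐ[k] Ω) : ∃ C : Subalgebra L Ω, C.FG ∧ ∀ r, x r ∈ C := by
  have : Algebra.FiniteType k R := (Subalgebra.fg_iff_finiteType R).mp hR
  refine ⟨(evalAt L x).range, ?_, fun r => ⟨1 ⊗ₜ r, ?_⟩⟩
  · rw [Subalgebra.fg_iff_finiteType]
    exact Algebra.FiniteType.of_surjective (evalAt L x).rangeRestrict
      (evalAt L x).rangeRestrict_surjective
  · exact (evalAt_tmul L x 1 r).trans (by rw [map_one, one_mul])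

variable (ρ : SchemeAction Gal(Ω/k) f)

/-- If the family `𝒰` has an affine fibre at a generic point, then its fibres at suitable algebraic
points are affine: affineness of the fibre already holds over a finitely generated algebra
containing the coordinates of the generic point, which can be specialized. -/
lemma exists_isAffineOpen_fibre [IsAlgClosed Ω] [CharZero Ω]
    (htr : Cardinal.aleph0 ≤ Algebra.trdeg k Ω) [LocallyOfFiniteType f] [QuasiCompact f]
    [IsSeparated f] {L : IntermediateField k Ω} (hL : L.FG)
    (hcov : ∀ x, ∃ U, (ρ.restrict L.fixingSubgroup).Good U ∧ x ∈ U)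
    {R : Subalgebra k Ω} (hR : R.FG) {𝒰 : (Fam f R).Opens} (h𝒰 : (Fam.action R ρ).Stable 𝒰)
    {x : R →ₐ[k] Ω} (hx : IsGeneric L x) (hxa : IsAffineOpen (Fam.fibre f x ⁻¹ᵁ 𝒰))
    {a : R} (ha : a ≠ 0) :
    ∃ y : R →ₐ[k] Ω, y a ≠ 0 ∧ (∀ r, IsAlgebraic k (y r)) ∧
      IsAffineOpen (Fam.fibre f y ⁻¹ᵁ 𝒰) := by
  have : Algebra.FiniteType k R := (Subalgebra.fg_iff_finiteType R).mp hR
  have hE' : ∀ c : Ω, (∀ γ : L.fixingSubgroup, γ • c = c) → c ∈ (algebraMap L Ω).range :=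
    fun c hc => ⟨⟨c, mem_of_forall_gal htr hL fun σ hσ => hc ⟨σ, fun y => hσ y y.2⟩⟩, rfl⟩
  obtain ⟨X₀, f₀, p, hp, hρp⟩ := (ρ.restrict L.fixingSubgroup).exists_quotient (E := L)
    (fun c γ => γ.2 c) hE' hcov
  have := locallyOfFiniteType_of_isPullback hp
  have := quasiCompact_of_isPullback hp
  have hsa : specAlg L Ω ≫ specAlg k L = specAlg k Ω := by
    rw [← Spec.map_comp]; rfl
  have hpk : p ≫ f₀ ≫ specAlg k L = f ≫ specAlg k Ω := by
    rw [← Category.assoc, hp.w, Category.assoc, hsa]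
  -- the family over `X` is the base change of a family over `X₀`, and the stable open subset `𝒰` is
  -- the inverse image of an open subset `𝒰₀` of the latter
  let g : Spec (.of R) ⟶ Spec (.of k) := Spec.map (CommRingCat.ofHom (algebraMap k R))
  let P : Fam f R ⟶ pullback (f₀ ≫ specAlg k L) g :=
    pullback.lift (Fam.fst f R ≫ p) (Fam.snd f R) (by
      rw [Category.assoc, hpk]
      exact pullback.condition)
  have hP1 : P ≫ pullback.fst _ _ = Fam.fst f R ≫ p := pullback.lift_fst _ _ _
  have hP2 : P ≫ pullback.snd _ _ = Fam.snd f R := pullback.lift_snd _ _ _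
  have hP : IsPullback P (Fam.fst f R ≫ f) (pullback.fst (f₀ ≫ specAlg k L) g ≫ f₀)
      (specAlg L Ω) := by
    refine IsPullback.paste_vert ?_ hp
    refine IsPullback.of_right (h₁₂ := pullback.snd _ _) (h₂₂ := f₀ ≫ specAlg k L) (v₁₃ := g)
      ?_ hP1 (IsPullback.of_hasPullback _ _).flip
    rw [hP2, hpk]
    exact (IsPullback.of_hasPullback _ _).flip
  have hPρ (γ : L.fixingSubgroup) :
      ((Fam.action R ρ).restrict L.fixingSubgroup).hom γ ≫ P = P := by
    apply pullback.hom_ext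
    · rw [Category.assoc, hP1]
      refine (Category.assoc _ _ _).symm.trans ?_
      refine (congrArg (· ≫ p) (Fam.actionHom_fst ρ γ.1)).trans ?_
      exact (Category.assoc _ _ _).trans (congrArg (Fam.fst f R ≫ ·) (hρp γ))
    · rw [Category.assoc, hP2]
      exact Fam.actionHom_snd ρ γ.1
  obtain ⟨𝒰₀, h𝒰₀⟩ := exists_preimage_eq_of_stable hP hPρ hE' (O := 𝒰) fun γ => h𝒰 γ
  obtain ⟨C₀, hC₀, hxC₀⟩ := exists_fg_subalgebra (L := L) hR x
  -- a homomorphism from `C` to `Ω` specializes the point `x` to another point of `R`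
  have hfib (C : Subalgebra L Ω) (hC : ∀ r, x r ∈ C) (c : C →ₐ[L] Ω) :
      ∃ y : R →ₐ[k] Ω, (∀ r, y r = c ⟨x r, hC r⟩) := by
    refine ⟨(c.restrictScalars k).comp
      (x.codRestrict (C.restrictScalars k) hC : R →ₐ[k] (C.restrictScalars k)), fun r => rfl⟩
  let i : CommRingCat.of R ⟶ CommRingCat.of C₀ :=
    CommRingCat.ofHom ((x : R →+* Ω).codRestrict C₀ hxC₀)
  have hi : CommRingCat.ofHom (algebraMap k R) ≫ i =
      CommRingCat.ofHom (algebraMap k L) ≫ CommRingCat.ofHom (algebraMap L C₀) := by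
    ext r
    exact x.commutes r
  -- the base change of `X₀` to `C₀` maps to the family over `X₀`; the fibre of `𝒰` over a point
  -- that factors through `c : C₀ → Ω` is the inverse image of `l⁻¹ 𝒰₀`
  let l : Level f₀ C₀ ⟶ pullback (f₀ ≫ specAlg k L) g :=
    pullback.lift (pullback.fst _ _) (pullback.snd _ _ ≫ Spec.map i) (by
      rw [Category.assoc, ← Spec.map_comp, hi, Spec.map_comp, ← Category.assoc,
        pullback.condition, Category.assoc])
  have hl (c : C₀ →ₐ[L] Ω) (y : R →ₐ[k] Ω) (hy : ∀ r, y r = c ⟨x r, hxC₀ r⟩) :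
      toLevel f₀ hp.w c ⁻¹ᵁ (l ⁻¹ᵁ 𝒰₀) = Fam.fibre f y ⁻¹ᵁ 𝒰 := by
    suffices h : toLevel f₀ hp.w c ≫ l = Fam.fibre f y ≫ P by
      rw [← h𝒰₀, ← Scheme.Hom.comp_preimage, ← Scheme.Hom.comp_preimage, h]
    apply pullback.hom_ext
    · rw [Category.assoc, Category.assoc, hP1, reassoc_of% Fam.fibre_fst f y]
      exact (congrArg (toLevel f₀ hp.w c ≫ ·) (pullback.lift_fst _ _ _)).trans
        (toLevel_fst f₀ hp.w c)
    · rw [Category.assoc, Category.assoc, hP2, Fam.fibre_snd f y]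
      refine (congrArg (toLevel f₀ hp.w c ≫ ·) (pullback.lift_snd _ _ _)).trans ?_
      rw [reassoc_of% toLevel_snd f₀ hp.w c, ← Spec.map_comp]
      congr 2
      ext r
      exact (hy r).symm
  have hUa : IsAffineOpen (toLevel f₀ hp.w C₀.val ⁻¹ᵁ (l ⁻¹ᵁ 𝒰₀)) := by
    rw [hl C₀.val x fun r => rfl]
    exact hxa
  obtain ⟨C, hC, hle, hCa⟩ := exists_isAffineOpen_level f₀ hp hC₀ hUa
  obtain ⟨c, hca, hcalg⟩ := exists_algebraic_specialization htr hL hx hC (fun r => hle (hxC₀ r)) ha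
  obtain ⟨y, hy⟩ := hfib C (fun r => hle (hxC₀ r)) c
  refine ⟨y, by rwa [hy], fun r => by rw [hy]; exact hcalg r, ?_⟩
  rw [← hl (c.comp (Subalgebra.inclusion hle)) y hy, ← toLevel_map f₀ hp.w hle,
    Scheme.Hom.comp_preimage]
  have := isAffineHom_toLevel f₀ hp c
  exact hCa.preimage _

variable {ρ}

lemma SchemeAction.Stable.sup {Γ : Type*} [Group Γ] [MulSemiringAction Γ Ω] {ρ : SchemeAction Γ f}
    {U V : X.Opens} (hU : ρ.Stable U) (hV : ρ.Stable V) : ρ.Stable (U ⊔ V) :=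
  fun γ => by rw [Scheme.Hom.preimage_sup, hU γ, hV γ]

lemma SchemeAction.Stable.of_le {L L' : IntermediateField k Ω} (h : L ≤ L') {U : X.Opens}
    (hU : (ρ.restrict L.fixingSubgroup).Stable U) : (ρ.restrict L'.fixingSubgroup).Stable U :=
  fun γ => hU ⟨γ.1, IntermediateField.fixingSubgroup_le h γ.2⟩

lemma SchemeAction.Good.of_le {L L' : IntermediateField k Ω} (h : L ≤ L') {U : X.Opens}
    (hU : (ρ.restrict L.fixingSubgroup).Good U) : (ρ.restrict L'.fixingSubgroup).Good U :=
  hU.of_forall_exists fun γ => ⟨⟨γ.1, IntermediateField.fixingSubgroup_le h γ.2⟩, rfl⟩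

/-- A vector of a representation that is split over a finitely generated field is rational over a
larger finitely generated field, containing its coordinates in an invariant basis. -/
lemma IsSplit.exists_fg_fixed {W : Type*} [AddCommGroup W] [Module Ω W]
    {L : IntermediateField k Ω} {a : L.fixingSubgroup →* AddMonoid.End W} (h : IsSplit Ω a)
    (ha : IsSemilinear Ω a) (hL : L.FG) (w : W) :
    ∃ L' : IntermediateField k Ω, L'.FG ∧ L ≤ L' ∧
      ∀ γ : L.fixingSubgroup, (∀ y ∈ L', γ.1 y = y) → a γ w = w := by
  classical
  obtain ⟨ι, b, hb⟩ := h.exists_basis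
  let s : Finset Ω := (b.repr w).support.image (b.repr w)
  refine ⟨L ⊔ IntermediateField.adjoin k s, IntermediateField.fg_sup hL
    (IntermediateField.fg_adjoin_finset s), le_sup_left, fun γ hγ => ?_⟩
  apply b.repr.injective
  ext i
  rw [repr_act ha b hb]
  by_cases hi : b.repr w i = 0
  · rw [hi, smul_zero]
  · refine hγ _ (le_sup_right (a := L) (IntermediateField.subset_adjoin _ _ ?_))
    exact Finset.mem_coe.mpr (Finset.mem_image_of_mem _ (Finsupp.mem_support_iff.mpr hi))

/-- If the action is defined over a finitely generated field, then every quasi-compact open subset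
is defined over a finitely generated field. -/
lemma exists_fg_stable {L : IntermediateField k Ω} (hL : L.FG)
    (hcov : ∀ x, ∃ U, (ρ.restrict L.fixingSubgroup).Good U ∧ x ∈ U) {U : X.Opens}
    (hU : IsCompact (U : Set X)) :
    ∃ L' : IntermediateField k Ω, L'.FG ∧ L ≤ L' ∧ (ρ.restrict L'.fixingSubgroup).Stable U := by
  let p (S : Set X) : Prop := ∃ (L' : IntermediateField k Ω) (O : X.Opens), L'.FG ∧ L ≤ L' ∧
    S ⊆ O ∧ O ≤ U ∧ (ρ.restrict L'.fixingSubgroup).Stable O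
  have hp : p U := by
    refine hU.induction_on ?_ ?_ ?_ ?_
    · exact ⟨L, ⊥, hL, le_rfl, Set.empty_subset _, bot_le, fun γ => rfl⟩
    · rintro S T hST ⟨L', O, h1, h2, h3, h4⟩
      exact ⟨L', O, h1, h2, hST.trans h3, h4⟩
    · rintro S T ⟨L₁, O₁, h1, h2, h3, h4, h5⟩ ⟨L₂, O₂, h1', h2', h3', h4', h5'⟩
      exact ⟨L₁ ⊔ L₂, O₁ ⊔ O₂, IntermediateField.fg_sup h1 h1', h2.trans le_sup_left,
        Set.union_subset_union h3 h3', sup_le h4 h4',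
        (h5.of_le le_sup_left).sup (h5'.of_le le_sup_right)⟩
    · intro x hxU
      -- a neighbourhood of `x` in `U` is cut out by a single function
      obtain ⟨W, hW, hxW⟩ := hcov x
      obtain ⟨a, hle, hxa⟩ := hW.affine.exists_basicOpen_le (V := U) ⟨x, hxU⟩ hxW
      obtain ⟨L', hL', hLL', hL'a⟩ := hW.split.exists_fg_fixed
        (SchemeAction.isSemilinear_act hW.stable) hL (a : Sect f W)
      refine ⟨_, mem_nhdsWithin_of_mem_nhds ((X.basicOpen a).isOpen.mem_nhds hxa), L',
        X.basicOpen a, hL', hLL', subset_rfl, hle, fun γ => ?_⟩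
      let γ' : L.fixingSubgroup := ⟨γ.1, IntermediateField.fixingSubgroup_le hLL' γ.2⟩
      refine (SchemeAction.preimage_basicOpen hW.stable γ' a).trans ?_
      exact congrArg _ (hL'a γ' fun y hy => γ.2 ⟨y, hy⟩)
  obtain ⟨L', O, h1, h2, h3, h4, h5⟩ := hp
  obtain rfl : O = U := le_antisymm h4 h3
  exact ⟨L', h1, h2, h5⟩

/-- Every affine open subset `U` is, up to conjugation, a fibre of a stable family of open subsets
that has affine fibres at suitable algebraic points. -/
theorem exists_affine_family [IsAlgClosed Ω] [CharZero Ω] (ρ : SchemeAction Gal(Ω/k) f)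
    (htr : Cardinal.aleph0 ≤ Algebra.trdeg k Ω) [LocallyOfFiniteType f] [QuasiCompact f]
    [IsSeparated f] {L : IntermediateField k Ω} (hL : L.FG)
    (hcov : ∀ x, ∃ U, (ρ.restrict L.fixingSubgroup).Good U ∧ x ∈ U)
    {U : X.Opens} (hU : IsAffineOpen U) :
    ∃ (R : Subalgebra k Ω) (_ : R.FG) (𝒰 : (Fam f R).Opens), (Fam.action R ρ).Stable 𝒰 ∧
      (∃ (x : R →ₐ[k] Ω) (σ : Gal(Ω/k)), Fam.fibre f x ⁻¹ᵁ 𝒰 = ρ.hom σ ⁻¹ᵁ U) ∧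
      ∀ a : R, a ≠ 0 → ∃ y : R →ₐ[k] Ω, y a ≠ 0 ∧ (∀ r, IsAlgebraic k (y r)) ∧
        IsAffineOpen (Fam.fibre f y ⁻¹ᵁ 𝒰) := by
  obtain ⟨L', hL', hLL', hU'⟩ := exists_fg_stable hL hcov hU.isCompact
  have hcov' (x : X) : ∃ U, (ρ.restrict L'.fixingSubgroup).Good U ∧ x ∈ U := by
    obtain ⟨U, hU, hx⟩ := hcov x
    exact ⟨U, hU.of_le hLL', hx⟩
  obtain ⟨R, hR, hRL⟩ := exists_subalgebra_of_fg hL'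
  obtain ⟨𝒰, h𝒰, N, hN, hLN, hfib⟩ := exists_family ρ htr hR hL' hRL hcov' hU'
  obtain ⟨σ, hσ⟩ := exists_isGeneric_gal htr hR hN
  refine ⟨R, hR, 𝒰, h𝒰, ⟨_, σ, hfib σ hσ⟩, fun a ha => ?_⟩
  refine exists_isAffineOpen_fibre ρ htr hL' hcov' hR h𝒰 (hσ.mono hLN) ?_ ha
  rw [hfib σ hσ]
  exact hU.preimage _

end Specialization

/-! ### Rational points -/

section Points

variable {Ω : Type u} [Field Ω] {X : Scheme.{u}} {f : X ⟶ Spec (.of Ω)}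

/-- The `Ω`-valued points of a scheme over `Ω`. -/
abbrev SchemePt (f : X ⟶ Spec (.of Ω)) : Type u := {z : Spec (.of Ω) ⟶ X // z ≫ f = 𝟙 _}

variable (Ω) in
/-- The point of `Spec Ω`. -/
def specPt : Spec (.of Ω) := IsLocalRing.closedPoint Ω

/-- The point of the underlying space defined by an `Ω`-valued point. -/
def SchemePt.pos (z : SchemePt f) : X := z.1 (specPt Ω)

lemma SchemePt.exists_pos_eq [IsAlgClosed Ω] [LocallyOfFiniteType f] {x : X} (hx : IsClosed {x}) :
    ∃ z : SchemePt f, z.pos = x :=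
  ⟨⟨pointOfClosedPoint f x hx, pointOfClosedPoint_comp f x hx⟩, pointOfClosedPoint_apply f x hx _⟩

lemma SchemePt.exists_pos_mem [IsAlgClosed Ω] [LocallyOfFiniteType f] {S : Set X}
    (hS : IsLocallyClosed S) (hne : S.Nonempty) : ∃ z : SchemePt f, z.pos ∈ S := by
  have : JacobsonSpace X := LocallyOfFiniteType.jacobsonSpace f
  obtain ⟨x, hxS, hx⟩ := nonempty_inter_closedPoints hne hS
  obtain ⟨z, rfl⟩ := SchemePt.exists_pos_eq (f := f) hx
  exact ⟨z, hxS⟩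

variable {Γ : Type*} [Group Γ] [MulSemiringAction Γ Ω] (ρ : SchemeAction Γ f)

lemma specAct_comp (γ δ : Γ) : specAct Ω γ ≫ specAct Ω δ = specAct Ω (γ * δ) := by
  rw [← Spec.map_comp, ← CommRingCat.ofHom_comp]
  congr 2
  refine RingHom.ext fun c => ?_
  exact (mul_smul γ δ c).symm

lemma specAct_one : specAct Ω (1 : Γ) = 𝟙 _ := by
  refine (congrArg Spec.map ?_).trans (Spec.map_id _)
  exact CommRingCat.hom_ext (RingHom.ext fun c => one_smul Γ c)

/-- The action on points: a point is mapped to its conjugate. -/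
def SchemeAction.smulPt (γ : Γ) (z : SchemePt f) : SchemePt f :=
  ⟨specAct Ω γ ≫ z.1 ≫ ρ.hom γ⁻¹, by
    rw [Category.assoc, Category.assoc, ρ.hom_over, ← Category.assoc z.1, z.2, Category.id_comp,
      specAct_comp, mul_inv_cancel, specAct_one]⟩

lemma SchemeAction.smulPt_mul (γ δ : Γ) (z : SchemePt f) :
    ρ.smulPt (γ * δ) z = ρ.smulPt γ (ρ.smulPt δ z) := by
  apply Subtype.ext
  simp only [smulPt, mul_inv_rev, ← ρ.hom_comp, ← specAct_comp, Category.assoc]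

lemma SchemeAction.smulPt_one (z : SchemePt f) : ρ.smulPt 1 z = z := by
  apply Subtype.ext
  simp only [smulPt, inv_one, ρ.hom_one, specAct_one, Category.id_comp, Category.comp_id]

lemma SchemeAction.smulPt_comp (γ : Γ) (z : SchemePt f) :
    (ρ.smulPt γ z).1 ≫ ρ.hom γ = specAct Ω γ ≫ z.1 := by
  rw [smulPt, Category.assoc, Category.assoc, ρ.hom_comp, inv_mul_cancel, ρ.hom_one,
    Category.comp_id]

lemma SchemeAction.pos_smulPt (γ : Γ) (z : SchemePt f) :
    ρ.hom γ (ρ.smulPt γ z).pos = z.pos := by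
  have h : specAct Ω γ (specPt Ω) = specPt Ω := Subsingleton.elim (α := PrimeSpectrum Ω) _ _
  rw [SchemePt.pos, ← Scheme.Hom.comp_apply, smulPt_comp, Scheme.Hom.comp_apply, h]
  rfl

lemma SchemeAction.pos_smulPt_mem {U : X.Opens} {γ : Γ} {z : SchemePt f} :
    (ρ.smulPt γ z).pos ∈ ρ.hom γ ⁻¹ᵁ U ↔ z.pos ∈ U := by
  rw [← ρ.pos_smulPt γ z]
  rfl

end Points

section Slice

variable {k Ω : Type u} [Field k] [Field Ω] [Algebra k Ω] {X : Scheme.{u}} {f : X ⟶ Spec (.of Ω)}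
  (R : Subalgebra k Ω)

/-- The inclusion of the slice of the family through a point `z`. -/
def Fam.slice (z : SchemePt f) : Spec (.of (Ω ⊗[k] R)) ⟶ Fam f R :=
  pullback.lift
    (Spec.map (CommRingCat.ofHom Algebra.TensorProduct.includeLeftRingHom) ≫ z.1)
    (Spec.map (CommRingCat.ofHom Algebra.TensorProduct.includeRight.toRingHom)) (by
    rw [Category.assoc, ← Category.assoc z.1, z.2, Category.id_comp, ← Spec.map_comp,
      ← Spec.map_comp, ← CommRingCat.ofHom_comp, ← CommRingCat.ofHom_comp]
    congr 2
    ext c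
    exact (Algebra.TensorProduct.includeRight (R := k) (A := Ω) (B := R)).commutes c |>.symm)

/-- The action on the first factor of `Ω ⊗ R`. -/
def tensorAct (τ : Gal(Ω/k)) : Ω ⊗[k] R →ₐ[k] Ω ⊗[k] R :=
  Algebra.TensorProduct.map (τ : Ω →ₐ[k] Ω) (AlgHom.id k R)

lemma tensorAct_tmul (τ : Gal(Ω/k)) (c : Ω) (r : R) :
    tensorAct R τ (c ⊗ₜ r) = τ c ⊗ₜ r := rfl

lemma tensorAct_one : tensorAct (k := k) (Ω := Ω) R 1 = AlgHom.id k _ :=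
  Algebra.TensorProduct.ext' fun _ _ => rfl

lemma tensorAct_mul (σ τ : Gal(Ω/k)) :
    tensorAct R (σ * τ) = (tensorAct R σ).comp (tensorAct R τ) :=
  Algebra.TensorProduct.ext' fun _ _ => rfl

variable {R}

lemma Fam.specMap_slice (z : SchemePt f) (y : R →ₐ[k] Ω) :
    Spec.map (CommRingCat.ofHom (evalAt Ω y).toRingHom) ≫ slice R z = z.1 ≫ fibre f y := by
  apply pullback.hom_ext
  · rw [Category.assoc, Category.assoc, fibre_fst, Category.comp_id]
    refine (congrArg (_ ≫ ·) (pullback.lift_fst _ _ _)).trans ?_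
    rw [← Category.assoc, ← Spec.map_comp, ← CommRingCat.ofHom_comp]
    refine Eq.trans (congrArg (· ≫ z.1) ?_) (Category.id_comp z.1)
    rw [← Spec.map_id]
    congr 1
    ext c
    exact (evalAt_tmul Ω y c 1).trans (by rw [map_one, mul_one]; rfl)
  · rw [Category.assoc, Category.assoc, fibre_snd, ← Category.assoc z.1, z.2, Category.id_comp]
    refine (congrArg (_ ≫ ·) (pullback.lift_snd _ _ _)).trans ?_
    rw [← Spec.map_comp, ← CommRingCat.ofHom_comp]
    congr 2
    ext r
    exact (evalAt_tmul Ω y 1 r).trans (by rw [map_one, one_mul]; rfl)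

lemma Fam.specMap_tensorAct_slice (ρ : SchemeAction Gal(Ω/k) f) (τ : Gal(Ω/k)) (z : SchemePt f) :
    Spec.map (CommRingCat.ofHom (tensorAct R τ).toRingHom) ≫ slice R z =
      slice R (ρ.smulPt τ z) ≫ actionHom R ρ τ := by
  apply pullback.hom_ext
  · rw [Category.assoc, Category.assoc, actionHom_fst]
    refine (congrArg (_ ≫ ·) (pullback.lift_fst _ _ _)).trans ?_
    refine Eq.trans ?_ ((congrArg (· ≫ ρ.hom τ) (pullback.lift_fst _ _ _)).symm.trans
      (Category.assoc _ _ _))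
    rw [Category.assoc, ρ.smulPt_comp, ← Category.assoc, ← Category.assoc, ← Spec.map_comp,
      ← Spec.map_comp, ← CommRingCat.ofHom_comp, ← CommRingCat.ofHom_comp]
    congr 3
  · rw [Category.assoc, Category.assoc, actionHom_snd]
    refine (congrArg (_ ≫ ·) (pullback.lift_snd _ _ _)).trans ?_
    refine Eq.trans ?_ (pullback.lift_snd _ _ _).symm
    rw [← Spec.map_comp, ← CommRingCat.ofHom_comp]
    congr 2
    ext r
    exact (Algebra.TensorProduct.map_tmul _ _ _ _).trans (by rw [map_one]; rfl)

lemma Fam.slice_preimage_smulPt {ρ : SchemeAction Gal(Ω/k) f} {𝒰 : (Fam f R).Opens}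
    (h𝒰 : (Fam.action R ρ).Stable 𝒰) (τ : Gal(Ω/k)) (z : SchemePt f) :
    Spec.map (CommRingCat.ofHom (tensorAct R τ).toRingHom) ⁻¹ᵁ (slice R z ⁻¹ᵁ 𝒰) =
      slice R (ρ.smulPt τ z) ⁻¹ᵁ 𝒰 := by
  rw [← Scheme.Hom.comp_preimage, specMap_tensorAct_slice ρ, Scheme.Hom.comp_preimage]
  exact congrArg _ (h𝒰 τ)

/-- The slice through `z` of an open subset of the family describes the fibres that contain `z`. -/
lemma Fam.mem_slice_preimage (z : SchemePt f) (y : R →ₐ[k] Ω) (𝒰 : (Fam f R).Opens) :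
    Spec.map (CommRingCat.ofHom (evalAt Ω y).toRingHom) (specPt Ω) ∈
      slice R z ⁻¹ᵁ 𝒰 ↔ z.pos ∈ fibre f y ⁻¹ᵁ 𝒰 := by
  change slice R z (Spec.map (CommRingCat.ofHom (evalAt Ω y).toRingHom) _) ∈ 𝒰 ↔
    fibre f y (z.1 _) ∈ 𝒰
  rw [← Scheme.Hom.comp_apply, specMap_slice, Scheme.Hom.comp_apply]

/-- A nonempty stable open subset of `Spec (Ω ⊗ R)` contains all points at which a certain nonzero
element of `R` does not vanish: the ideal of the complement is stable, hence spanned by elements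
of `R`. -/
lemma exists_ne_zero_of_stable [IsAlgClosed Ω] [CharZero Ω]
    (htr : Cardinal.aleph0 ≤ Algebra.trdeg k Ω) {O : (Spec (.of (Ω ⊗[k] R))).Opens}
    (hO : ∀ τ, Spec.map (CommRingCat.ofHom (tensorAct R τ).toRingHom) ⁻¹ᵁ O = O)
    (hne : (O : Set (Spec (.of (Ω ⊗[k] R)))).Nonempty) :
    ∃ a : R, a ≠ 0 ∧ ∀ y : R →ₐ[k] Ω, y a ≠ 0 →
      Spec.map (CommRingCat.ofHom (evalAt Ω y).toRingHom) (specPt Ω) ∈ O := by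
  let I : Ideal (Ω ⊗[k] R) := PrimeSpectrum.vanishingIdeal {q | q ∉ O}
  have hI (b : Ω ⊗[k] R) : b ∈ I ↔ ∀ q : PrimeSpectrum (Ω ⊗[k] R), b ∉ q.asIdeal → q ∈ O := by
    rw [PrimeSpectrum.mem_vanishingIdeal]
    exact forall_congr' fun q => not_imp_comm
  let A : Gal(Ω/k) →* AddMonoid.End (Ω ⊗[k] R) :=
    { toFun τ := (tensorAct R τ).toRingHom.toAddMonoidHom
      map_one' := by
        ext b
        exact congr($(tensorAct_one R) b)
      map_mul' σ τ := by
        ext b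
        exact congr($(tensorAct_mul R σ τ) b) }
  have hA (τ : Gal(Ω/k)) (b : Ω ⊗[k] R) : A τ b = tensorAct R τ b := rfl
  have hsemi : IsSemilinear Ω A := by
    intro τ c b
    induction b with
    | zero => simp
    | add b b' hb hb' => rw [smul_add, map_add, map_add, hb, hb', smul_add]
    | tmul c' r =>
      rw [TensorProduct.smul_tmul', hA, hA, tensorAct_tmul, tensorAct_tmul,
        TensorProduct.smul_tmul']
      exact congrArg (· ⊗ₜ[k] r) (map_mul τ c c')
  let b := (Module.Basis.ofVectorSpace k R).baseChange Ω
  have hb (i) : b i ∈ invariants A := fun τ => by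
    rw [Module.Basis.baseChange_apply, hA, tensorAct_tmul, map_one]
  have hsplit : IsSplit Ω A := by
    rw [IsSplit, eq_top_iff, ← b.span_eq]
    exact Submodule.span_mono (Set.range_subset_iff.mpr hb)
  have hst (τ) (c : Ω ⊗[k] R) (hc : c ∈ I) : A τ c ∈ I := by
    rw [hI] at hc ⊢
    intro q hq
    rw [← hO τ]
    exact hc (PrimeSpectrum.comap (tensorAct R τ).toRingHom q) hq
  have hspan := hsplit.span_invariants_inter hsemi (I.restrictScalars Ω) hst
  -- the invariants of `Ω ⊗ R` are the elements of `R`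
  have hInv (c : Ω ⊗[k] R) (hc : c ∈ invariants A) : ∃ a : R, c = 1 ⊗ₜ a := by
    have hr (i) : ∃ d : k, algebraMap k Ω d = b.repr c i :=
      mem_range_algebraMap_of_forall_gal htr fun σ => by
        have := repr_act hsemi b hb σ c i
        rw [hc σ] at this
        exact this.symm
    choose d hd using hr
    refine ⟨∑ i ∈ (b.repr c).support, d i • Module.Basis.ofVectorSpace k R i, ?_⟩
    conv_lhs => rw [← b.linearCombination_repr c, Finsupp.linearCombination_apply, Finsupp.sum]
    rw [TensorProduct.tmul_sum]
    refine Finset.sum_congr rfl fun i _ => ?_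
    rw [← hd, TensorProduct.tmul_smul, algebraMap_smul, Module.Basis.baseChange_apply]
  obtain ⟨q, hq⟩ := hne
  obtain ⟨a, ha, haI⟩ : ∃ a : R, a ≠ 0 ∧ (1 ⊗ₜ a : Ω ⊗[k] R) ∈ I := by
    by_contra! hcon
    -- then the complement of `O`, being closed and dense, would be everything
    have hI0 : I = ⊥ := by
      rw [eq_bot_iff]
      intro c hc
      have hc' : c ∈ I.restrictScalars Ω := hc
      replace hc' := hspan hc'
      refine (Submodule.span_le.mpr ?_ : _ ≤ (⊥ : Submodule Ω (Ω ⊗[k] R))) hc'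
      rintro c ⟨hc, hcI⟩
      obtain ⟨a, rfl⟩ := hInv c hc
      by_cases ha : a = 0
      · rw [ha, TensorProduct.tmul_zero]; exact Submodule.zero_mem _
      · exact absurd hcI (hcon a ha)
    have hc : IsClosed {q : PrimeSpectrum (Ω ⊗[k] R) | q ∉ O} := O.isOpen.isClosed_compl
    have h1 : closure {q : PrimeSpectrum (Ω ⊗[k] R) | q ∉ O} = Set.univ := by
      rw [← PrimeSpectrum.zeroLocus_vanishingIdeal_eq_closure]
      change PrimeSpectrum.zeroLocus (I : Set (Ω ⊗[k] R)) = _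
      rw [hI0]
      exact PrimeSpectrum.zeroLocus_bot
    rw [hc.closure_eq] at h1
    have h2 : q ∈ {q : PrimeSpectrum (Ω ⊗[k] R) | q ∉ O} := by rw [h1]; trivial
    exact h2 hq
  refine ⟨a, ha, fun y hy => (hI _).mp haI _ fun h => hy ?_⟩
  have h1 : evalAt Ω y (1 ⊗ₜ a) ∈ (IsLocalRing.closedPoint Ω).asIdeal := h
  rw [evalAt_tmul, map_one, one_mul] at h1
  by_contra hne
  exact (IsLocalRing.closedPoint Ω).isPrime.ne_top (Ideal.eq_top_of_isUnit_mem _ h1 (.mk0 _ hne))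

end Slice

/-! ### Covers by good open subsets -/

section FiniteExtensions

variable {k Ω : Type u} [Field k] [Field Ω] [Algebra k Ω]

/-- The values of an algebraic point of an algebra of finite type lie in a finite extension. -/
lemma exists_finiteDimensional_of_isAlgebraic {B : Type*} [CommRing B] [Algebra k B]
    [hB : Algebra.FiniteType k B] {y : B →ₐ[k] Ω} (hy : ∀ b, IsAlgebraic k (y b)) :
    ∃ K : IntermediateField k Ω, FiniteDimensional k K ∧ ∀ b, y b ∈ K := by
  obtain ⟨s, hs⟩ := hB.out
  have : Finite (y '' s) := (s.finite_toSet.image y).to_subtype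
  refine ⟨IntermediateField.adjoin k (y '' s), IntermediateField.finiteDimensional_adjoin ?_,
    fun b => ?_⟩
  · rintro _ ⟨b, -, rfl⟩
    exact (hy b).isIntegral
  · have h1 : y b ∈ (⊤ : Subalgebra k B).map y := ⟨b, trivial, rfl⟩
    rw [← hs, AlgHom.map_adjoin] at h1
    exact IntermediateField.algebra_adjoin_le_adjoin k _ h1

/-- A function on `Gal(Ω/k)` that only depends on the restriction to a finite extension takes only
finitely many values. -/
lemma finite_range_of_agree (K : IntermediateField k Ω) [FiniteDimensional k K] {β : Type*}
    {F : Gal(Ω/k) → β} (h : ∀ σ τ : Gal(Ω/k), (∀ x ∈ K, σ x = τ x) → F σ = F τ) :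
    (Set.range F).Finite := by
  let r (σ : Gal(Ω/k)) : K →ₐ[k] Ω := (σ : Ω →ₐ[k] Ω).comp K.val
  refine (Set.finite_range fun x : Set.range r => F x.2.choose).subset ?_
  rintro _ ⟨σ, rfl⟩
  refine ⟨⟨r σ, σ, rfl⟩, h _ _ fun x hx => ?_⟩
  exact congr($((⟨σ, rfl⟩ : ∃ τ, r τ = r σ).choose_spec) ⟨x, hx⟩)

variable {X : Scheme.{u}} {f : X ⟶ Spec (.of Ω)} (ρ : SchemeAction Gal(Ω/k) f)

/-- The fibre of a stable family at a point with coordinates in `K` is stable over `K`. -/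
lemma stable_fibre {R : Subalgebra k Ω} {𝒰 : (Fam f R).Opens} (h𝒰 : (Fam.action R ρ).Stable 𝒰)
    {K : IntermediateField k Ω} {y : R →ₐ[k] Ω} (hy : ∀ r, y r ∈ K) :
    (ρ.restrict K.fixingSubgroup).Stable (Fam.fibre f y ⁻¹ᵁ 𝒰) := fun γ => by
  have h : (γ.1 : Ω →ₐ[k] Ω).comp y = y := AlgHom.ext fun r => γ.2 ⟨_, hy r⟩
  have h1 := Fam.fibre_action ρ γ.1 y
  rw [h] at h1
  have h2 : ρ.hom γ.1 ⁻¹ᵁ (Fam.fibre f y ⁻¹ᵁ 𝒰) = Fam.fibre f y ⁻¹ᵁ 𝒰 := by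
    rw [← Scheme.Hom.comp_preimage, ← h1, Scheme.Hom.comp_preimage]
    exact congrArg _ (h𝒰 γ.1)
  exact h2

/-- The action of the automorphisms over an intermediate field. -/
def SchemeAction.over (K : IntermediateField k Ω) : SchemeAction Gal(Ω/K) f :=
  ρ.comap (AlgEquiv.restrictScalarsHom k) fun _ _ => rfl

/-- Stable affine open subsets over a finite extension `K` of `k` are good, since the action of the
automorphisms over `K` is again locally split over a finitely generated field. -/
lemma good_over [IsAlgClosed Ω] [CharZero Ω] (htr : Cardinal.aleph0 ≤ Algebra.trdeg k Ω)
    {L : IntermediateField k Ω} (hL : L.FG)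
    (hcov : ∀ x, ∃ U, (ρ.restrict L.fixingSubgroup).Good U ∧ x ∈ U)
    (K : IntermediateField k Ω) [FiniteDimensional k K] {O : X.Opens}
    (hO : (ρ.restrict K.fixingSubgroup).Stable O) (hOa : IsAffineOpen O) : (ρ.over K).Good O := by
  have : FinTrdeg k K := finTrdeg_of_fg (IntermediateField.essFiniteType_iff.mp inferInstance)
  have htr' : Cardinal.aleph0 ≤ Algebra.trdeg K Ω := by rwa [trdeg_eq_of_finTrdeg htr]
  obtain ⟨s, rfl⟩ := hL
  refine SchemeAction.good_of_stable (L := IntermediateField.adjoin K s) htr'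
    (IntermediateField.fg_adjoin_finset s) ?_ ?_ hOa
  · intro x
    obtain ⟨U, hU, hx⟩ := hcov x
    refine ⟨U, hU.of_forall_exists fun γ => ⟨⟨γ.1.restrictScalars k, ?_⟩, rfl⟩, hx⟩
    exact mem_fixingSubgroup_adjoin fun r hr =>
      γ.2 ⟨r, IntermediateField.subset_adjoin K _ hr⟩
  · exact fun γ => hO ⟨γ.restrictScalars k, fun x => γ.commutes x⟩

end FiniteExtensions

section FixedPoint

variable {k Ω : Type u} [Field k] [Field Ω] [Algebra k Ω] {X : Scheme.{u}} {f : X ⟶ Spec (.of Ω)}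
  {ρ : SchemeAction Gal(Ω/k) f}

/-- A good open subset `U` contains points that are rational over a finite extension of `k`, also
outside a given stable open subset `W`: a closed point of the subset of the model `Spec B` of `U`
where the invariant functions supported in `W` vanish. -/
lemma SchemeAction.Good.exists_pt [IsAlgClosed Ω] [CharZero Ω]
    (htr : Cardinal.aleph0 ≤ Algebra.trdeg k Ω) [LocallyOfFiniteType f] {U W : X.Opens}
    (hU : ρ.Good U) (hW : ρ.Stable W) (hUW : ¬ U ≤ W) :
    ∃ z : SchemePt f, z.pos ∉ W ∧ ∃ K : IntermediateField k Ω, FiniteDimensional k K ∧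
      ∀ γ : Gal(Ω/k), (∀ x ∈ K, γ x = x) → ρ.smulPt γ z = z := by
  have hE (c : k) (γ : Gal(Ω/k)) : γ • algebraMap k Ω c = algebraMap k Ω c := γ.commutes c
  have sq := hU.isPullback hE fun c hc => mem_range_algebraMap_of_forall_gal htr hc
  have h1 : LocallyOfFiniteType (Spec.map (sectHom f U)) := by
    rw [← fromSpec_comp hU.affine]
    infer_instance
  have h2 := locallyOfFiniteType_of_isPullback sq
  rw [HasRingHomProperty.Spec_iff (P := @LocallyOfFiniteType)] at h2
  let B := invRing hU.stable
  let _ : Algebra k B := (invAlg hE hU.stable).toAlgebra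
  have hB : Algebra.FiniteType k B := h2
  -- the ideal of the invariant functions supported in `W`
  let I : Ideal B := (supportedIn f U W).comap B.subtype
  have hI : I ≠ ⊤ := by
    rw [Ideal.ne_top_iff_one]
    intro h
    have h3 : X.basicOpen (U := U) 1 ≤ W := h
    rw [Scheme.basicOpen_of_isUnit _ isUnit_one] at h3
    exact hUW h3
  obtain ⟨m, hm, hIm⟩ := I.exists_le_maximal hI
  let _ : Field (B ⧸ m) := Ideal.Quotient.field m
  have : Module.Finite k (B ⧸ m) := finite_of_finite_type_of_isJacobsonRing k (B ⧸ m)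
  let ψ : B →ₐ[k] Ω := (IsAlgClosed.lift (R := k) (S := B ⧸ m)).comp (Ideal.Quotient.mkₐ k m)
  have hψm (b : B) (hb : b ∈ m) : ψ b = 0 := by
    have : Ideal.Quotient.mkₐ k m b = 0 := Ideal.Quotient.eq_zero_iff_mem.mpr hb
    rw [AlgHom.comp_apply, this, map_zero]
  obtain ⟨K, hK, hψK⟩ := exists_finiteDimensional_of_isAlgebraic (y := ψ) fun b =>
    (Algebra.IsAlgebraic.isAlgebraic (R := k) (Ideal.Quotient.mkₐ k m b)).algHom
      (IsAlgClosed.lift (R := k) (S := B ⧸ m))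
  have hψ : Spec.map (CommRingCat.ofHom ψ.toRingHom) ≫
      Spec.map (CommRingCat.ofHom (invAlg hE hU.stable)) = 𝟙 _ ≫ specAlg k Ω := by
    rw [Category.id_comp, ← Spec.map_comp, ← CommRingCat.ofHom_comp]
    congr 2
    exact ψ.comp_algebraMap
  -- `U` is the base change of `Spec B`, so `ψ` defines an `Ω`-valued point of `U`
  let z' := sq.lift _ _ hψ
  have hz1 : z' ≫ Spec.map (CommRingCat.ofHom (S := Γ(X, U)) B.subtype) =
    Spec.map (CommRingCat.ofHom ψ.toRingHom) := sq.lift_fst _ _ hψ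
  have hz2 : z' ≫ Spec.map (sectHom f U) = 𝟙 _ := sq.lift_snd _ _ hψ
  let z : SchemePt f := ⟨z' ≫ hU.affine.fromSpec, by
    rw [Category.assoc, fromSpec_comp hU.affine, hz2]⟩
  have hzU : z.pos ∈ U := by
    have := hU.affine.opensRange_fromSpec
    rw [← SetLike.mem_coe, ← this]
    exact ⟨z' (specPt Ω), (Scheme.Hom.comp_apply _ _ _).symm⟩
  refine ⟨z, fun hzW => ?_, K, hK, fun γ hγ => ?_⟩
  · obtain ⟨a, ha, hza, haW⟩ := hU.exists_basicOpen_le hW hzU hzW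
    have h3 : z' (specPt Ω) ∈ hU.affine.fromSpec ⁻¹ᵁ X.basicOpen (U := U) a := hza
    replace h3 := (hU.affine.fromSpec_preimage_basicOpen (a : Γ(X, U))).le h3
    have h4 : Spec.map (CommRingCat.ofHom (S := Γ(X, U)) B.subtype) (z' (specPt Ω)) ∈
      PrimeSpectrum.basicOpen (⟨a, ha⟩ : B) := h3
    rw [← Scheme.Hom.comp_apply, hz1] at h4
    refine h4 ?_
    change ψ ⟨a, ha⟩ ∈ (IsLocalRing.closedPoint Ω).asIdeal
    rw [hψm _ (hIm haW)]
    exact Ideal.zero_mem _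
  · apply Subtype.ext
    have h5 : hU.affine.fromSpec ≫ ρ.hom γ⁻¹ =
        Spec.map ((ρ.hom γ⁻¹).appLE U U (hU.stable γ⁻¹).ge) ≫ hU.affine.fromSpec :=
      (hU.affine.SpecMap_appLE_fromSpec (ρ.hom γ⁻¹) hU.affine (hU.stable γ⁻¹).ge).symm
    change specAct Ω γ ≫ (z' ≫ hU.affine.fromSpec) ≫ ρ.hom γ⁻¹ = z' ≫ hU.affine.fromSpec
    rw [Category.assoc, h5]
    simp only [← Category.assoc]
    congr 1
    apply sq.hom_ext
    · rw [Category.assoc, hz1, ← Spec.map_comp]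
      have h6 : CommRingCat.ofHom (S := Γ(X, U)) B.subtype ≫
          (ρ.hom γ⁻¹).appLE U U (hU.stable γ⁻¹).ge =
            CommRingCat.ofHom (S := Γ(X, U)) B.subtype := by
        ext b
        exact b.2 γ⁻¹
      rw [h6, Category.assoc, hz1, ← Spec.map_comp, ← CommRingCat.ofHom_comp]
      congr 2
      exact RingHom.ext fun b => hγ _ (hψK b)
    · rw [Category.assoc, hz2, ← Spec.map_comp, sectHom_appLE (ρ.hom_over γ⁻¹), Spec.map_comp,
        Category.assoc, ← Category.assoc z', hz2, Category.id_comp, specAct_comp, mul_inv_cancel,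
        specAct_one]

end FixedPoint

section Cover

lemma exists_isAffineOpen_inter {A : Type u} [CommRing A] {X : Scheme.{u}} (f : X ⟶ Spec (.of A))
    [IsSeparated f] {F : Set X.Opens} (hF : F.Finite) (hne : F.Nonempty)
    (hFa : ∀ U ∈ F, IsAffineOpen U) :
    ∃ V : X.Opens, IsAffineOpen V ∧ ∀ x, x ∈ V ↔ ∀ U ∈ F, x ∈ U := by
  lift F to Finset X.Opens using hF
  induction hne using Finset.Nonempty.cons_induction with
  | singleton U => exact ⟨U, hFa U (by simp), by simp⟩
  | cons U F hU hne ih =>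
    obtain ⟨V, hV, hVF⟩ := ih fun W hW => hFa W (by simp [Finset.mem_coe.mp hW])
    have : X.IsSeparated := ⟨by rw [← terminal.comp_from f]; infer_instance⟩
    exact ⟨U ⊓ V, (hFa U (by simp)).inf hV, fun x => by simp [hVF]⟩

variable {k Ω : Type u} [Field k] [Field Ω] [Algebra k Ω] {X : Scheme.{u}} {f : X ⟶ Spec (.of Ω)}
  (ρ : SchemeAction Gal(Ω/k) f) [IsAlgClosed Ω] [CharZero Ω]
  (htr : Cardinal.aleph0 ≤ Algebra.trdeg k Ω) [LocallyOfFiniteType f] [QuasiCompact f]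
  [IsSeparated f] {L : IntermediateField k Ω} (hL : L.FG)
  (hcov : ∀ x, ∃ U, (ρ.restrict L.fixingSubgroup).Good U ∧ x ∈ U)
include htr hL hcov

/-- An affine open subset with a property `Q` can be replaced by one that is defined over a finite
extension of `k`, provided that all its conjugates have `Q` and that `Q` holds for the fibres of a
stable family over the points of a stable open subset of `Spec (Ω ⊗ R)`. -/
lemma exists_stable_affine {Q : X.Opens → Prop}
    (hQ : ∀ (R : Subalgebra k Ω) (𝒰 : (Fam f R).Opens), (Fam.action R ρ).Stable 𝒰 →
      ∃ O : (Spec (.of (Ω ⊗[k] R))).Opens,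
        (∀ τ, Spec.map (CommRingCat.ofHom (tensorAct R τ).toRingHom) ⁻¹ᵁ O = O) ∧
        ∀ y : R →ₐ[k] Ω, Spec.map (CommRingCat.ofHom (evalAt Ω y).toRingHom) (specPt Ω) ∈ O ↔
          Q (Fam.fibre f y ⁻¹ᵁ 𝒰))
    {U : X.Opens} (hU : IsAffineOpen U) (hQU : ∀ σ, Q (ρ.hom σ ⁻¹ᵁ U)) :
    ∃ (K : IntermediateField k Ω) (_ : FiniteDimensional k K) (U' : X.Opens), IsAffineOpen U' ∧
      (ρ.restrict K.fixingSubgroup).Stable U' ∧ Q U' := by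
  obtain ⟨R, hR, 𝒰, h𝒰, ⟨x, σ, hx⟩, hy⟩ := exists_affine_family ρ htr hL hcov hU
  obtain ⟨O, hO, hOQ⟩ := hQ R 𝒰 h𝒰
  obtain ⟨a, ha, haO⟩ := exists_ne_zero_of_stable htr hO ⟨_, (hOQ x).mpr (hx ▸ hQU σ)⟩
  obtain ⟨y, hya, hyalg, hyU⟩ := hy a ha
  have : Algebra.FiniteType k R := (Subalgebra.fg_iff_finiteType R).mp hR
  obtain ⟨K, hK, hyK⟩ := exists_finiteDimensional_of_isAlgebraic hyalg
  exact ⟨K, hK, _, hyU, stable_fibre ρ h𝒰 hyK, (hOQ y).mp (haO y hya)⟩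

/-- An affine open subset meeting a stable set of points can be replaced by one that is defined over
a finite extension of `k`. -/
lemma exists_stable_affine_meets {T : Set (SchemePt f)} (hT : ∀ γ, ∀ z ∈ T, ρ.smulPt γ z ∈ T)
    {U : X.Opens} (hU : IsAffineOpen U) (hTU : ∃ z ∈ T, z.pos ∈ U) :
    ∃ (K : IntermediateField k Ω) (_ : FiniteDimensional k K) (U' : X.Opens), IsAffineOpen U' ∧
      (ρ.restrict K.fixingSubgroup).Stable U' ∧ ∃ z ∈ T, z.pos ∈ U' := by
  refine exists_stable_affine ρ htr hL hcov (Q := fun U => ∃ z ∈ T, z.pos ∈ U) ?_ hU ?_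
  · intro R 𝒰 h𝒰
    refine ⟨⟨{q | ∃ z ∈ T, q ∈ Fam.slice R z ⁻¹ᵁ 𝒰}, ?_⟩, fun τ => ?_, fun y => ?_⟩
    · have : {q | ∃ z ∈ T, q ∈ Fam.slice R z ⁻¹ᵁ 𝒰} =
          ⋃ z ∈ T, (Fam.slice R z ⁻¹ᵁ 𝒰 : Set (Spec (.of (Ω ⊗[k] R)))) := by
        ext q; simp
      rw [this]
      exact isOpen_biUnion fun z _ => (Fam.slice R z ⁻¹ᵁ 𝒰).isOpen
    · ext q
      have key (z : SchemePt f) : Spec.map (CommRingCat.ofHom (tensorAct R τ).toRingHom) q ∈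
          Fam.slice R z ⁻¹ᵁ 𝒰 ↔ q ∈ Fam.slice R (ρ.smulPt τ z) ⁻¹ᵁ 𝒰 := by
        rw [← Fam.slice_preimage_smulPt h𝒰 τ z]
        rfl
      change (∃ z ∈ T, _ ∈ Fam.slice R z ⁻¹ᵁ 𝒰) ↔ ∃ z ∈ T, q ∈ Fam.slice R z ⁻¹ᵁ 𝒰
      constructor
      · rintro ⟨z, hz, h⟩
        exact ⟨_, hT τ z hz, (key z).mp h⟩
      · rintro ⟨z, hz, h⟩
        refine ⟨_, hT τ⁻¹ z hz, (key _).mpr ?_⟩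
        rwa [← ρ.smulPt_mul, mul_inv_cancel, ρ.smulPt_one]
    · exact exists_congr fun z => and_congr_right fun _ => Fam.mem_slice_preimage z y 𝒰
  · obtain ⟨z, hz, hzU⟩ := hTU
    exact fun σ => ⟨_, hT σ z hz, ρ.pos_smulPt_mem.mpr hzU⟩

/-- An affine open subset containing a finite stable set of points can be replaced by one that is
defined over a finite extension of `k`. -/
lemma exists_stable_affine_contains {T : Set (SchemePt f)} (hTf : T.Finite)
    (hT : ∀ γ, ∀ z ∈ T, ρ.smulPt γ z ∈ T)
    {U : X.Opens} (hU : IsAffineOpen U) (hTU : ∀ z ∈ T, z.pos ∈ U) :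
    ∃ (K : IntermediateField k Ω) (_ : FiniteDimensional k K) (U' : X.Opens), IsAffineOpen U' ∧
      (ρ.restrict K.fixingSubgroup).Stable U' ∧ ∀ z ∈ T, z.pos ∈ U' := by
  have hT' (γ : Gal(Ω/k)) (z : SchemePt f) (hz : z ∈ T) : ∃ z' ∈ T, ρ.smulPt γ z' = z :=
    ⟨_, hT γ⁻¹ z hz, by rw [← ρ.smulPt_mul, mul_inv_cancel, ρ.smulPt_one]⟩
  refine exists_stable_affine ρ htr hL hcov (Q := fun U => ∀ z ∈ T, z.pos ∈ U) ?_ hU ?_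
  · intro R 𝒰 h𝒰
    refine ⟨⟨{q | ∀ z ∈ T, q ∈ Fam.slice R z ⁻¹ᵁ 𝒰}, ?_⟩, fun τ => ?_, fun y => ?_⟩
    · have : {q | ∀ z ∈ T, q ∈ Fam.slice R z ⁻¹ᵁ 𝒰} =
          ⋂ z ∈ T, (Fam.slice R z ⁻¹ᵁ 𝒰 : Set (Spec (.of (Ω ⊗[k] R)))) := by
        ext q; simp
      rw [this]
      exact hTf.isOpen_biInter fun z _ => (Fam.slice R z ⁻¹ᵁ 𝒰).isOpen
    · ext q
      have key (z : SchemePt f) : Spec.map (CommRingCat.ofHom (tensorAct R τ).toRingHom) q ∈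
          Fam.slice R z ⁻¹ᵁ 𝒰 ↔ q ∈ Fam.slice R (ρ.smulPt τ z) ⁻¹ᵁ 𝒰 := by
        rw [← Fam.slice_preimage_smulPt h𝒰 τ z]
        rfl
      change (∀ z ∈ T, _ ∈ Fam.slice R z ⁻¹ᵁ 𝒰) ↔ ∀ z ∈ T, q ∈ Fam.slice R z ⁻¹ᵁ 𝒰
      constructor
      · intro h z hz
        obtain ⟨z', hz', rfl⟩ := hT' τ z hz
        exact (key z').mp (h z' hz')
      · exact fun h z hz => (key z).mpr (h _ (hT τ z hz))
    · exact forall_congr' fun z => imp_congr_right fun _ => Fam.mem_slice_preimage z y 𝒰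
  · intro σ z hz
    obtain ⟨z', hz', rfl⟩ := hT' σ z hz
    exact ρ.pos_smulPt_mem.mpr (hTU z' hz')

/-- An action that is defined over a finitely generated field has a cover by good open subsets, if
every finite set of rational points is contained in an affine open subset. Outside of the union `W`
of the good open subsets there would be a point with finite orbit, and the intersection of the
conjugates of an affine neighbourhood of the orbit, defined over a finite extension, would be stable
and affine, hence good. -/
theorem exists_good_cover (hAF : ∀ T : Set (SchemePt f), T.Finite →
      ∃ U : X.Opens, IsAffineOpen U ∧ ∀ z ∈ T, z.pos ∈ U)
    (x : X) : ∃ U, ρ.Good U ∧ x ∈ U := by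
  by_contra! hx
  let W : X.Opens := sSup {U | ρ.Good U}
  have hW : ρ.Stable W := SchemeAction.stable_of_le fun γ => sSup_le fun U hU => by
    rw [← hU.stable γ]
    exact Scheme.Hom.preimage_mono _ (le_sSup hU)
  have hxW : x ∉ W := fun h => by
    obtain ⟨U, hU, hxU⟩ := TopologicalSpace.Opens.mem_sSup.mp h
    exact hx U hU hxU
  let T : Set (SchemePt f) := {z | z.pos ∉ W}
  have hT (γ) (z) (hz : z ∈ T) : ρ.smulPt γ z ∈ T := fun h => hz (by
    rw [← hW γ] at h
    exact ρ.pos_smulPt_mem.mp h)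
  obtain ⟨U, hU, hxU, -⟩ := TopologicalSpace.Opens.isBasis_iff_nbhd.mp X.isBasis_affineOpens
    (show x ∈ (⊤ : X.Opens) from trivial)
  obtain ⟨z, hzU, hzW⟩ := SchemePt.exists_pos_mem (f := f) (S := (U : Set X) ∩ (W : Set X)ᶜ)
    (U.isOpen.isLocallyClosed.inter W.isOpen.isClosed_compl.isLocallyClosed)
    ⟨x, hxU, hxW⟩
  -- a point outside of `W` with a finite orbit
  obtain ⟨K, _, U', hU', hU'K, z', hz', hz'U⟩ :=
    exists_stable_affine_meets ρ htr hL hcov hT hU ⟨z, hzW, hzU⟩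
  have hgood := good_over ρ htr hL hcov K hU'K hU'
  have : FinTrdeg k K := finTrdeg_of_fg (IntermediateField.essFiniteType_iff.mp inferInstance)
  have htr' : Cardinal.aleph0 ≤ Algebra.trdeg K Ω := by rwa [trdeg_eq_of_finTrdeg htr]
  obtain ⟨v, hvW, K', _, hvK⟩ := hgood.exists_pt htr' (W := W) (fun γ => hW _)
    fun h => hz' (h hz'U)
  have : FiniteDimensional k (K'.restrictScalars k) := by
    have : FiniteDimensional k K' := FiniteDimensional.trans k K K'
    exact this
  have horb : (Set.range fun σ => ρ.smulPt σ v).Finite := by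
    refine finite_range_of_agree (K'.restrictScalars k) fun σ τ hστ => ?_
    have h1 (x) (hx : x ∈ K') : (σ⁻¹ * τ) x = x := by
      change σ.symm (τ x) = x
      rw [← hστ x hx, σ.symm_apply_apply]
    let γ : Gal(Ω/K) := AlgEquiv.ofRingEquiv (f := (σ⁻¹ * τ).toRingEquiv) fun x =>
      h1 _ (K'.algebraMap_mem x)
    have h2 : ρ.smulPt (σ⁻¹ * τ) v = v := hvK γ h1
    change ρ.smulPt σ v = ρ.smulPt τ v
    conv_lhs => rw [← h2, ← ρ.smulPt_mul, mul_inv_cancel_left]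
  have hTorb (γ) (z) (hz : z ∈ Set.range fun σ => ρ.smulPt σ v) :
      ρ.smulPt γ z ∈ Set.range fun σ => ρ.smulPt σ v := by
    obtain ⟨σ, rfl⟩ := hz
    exact ⟨γ * σ, ρ.smulPt_mul γ σ v⟩
  -- an affine neighbourhood of the orbit
  obtain ⟨U₂, hU₂, hU₂v⟩ := hAF _ horb
  obtain ⟨K₂, _, U₃, hU₃, hU₃K, hU₃v⟩ := exists_stable_affine_contains ρ htr hL hcov horb hTorb hU₂
    hU₂v
  -- `U₃` has finitely many conjugates
  have hfin : (Set.range fun σ => ρ.hom σ ⁻¹ᵁ U₃).Finite := by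
    refine finite_range_of_agree K₂ fun σ τ hστ => ?_
    have h1 : σ⁻¹ * τ ∈ K₂.fixingSubgroup := fun x => by
      change σ.symm (τ x) = x
      rw [← hστ x x.2, σ.symm_apply_apply]
    have h2 : ρ.hom σ ≫ ρ.hom (σ⁻¹ * τ) = ρ.hom τ := by rw [ρ.hom_comp, mul_inv_cancel_left]
    rw [← h2, Scheme.Hom.comp_preimage]
    exact congrArg (ρ.hom σ ⁻¹ᵁ ·) (hU₃K ⟨_, h1⟩).symm
  obtain ⟨V, hV, hVmem⟩ := exists_isAffineOpen_inter f hfin (Set.range_nonempty _) (by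
    rintro _ ⟨σ, rfl⟩
    exact hU₃.preimage _)
  have hVst : ρ.Stable V := SchemeAction.stable_of_le fun γ x hx => by
    refine (hVmem _).mpr ?_
    rintro _ ⟨σ, rfl⟩
    have : x ∈ ρ.hom (γ * σ) ⁻¹ᵁ U₃ := (hVmem x).mp hx _ ⟨γ * σ, rfl⟩
    rw [← ρ.hom_comp, Scheme.Hom.comp_preimage] at this
    exact this
  have hVgood : ρ.Good V := SchemeAction.good_of_stable htr hL hcov hVst hV
  refine hvW (le_sSup (α := X.Opens) hVgood ((hVmem _).mpr ?_))
  rintro _ ⟨σ, rfl⟩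
  have h3 := ρ.pos_smulPt_mem (U := U₃) (γ := σ) (z := ρ.smulPt σ⁻¹ v)
  rw [← ρ.smulPt_mul, mul_inv_cancel, ρ.smulPt_one] at h3
  exact h3.mpr (hU₃v _ ⟨σ⁻¹, rfl⟩)

end Cover

/-! ### The action on the solution of a moduli problem -/

section Varieties

variable {Ω : Type u} [Field Ω]

lemma Variety.isReduced (V : Variety Ω) : IsReduced V.obj.left :=
  V.property.1.1.geometrically_isReduced (𝟙 _) (𝟙 _) V.obj.hom
    (IsPullback.of_horiz_isIso ⟨by rw [Category.id_comp, Category.comp_id]⟩)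

lemma Variety.locallyOfFiniteType (V : Variety Ω) : LocallyOfFiniteType V.obj.hom :=
  V.property.1.2

lemma Variety.quasiCompact (V : Variety Ω) : QuasiCompact V.obj.hom := V.property.2

/-- The morphism of schemes underlying a point of a variety. -/
def sch {V : Variety Ω} (P : Pts V) : Spec (.of Ω) ⟶ V.obj.left := P.hom.left

lemma sch_comp {V : Variety Ω} (P : Pts V) : sch P ≫ V.obj.hom = 𝟙 _ := Over.w P.hom

/-- The point of a variety defined by a point of its underlying scheme. -/
def SchemePt.toPts {V : Variety Ω} (z : SchemePt V.obj.hom) : Pts V :=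
  ObjectProperty.homMk (Over.homMk z.1 z.2)

lemma sch_toPts {V : Variety Ω} (z : SchemePt V.obj.hom) : sch z.toPts = z.1 := rfl

lemma Variety.hom_ext {V W : Variety Ω} {φ ψ : V ⟶ W} (h : φ.hom.left = ψ.hom.left) : φ = ψ := by
  apply ObjectProperty.hom_ext
  ext1
  exact h

/-- Morphisms from a variety to a separated scheme are determined by their values on points. -/
lemma hom_ext_of_pts [IsAlgClosed Ω] {V : Variety Ω} {Y : Scheme.{u}} {g : Y ⟶ Spec (.of Ω)}
    [IsSeparated g] [LocallyOfFiniteType g] {φ ψ : V.obj.left ⟶ Y} (hφψ : φ ≫ g = ψ ≫ g)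
    [LocallyOfFiniteType (φ ≫ g)]
    (h : ∀ P : Pts V, sch P ≫ φ = sch P ≫ ψ) : φ = ψ := by
  have := V.isReduced
  have := V.locallyOfFiniteType
  refine ext_of_apply_eq g Set.univ isOpen_univ.isLocallyClosed dense_univ (fun x _ hx => ?_) hφψ
  obtain ⟨z, rfl⟩ := SchemePt.exists_pos_eq (f := V.obj.hom) hx
  have h1 := h z.toPts
  rw [sch_toPts] at h1
  rw [SchemePt.pos, ← Scheme.Hom.comp_apply, h1, Scheme.Hom.comp_apply]

end Varieties

section Moduli

variable {k Ω : Type u} [Field k] [Field Ω] [Algebra k Ω]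

/-- The point of the conjugate variety defined by a point of a variety. -/
def conjPts (σ : Gal(Ω/k)) {V : Variety Ω} (P : Pts V) : Pts ((conj σ).obj V) :=
  ObjectProperty.homMk (Over.homMk (specAut σ ≫ sch (V := V) P) (by
    change (specAut σ ≫ sch P) ≫ V.obj.hom ≫ specAut σ⁻¹ = 𝟙 _
    rw [Category.assoc, ← Category.assoc (sch P), sch_comp, Category.id_comp, specAut_comp_inv]))

namespace RationalModuliProblem

variable (M : RationalModuliProblem.{u, w} k Ω)

lemma map_map {S T U : Variety Ω} (a : S ⟶ T) (b : T ⟶ U) (m : M.fam.obj (op U)) :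
    M.fam.map a.op (M.fam.map b.op m) = M.fam.map (a ≫ b).op m := by
  rw [op_comp, Functor.map_comp]; rfl

lemma g_naturality (σ : Gal(Ω/k)) {S T : Variety Ω} (a : S ⟶ T)
    (m : M.fam.obj (op ((conj σ⁻¹).obj T))) :
    M.fam.map a.op ((M.g σ).hom.app (op T) m) =
      (M.g σ).hom.app (op S) (M.fam.map ((conj σ⁻¹).map a).op m) :=
  congr($((M.g σ).hom.naturality a.op) m).symm

lemma act_mul (σ τ : Gal(Ω/k)) (m : M.fam.obj (op (pt Ω))) :
    M.act (σ * τ) m = M.act σ (M.act τ m) := by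
  have h : conjPt (σ * τ) = conjMul σ τ (pt Ω) ≫ (conj τ⁻¹).map (conjPt σ) ≫ conjPt τ := by
    apply Variety.hom_ext
    change specAut (σ * τ) = 𝟙 _ ≫ specAut σ ≫ specAut τ
    rw [specAut_comp, Category.id_comp]
  rw [act, h, ← M.map_map, ← M.map_map, M.g_mul, act, act, M.g_naturality]

lemma act_injective (σ : Gal(Ω/k)) : Function.Injective (M.act σ) := by
  let s : pt Ω ⟶ (conj σ⁻¹).obj (pt Ω) := ObjectProperty.homMk (Over.homMk (specAut σ⁻¹) (by
    change specAut σ⁻¹ ≫ 𝟙 _ ≫ specAut σ⁻¹⁻¹ = 𝟙 _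
    rw [Category.id_comp, specAut_comp_inv]))
  have hs : s ≫ conjPt σ = 𝟙 _ := by
    apply Variety.hom_ext
    exact specAut_inv_comp σ
  intro m m' h
  have h1 := congr((M.g σ).inv.app (op (pt Ω)) $h)
  have h2 (x) : (M.g σ).inv.app (op (pt Ω)) ((M.g σ).hom.app (op (pt Ω)) x) = x :=
    congr($((M.g σ).hom_inv_id_app (op (pt Ω))) x)
  rw [act, act, h2, h2] at h1
  have h3 := congr(M.fam.map s.op $h1)
  rw [M.map_map, M.map_map, hs, op_id, M.fam.map_id] at h3
  exact h3

/-- The cocycle condition makes the action of `1` idempotent, hence trivial by injectivity. -/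
lemma act_one (m : M.fam.obj (op (pt Ω))) : M.act 1 m = m :=
  M.act_injective 1 (by rw [← M.act_mul, mul_one])

lemma act_rel (σ : Gal(Ω/k)) {m m' : M.fam.obj (op (pt Ω))} (h : M.rel (pt Ω) m m') :
    M.rel (pt Ω) (M.act σ m) (M.act σ m') :=
  M.g_rel _ _ _ _ (M.rel_map _ _ _ h)

/-- The action on the set of equivalence classes. -/
def actClass (σ : Gal(Ω/k)) : M.Classes → M.Classes :=
  Quotient.map (M.act σ) fun _ _ h => M.act_rel σ h

lemma actClass_mul (σ τ : Gal(Ω/k)) (c : M.Classes) :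
    M.actClass (σ * τ) c = M.actClass σ (M.actClass τ c) := by
  induction c using Quotient.inductionOn with
  | h m => exact congrArg (Quotient.mk _) (M.act_mul σ τ m)

lemma actClass_one (c : M.Classes) : M.actClass 1 c = c := by
  induction c using Quotient.inductionOn with
  | h m => exact congrArg (Quotient.mk _) (M.act_one m)

variable {M}

/-- The conjugates of a map that is regular on families are regular on families: the value at `m` is
the conjugate of the value at the family `g_{σ⁻¹}(m)` over the conjugate of the base. -/
lemma regularOnFamilies_conj {V : Variety Ω} {α : M.Classes → Pts V}
    (hα : M.RegularOnFamilies α) (σ : Gal(Ω/k)) :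
    M.RegularOnFamilies fun c => conjPts σ (α (M.actClass σ⁻¹ c)) := by
  intro T m
  -- the canonical identification of `σ(σ⁻¹T)` with `T`
  let e : (conj σ⁻¹⁻¹).obj ((conj σ⁻¹).obj T) ⟶ T :=
    ObjectProperty.homMk (Over.homMk (𝟙 T.obj.left) (by
      change 𝟙 _ ≫ T.obj.hom = (T.obj.hom ≫ specAut σ⁻¹⁻¹) ≫ specAut σ⁻¹⁻¹⁻¹
      rw [Category.id_comp, Category.assoc, specAut_comp_inv, Category.comp_id]))
  obtain ⟨φ, hφ⟩ := hα _ ((M.g σ⁻¹).hom.app (op ((conj σ⁻¹).obj T)) (M.fam.map e.op m))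
  let φ' : T.obj.left ⟶ V.obj.left := φ.hom.left
  have hw : φ' ≫ V.obj.hom = T.obj.hom ≫ specAut σ⁻¹⁻¹ := Over.w φ.hom
  refine ⟨ObjectProperty.homMk (Over.homMk φ' (by
    change φ' ≫ V.obj.hom ≫ specAut σ⁻¹ = T.obj.hom
    rw [← Category.assoc, hw, Category.assoc, specAut_comp, inv_mul_cancel, specAut_one,
      Category.comp_id])), fun t => ?_⟩
  have h1 : (conj σ⁻¹⁻¹).map (conjPts σ⁻¹ t) ≫ e = conjPt σ⁻¹ ≫ t := by
    apply Variety.hom_ext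
    exact Category.comp_id (specAut σ⁻¹ ≫ sch t)
  have h2 : M.fibre ((M.g σ⁻¹).hom.app (op ((conj σ⁻¹).obj T)) (M.fam.map e.op m))
      (conjPts σ⁻¹ t) = M.actClass σ⁻¹ (M.fibre m t) := by
    refine congrArg (Quotient.mk _) ?_
    rw [M.g_naturality, M.map_map, h1, ← M.map_map]
    rfl
  have h3 : sch (α (M.actClass σ⁻¹ (M.fibre m t))) = (specAut σ⁻¹ ≫ sch t) ≫ φ' :=
    congr(sch $((congrArg α h2).symm.trans (hφ _)))
  apply Variety.hom_ext
  change specAut σ ≫ sch (V := V) (α (M.actClass σ⁻¹ (M.fibre m t))) = sch t ≫ φ'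
  rw [h3, Category.assoc, ← Category.assoc, specAut_comp_inv, Category.id_comp]

/-- The action of the automorphism group on a solution: the universal property provides the
morphisms to the conjugates. They satisfy the laws of an action since they do so on points. -/
theorem exists_action [IsAlgClosed Ω] {V : Variety Ω} [IsSeparated V.obj.hom]
    {α : M.Classes ≃ Pts V} (hα : M.IsSolution V α) :
    ∃ ρ : SchemeAction Gal(Ω/k) V.obj.hom, ∀ σ c,
      sch (α (M.actClass σ c)) = specAut σ ≫ sch (α c) ≫ ρ.hom σ⁻¹ := by
  choose h hh using fun σ => hα.universal _ _ (regularOnFamilies_conj hα.regular σ)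
  let r (σ : Gal(Ω/k)) : V.obj.left ⟶ V.obj.left := (h σ).hom.left
  -- as a morphism of schemes, `h σ` lies over the automorphism `specAut σ`
  have hr (σ) : r σ ≫ V.obj.hom = V.obj.hom ≫ specAut σ := by
    have : r σ ≫ V.obj.hom ≫ specAut σ⁻¹ = V.obj.hom := Over.w (h σ).hom
    conv_rhs => rw [← this, Category.assoc, Category.assoc, specAut_inv_comp, Category.comp_id]
  have key (σ) (c : M.Classes) :
      sch (α c) ≫ r σ = specAut σ ≫ sch (α (M.actClass σ⁻¹ c)) := by
    have h1 : conjPts σ (α (M.actClass σ⁻¹ (α.symm (α c)))) = α c ≫ h σ := hh σ (α c)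
    rw [α.symm_apply_apply] at h1
    exact congr(sch $h1).symm
  have hiso (σ : Gal(Ω/k)) : IsIso (specAut σ) :=
    ⟨specAut σ⁻¹, specAut_comp_inv σ, specAut_inv_comp σ⟩
  have := V.locallyOfFiniteType
  have hlft (σ : Gal(Ω/k)) (φ : V.obj.left ⟶ V.obj.left) (hφ : φ ≫ V.obj.hom =
      V.obj.hom ≫ specAut σ) : LocallyOfFiniteType (φ ≫ V.obj.hom) := by
    rw [hφ]; infer_instance
  have hone : r 1 = 𝟙 _ := by
    have h1 : r 1 ≫ V.obj.hom = 𝟙 _ ≫ V.obj.hom := by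
      rw [hr, specAut_one, Category.comp_id, Category.id_comp]
    have := hlft 1 (r 1) (hr 1)
    refine hom_ext_of_pts h1 fun P => ?_
    obtain ⟨c, rfl⟩ := α.surjective P
    rw [key, inv_one, M.actClass_one, specAut_one, Category.id_comp, Category.comp_id]
  have hmul (σ τ) : r σ ≫ r τ = r (σ * τ) := by
    have h1 : (r σ ≫ r τ) ≫ V.obj.hom = V.obj.hom ≫ specAut (σ * τ) := by
      rw [Category.assoc, hr, ← Category.assoc, hr, Category.assoc, specAut_comp]
    have := hlft _ _ h1
    refine hom_ext_of_pts (h1.trans (hr _).symm) fun P => ?_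
    obtain ⟨c, rfl⟩ := α.surjective P
    rw [← Category.assoc, key, Category.assoc, key, key, ← M.actClass_mul, ← Category.assoc,
      specAut_comp, mul_inv_rev]
  refine ⟨⟨r, hone, hmul, hr⟩, fun σ c => ?_⟩
  change _ = specAut σ ≫ sch (α c) ≫ r σ⁻¹
  rw [key, inv_inv, ← Category.assoc, specAut_comp_inv, Category.id_comp]

end RationalModuliProblem

end Moduli

/-! ### The semilinear action on projective space -/

section ProjectiveSpace

attribute [local instance] MvPolynomial.gradedAlgebra

variable {Ω : Type u} [Field Ω] (n : ℕ)

/-- The grading of the polynomial ring in `n + 1` variables by the degree. -/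
abbrev grading (n : ℕ) (Ω : Type u) [Field Ω] : ℕ → Submodule Ω (MvPolynomial (Fin (n + 1)) Ω) :=
  MvPolynomial.homogeneousSubmodule (Fin (n + 1)) Ω

/-- Application of an endomorphism to the coefficients of polynomials. -/
def coeffMap (σ : Ω →+* Ω) : grading n Ω →+*ᵍ grading n Ω where
  toRingHom := MvPolynomial.map σ
  map_mem {_ _} h := by
    exact (MvPolynomial.mem_homogeneousSubmodule _ _).mpr
      (((MvPolynomial.mem_homogeneousSubmodule _ _).mp h).map σ)

lemma coeffMap_apply (σ : Ω →+* Ω) (F : MvPolynomial (Fin (n + 1)) Ω) :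
    coeffMap n σ F = MvPolynomial.map σ F := rfl

lemma coeffMap_mul {Γ : Type*} [Group Γ] [MulSemiringAction Γ Ω] (γ δ : Γ) :
    coeffMap n (MulSemiringAction.toRingHom Γ Ω (γ * δ)) =
      (coeffMap n (MulSemiringAction.toRingHom Γ Ω γ)).comp
        (coeffMap n (MulSemiringAction.toRingHom Γ Ω δ)) := by
  ext F : 1
  simp only [GradedRingHom.comp_apply, coeffMap_apply, MvPolynomial.map_map]
  congr 2
  ext c
  exact mul_smul γ δ c

lemma coeffMap_one (Γ : Type*) [Group Γ] [MulSemiringAction Γ Ω] :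
    coeffMap n (MulSemiringAction.toRingHom Γ Ω 1) = .id (grading n Ω) := by
  ext F : 1
  rw [coeffMap_apply]
  have : MulSemiringAction.toRingHom Γ Ω 1 = RingHom.id Ω := by
    ext c
    exact one_smul Γ c
  rw [this, MvPolynomial.map_id]
  rfl

open HomogeneousIdeal in
lemma irrelevant_le_map_coeffMap {Γ : Type*} [Group Γ] [MulSemiringAction Γ Ω] (γ : Γ) :
    irrelevant (grading n Ω) ≤
      (irrelevant (grading n Ω)).map (coeffMap n (MulSemiringAction.toRingHom Γ Ω γ)) := by
  refine (toIdeal_irrelevant_le _).mpr fun i hi F hF => ?_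
  have h1 : coeffMap n (MulSemiringAction.toRingHom Γ Ω γ)
      (coeffMap n (MulSemiringAction.toRingHom Γ Ω γ⁻¹) F) = F := by
    rw [← GradedRingHom.comp_apply, ← coeffMap_mul, mul_inv_cancel, coeffMap_one]
    rfl
  rw [← h1]
  refine Ideal.mem_map_of_mem _ ?_
  exact (toIdeal_irrelevant_le (𝒜 := grading n Ω)
    (I := (irrelevant (grading n Ω)).toIdeal)).mp le_rfl i hi
    ((coeffMap n (MulSemiringAction.toRingHom Γ Ω γ⁻¹)).map_mem hF)

/-- The structure morphism of projective space. -/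
abbrev projHom (n : ℕ) (Ω : Type u) [Field Ω] : Proj (grading n Ω) ⟶ Spec (.of Ω) :=
  Proj.toSpecZero (grading n Ω) ≫ Spec.map (CommRingCat.ofHom (algebraMap Ω (grading n Ω 0)))

lemma awayι_comp_projHom {m : ℕ} {F : MvPolynomial (Fin (n + 1)) Ω}
    (hF : F ∈ grading n Ω m) (hm : 0 < m) :
    Proj.awayι (grading n Ω) F hF hm ≫ projHom n Ω =
      Spec.map (CommRingCat.ofHom ((HomogeneousLocalization.fromZeroRingHom (grading n Ω)
        (.powers F)).comp (algebraMap Ω (grading n Ω 0)))) := by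
  rw [CommRingCat.ofHom_comp, Spec.map_comp, Proj.awayι_toSpecZero_assoc]

lemma sectHom_projHom {m : ℕ} {F : MvPolynomial (Fin (n + 1)) Ω} (hF : F ∈ grading n Ω m)
    (hm : 0 < m) : sectHom (projHom n Ω) (Proj.basicOpen (grading n Ω) F) =
      CommRingCat.ofHom ((HomogeneousLocalization.fromZeroRingHom (grading n Ω)
        (.powers F)).comp (algebraMap Ω (grading n Ω 0))) ≫
          Proj.awayToSection (grading n Ω) F := by
  have hU := Proj.isAffineOpen_basicOpen (grading n Ω) F hF hm
  have h1 : (Proj.basicOpen (grading n Ω) F).ι =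
      Proj.basicOpenToSpec (grading n Ω) F ≫ Proj.awayι (grading n Ω) F hF hm := by
    rw [Proj.awayι, ← Proj.basicOpenIsoSpec_hom _ _ hF hm, Iso.hom_inv_id_assoc]
  apply Spec.map_injective
  rw [← fromSpec_comp hU, ← hU.isoSpec_inv_ι, h1, Proj.basicOpenToSpec, Category.assoc,
    Category.assoc, Category.assoc, awayι_comp_projHom, ← hU.isoSpec_hom, Iso.inv_hom_id_assoc,
    Spec.map_comp]

lemma map_coeffMap_fromZeroRingHom (σ : Ω →+* Ω) (F : MvPolynomial (Fin (n + 1)) Ω) (c : Ω) :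
    HomogeneousLocalization.Away.map (coeffMap n σ) F
      (HomogeneousLocalization.fromZeroRingHom (grading n Ω) (.powers F)
        (algebraMap Ω (grading n Ω 0) c)) =
    HomogeneousLocalization.fromZeroRingHom (grading n Ω) (.powers (coeffMap n σ F))
        (algebraMap Ω (grading n Ω 0) (σ c)) := by
  refine (HomogeneousLocalization.map_mk ..).trans ?_
  refine congrArg HomogeneousLocalization.mk ?_
  have h1 : (⟨MvPolynomial.map σ (algebraMap Ω (grading n Ω 0) c).1,
      (coeffMap n σ).map_mem (algebraMap Ω (grading n Ω 0) c).2⟩ : grading n Ω 0) =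
      algebraMap Ω (grading n Ω 0) (σ c) := Subtype.ext (MvPolynomial.map_C σ c)
  have h2 : (⟨MvPolynomial.map σ 1, (coeffMap n σ).map_mem SetLike.GradedOne.one_mem⟩ :
      grading n Ω 0) = 1 := Subtype.ext (map_one (MvPolynomial.map σ))
  congr 1

/-- The semilinear action on projective space through the coordinates. -/
def projAction (Γ : Type*) [Group Γ] [MulSemiringAction Γ Ω] :
    SchemeAction Γ (projHom n Ω) where
  hom γ := Proj.map (coeffMap n (MulSemiringAction.toRingHom Γ Ω γ))
    (irrelevant_le_map_coeffMap n γ)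
  hom_one := by
    have (g : grading n Ω →+*ᵍ grading n Ω) (hg) (h : g = .id _) : Proj.map g hg = 𝟙 _ := by
      subst h
      exact Proj.map_id
    exact this _ _ (coeffMap_one n Γ)
  hom_comp γ δ := by
    have (g : grading n Ω →+*ᵍ grading n Ω) (hg)
        (h : g = (coeffMap n (MulSemiringAction.toRingHom Γ Ω γ)).comp
          (coeffMap n (MulSemiringAction.toRingHom Γ Ω δ))) :
        Proj.map g hg = Proj.map _ (irrelevant_le_map_coeffMap n γ) ≫
          Proj.map _ (irrelevant_le_map_coeffMap n δ) := by
      subst h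
      exact Proj.map_comp _ _ _ _
    exact (this _ _ (coeffMap_mul n γ δ)).symm
  hom_over γ := by
    refine (Proj.mapAffineOpenCover _ (irrelevant_le_map_coeffMap n γ)).openCover.hom_ext _ _
      fun s => ?_
    have h1 := Proj.awayι_comp_map _ (irrelevant_le_map_coeffMap n γ) s.1.2 _ s.2.2
    refine (Category.assoc _ _ _).symm.trans <| (congrArg (· ≫ _) h1).trans <|
      (Category.assoc _ _ _).trans ?_
    refine (congrArg (_ ≫ ·) (awayι_comp_projHom n s.2.2 s.1.2)).trans ?_
    have h2 := awayι_comp_projHom n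
      ((coeffMap n (MulSemiringAction.toRingHom Γ Ω γ)).map_mem s.2.2) s.1.2
    refine .trans ?_ ((congrArg (· ≫ specAct Ω γ) h2).symm.trans (Category.assoc _ _ _))
    refine (Spec.map_comp _ _).symm.trans <| .trans ?_ (Spec.map_comp _ _)
    congr 1
    ext c
    exact congrArg HomogeneousLocalization.val (map_coeffMap_fromZeroRingHom n _ _ c)

lemma projAction_preimage_basicOpen {Γ : Type*} [Group Γ] [MulSemiringAction Γ Ω] (γ : Γ)
    (F : MvPolynomial (Fin (n + 1)) Ω) :
    (projAction n Γ).hom γ ⁻¹ᵁ Proj.basicOpen (grading n Ω) F =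
      Proj.basicOpen (grading n Ω) (MvPolynomial.map (MulSemiringAction.toRingHom Γ Ω γ) F) := rfl

lemma stable_basicOpen_X (Γ : Type*) [Group Γ] [MulSemiringAction Γ Ω] (j : Fin (n + 1)) :
    (projAction (Ω := Ω) n Γ).Stable (Proj.basicOpen (grading n Ω) (MvPolynomial.X j)) :=
  fun γ => by rw [projAction_preimage_basicOpen, MvPolynomial.map_X]

lemma X_mem_grading (j : Fin (n + 1)) : (MvPolynomial.X j : MvPolynomial _ Ω) ∈ grading n Ω 1 :=
  (MvPolynomial.mem_homogeneousSubmodule _ _).mpr (MvPolynomial.isHomogeneous_X Ω j)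

lemma monomial_mem_grading {d : ℕ} {F : MvPolynomial (Fin (n + 1)) Ω} (hF : F ∈ grading n Ω d)
    {m : Fin (n + 1) →₀ ℕ} (hm : m ∈ F.support) :
    MvPolynomial.monomial m (1 : Ω) ∈ grading n Ω d := by
  refine (MvPolynomial.mem_homogeneousSubmodule _ _).mpr (MvPolynomial.isHomogeneous_monomial _ ?_)
  have := ((MvPolynomial.mem_homogeneousSubmodule _ _).mp hF) (MvPolynomial.mem_support_iff.mp hm)
  rwa [Finsupp.degree_eq_weight_one]

/-- The function `F / x_j ^ d` on the open subset `x_j ≠ 0`. -/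
def dehomogenize (j : Fin (n + 1)) (d : ℕ) (F : grading n Ω (d • 1)) :
    Sect (projHom n Ω) (Proj.basicOpen (grading n Ω) (MvPolynomial.X j)) :=
  (Proj.awayToSection (grading n Ω) (MvPolynomial.X j)).hom
    (HomogeneousLocalization.Away.mk (grading n Ω) (X_mem_grading n j) d F.1 F.2)

lemma dehomogenize_add (j : Fin (n + 1)) (d : ℕ) (F G : grading n Ω (d • 1)) :
    dehomogenize n j d (F + G) = dehomogenize n j d F + dehomogenize n j d G := by
  refine .trans ?_ (map_add (Proj.awayToSection (grading n Ω) (MvPolynomial.X j)).hom _ _)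
  refine congrArg (Proj.awayToSection (grading n Ω) (MvPolynomial.X j)).hom ?_
  ext
  simp [Localization.add_mk_self]

lemma dehomogenize_smul (j : Fin (n + 1)) (d : ℕ) (c : Ω) (F : grading n Ω (d • 1)) :
    dehomogenize n j d (c • F) = c • dehomogenize n j d F := by
  have h1 := congr($(sectHom_projHom n (X_mem_grading (Ω := Ω) n j) zero_lt_one).hom c)
  refine .trans ?_ (Algebra.smul_def c (dehomogenize n j d F)).symm
  refine .trans ?_ (congrArg (· * dehomogenize n j d F) h1).symm
  refine .trans ?_ (map_mul (Proj.awayToSection (grading n Ω) (MvPolynomial.X j)).hom _ _)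
  refine congrArg (Proj.awayToSection (grading n Ω) (MvPolynomial.X j)).hom ?_
  ext
  rw [HomogeneousLocalization.val_mul, HomogeneousLocalization.Away.val_mk,
    HomogeneousLocalization.Away.val_mk]
  refine .trans ?_ (Localization.mk_mul _ _ _ _).symm
  congr 1
  · exact MvPolynomial.smul_eq_C_mul _ _
  · exact (one_mul _).symm

lemma appLE_awayToSection {g : grading n Ω →+*ᵍ grading n Ω} (hg) {s s' : MvPolynomial _ Ω}
    (h : g s = s') (hs : s ∈ grading n Ω 1) (hs' : s' ∈ grading n Ω 1) (d : ℕ)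
    (F : grading n Ω (d • 1)) (e) :
    ((Proj.map g hg).appLE (Proj.basicOpen (grading n Ω) s) (Proj.basicOpen (grading n Ω) s') e).hom
      ((Proj.awayToSection (grading n Ω) s).hom
        (HomogeneousLocalization.Away.mk (grading n Ω) hs d F.1 F.2)) =
      (Proj.awayToSection (grading n Ω) s').hom
        (HomogeneousLocalization.Away.mk (grading n Ω) hs' d (g F.1) (g.map_mem F.2)) := by
  subst h
  refine congr($(Proj.awayToSection_comp_appLE g hg hs).hom
    (HomogeneousLocalization.Away.mk (grading n Ω) hs d F.1 F.2)).trans ?_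
  exact congrArg (Proj.awayToSection (grading n Ω) (g s)).hom
    (HomogeneousLocalization.Away.map_mk g s hs d F.1 F.2)

lemma actHom_dehomogenize {Γ : Type*} [Group Γ] [MulSemiringAction Γ Ω] (j : Fin (n + 1)) (d : ℕ)
    (F : grading n Ω (d • 1)) (γ : Γ) : SchemeAction.actHom (stable_basicOpen_X n Γ j) γ
      (dehomogenize n j d F) = dehomogenize n j d ⟨MvPolynomial.map
        (MulSemiringAction.toRingHom Γ Ω γ) F.1, (coeffMap n _).map_mem F.2⟩ :=
  appLE_awayToSection n _ (MvPolynomial.map_X _ _) _ _ d F _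

/-- The standard open subsets of projective space are good: their rings of functions are spanned
by quotients of monomials. -/
lemma good_basicOpen_X (Γ : Type*) [Group Γ] [MulSemiringAction Γ Ω] (j : Fin (n + 1)) :
    (projAction (Ω := Ω) n Γ).Good (Proj.basicOpen (grading n Ω) (MvPolynomial.X j)) where
  affine := Proj.isAffineOpen_basicOpen _ _ (X_mem_grading n j) zero_lt_one
  stable := stable_basicOpen_X n Γ j
  split := by
    rw [IsSplit, eq_top_iff]
    intro s _
    obtain ⟨t, rfl⟩ : ∃ t, (Proj.awayToSection (grading n Ω) (MvPolynomial.X j)).hom t = s :=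
      (Proj.basicOpenIsoAway (grading n Ω) _ (X_mem_grading n j)
        zero_lt_one).commRingCatIsoToRingEquiv.surjective s
    obtain ⟨d, F, hF, rfl⟩ := HomogeneousLocalization.Away.mk_surjective _ (X_mem_grading n j) t
    let φ : grading n Ω (d • 1) →ₗ[Ω] Sect (projHom n Ω)
        (Proj.basicOpen (grading n Ω) (MvPolynomial.X j)) :=
      { toFun := dehomogenize n j d
        map_add' := dehomogenize_add n j d
        map_smul' := dehomogenize_smul n j d }
    change φ ⟨F, hF⟩ ∈ _
    -- `F` is a combination of monomials, which are fixed by the action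
    have h1 : (⟨F, hF⟩ : grading n Ω (d • 1)) = ∑ m : F.support, F.coeff m.1 •
        (⟨MvPolynomial.monomial m.1 1, monomial_mem_grading n hF m.2⟩ : grading n Ω (d • 1)) := by
      apply Subtype.ext
      rw [AddSubmonoidClass.coe_finsetSum]
      refine F.as_sum.trans ((Finset.sum_coe_sort _ _).symm.trans ?_)
      refine Finset.sum_congr rfl fun m _ => ?_
      rw [SetLike.val_smul, MvPolynomial.smul_monomial, smul_eq_mul, mul_one]
    rw [h1, map_sum]
    refine Submodule.sum_mem _ fun m _ => ?_
    rw [map_smul]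
    refine Submodule.smul_mem _ _ (Submodule.subset_span fun γ => ?_)
    refine (actHom_dehomogenize n j d _ γ).trans (congrArg (dehomogenize n j d) (Subtype.ext ?_))
    exact (MvPolynomial.map_monomial _ _ _).trans (by rw [map_one])

lemma iSup_basicOpen_X :
    ⨆ j, Proj.basicOpen (grading n Ω) (MvPolynomial.X j) = ⊤ := by
  refine Proj.iSup_basicOpen_eq_top' _ _ (fun j => ⟨1, X_mem_grading n j⟩) ?_
  rw [eq_top_iff]
  rintro F -
  induction F using MvPolynomial.induction_on with
  | C c => exact Subalgebra.algebraMap_mem _ (algebraMap Ω (grading n Ω 0) c)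
  | add F G hF hG => exact add_mem hF hG
  | mul_X F j hF => exact mul_mem hF (Algebra.subset_adjoin ⟨j, rfl⟩)

lemma exists_good_projAction (Γ : Type*) [Group Γ] [MulSemiringAction Γ Ω]
    (x : Proj (grading n Ω)) : ∃ U, (projAction (Ω := Ω) n Γ).Good U ∧ x ∈ U := by
  have hx : x ∈ ⨆ j, Proj.basicOpen (grading n Ω) (MvPolynomial.X j) := by
    rw [iSup_basicOpen_X]
    trivial
  obtain ⟨j, hj⟩ := TopologicalSpace.Opens.mem_iSup.mp hx
  exact ⟨_, good_basicOpen_X n Γ j, hj⟩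

instance : Algebra.FiniteType (grading n Ω 0) (MvPolynomial (Fin (n + 1)) Ω) := by
  have : IsScalarTower Ω (grading n Ω 0) (MvPolynomial (Fin (n + 1)) Ω) :=
    ⟨fun a b c => smul_mul_assoc a b.1 c⟩
  exact .of_restrictScalars_finiteType Ω _ _

instance : IsIso (CommRingCat.ofHom (algebraMap Ω (grading n Ω 0))) := by
  rw [ConcreteCategory.isIso_iff_bijective]
  refine ⟨fun a b h => MvPolynomial.C_injective _ _ (congrArg Subtype.val h), fun F => ?_⟩
  have h1 := (MvPolynomial.mem_homogeneousSubmodule _ _).mp F.2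
  refine ⟨F.1.coeff 0, Subtype.ext ?_⟩
  exact (MvPolynomial.totalDegree_eq_zero_iff_eq_C.mp
    (Nat.le_zero.mp h1.totalDegree_le)).symm

instance : IsNoetherian (Proj (grading n Ω)) := by
  have : CompactSpace (Proj (grading n Ω)) :=
    QuasiCompact.compactSpace_of_compactSpace (projHom n Ω)
  have := LocallyOfFiniteType.isLocallyNoetherian (projHom n Ω)
  constructor

end ProjectiveSpace

/-! ### Immersions and actions -/

section Immersion

variable {X Y Z : Scheme.{u}}

/-- A morphism from a reduced scheme factors through an immersion as soon as its image does. -/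
lemma exists_lift_of_isImmersion (i : X ⟶ Y) [IsImmersion i] (g : Z ⟶ Y) [IsReduced Z]
    (h : Set.range g ⊆ Set.range i) : ∃ g' : Z ⟶ X, g' ≫ i = g := by
  have hr : Set.range (pullback.snd i g) = Set.univ := by
    rw [Scheme.Pullback.range_snd]
    exact Set.eq_univ_of_forall fun z => h ⟨z, rfl⟩
  have : IsClosedImmersion (pullback.snd i g) :=
    .of_isPreimmersion _ (by rw [hr]; exact isClosed_univ)
  have : Surjective (pullback.snd i g) := ⟨Set.range_eq_univ.mp hr⟩
  have := isIso_of_isClosedImmersion_of_surjective (pullback.snd i g)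
  exact ⟨inv (pullback.snd i g) ≫ pullback.fst i g, by
    rw [Category.assoc, pullback.condition, IsIso.inv_hom_id_assoc]⟩

/-- The image of an immersion is the intersection of its closure with an open subset, the
coborder. -/
lemma mem_range_iff_of_isImmersion (i : X ⟶ Y) [IsImmersion i] (y : Y) :
    y ∈ Set.range i ↔ y ∈ i.coborderRange ∧ y ∈ closure (Set.range i) := by
  have h := congr(y ∈ $(coborder_inter_closure (s := Set.range i)))
  exact (Iff.of_eq h).symm

/-- The immersion is closed in the open subset `coborderRange`. -/
lemma isAffineOpen_preimage_of_isImmersion (i : X ⟶ Y) [IsImmersion i] {D : Y.Opens}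
    (hD : IsAffineOpen D) (hle : D ≤ i.coborderRange) : IsAffineOpen (i ⁻¹ᵁ D) := by
  have h1 := (hD.preimage_of_isOpenImmersion i.coborderRange.ι
    (by rwa [Scheme.Opens.opensRange_ι])).preimage i.liftCoborder
  rwa [← Scheme.Hom.comp_preimage, Scheme.Hom.liftCoborder_ι] at h1

lemma app_surjective_of_isImmersion (i : X ⟶ Y) [IsImmersion i] {D : Y.Opens}
    (hD : IsAffineOpen D) (hle : D ≤ i.coborderRange) : Function.Surjective (i.app D) := by
  have h1 := hD.preimage_of_isOpenImmersion i.coborderRange.ι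
    (by rwa [Scheme.Opens.opensRange_ι])
  have h2 := i.liftCoborder.app_surjective _ h1
  have h3 := i.coborderRange.ι.isIso_app D (by rwa [Scheme.Opens.opensRange_ι])
  have h4 : Function.Bijective (i.coborderRange.ι.app D) :=
    ConcreteCategory.bijective_of_isIso _
  have h5 (j : X ⟶ Y) (hj : j = i) (h : Function.Surjective (j.app D)) :
      Function.Surjective (i.app D) := by
    subst hj
    exact h
  refine h5 _ i.liftCoborder_ι ?_
  rw [Scheme.Hom.comp_app]
  exact h2.comp h4.surjective

variable {k Ω : Type u} [Field k] [Field Ω] [Algebra k Ω] {f : X ⟶ Spec (.of Ω)}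
  {g : Y ⟶ Spec (.of Ω)}

/-- An immersion of a reduced scheme into a Noetherian scheme with an action that is locally split:
its image is preserved by the automorphisms over some finitely generated field, and the action
induced on it is again locally split. -/
theorem exists_action_of_isImmersion [IsReduced X] [IsNoetherian Y] (i : X ⟶ Y) [IsImmersion i]
    (hi : i ≫ g = f) (c : SchemeAction Gal(Ω/k) g) (hc : ∀ y, ∃ U, c.Good U ∧ y ∈ U) :
    ∃ (L : IntermediateField k Ω) (_ : L.FG) (ρ : SchemeAction L.fixingSubgroup f),
      (∀ γ, ρ.hom γ ≫ i = i ≫ c.hom γ) ∧ ∀ x, ∃ U, ρ.Good U ∧ x ∈ U := by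
  have hcL (L : IntermediateField k Ω) (y) : ∃ U, (c.restrict L.fixingSubgroup).Good U ∧ y ∈ U := by
    obtain ⟨U, hU, hy⟩ := hc y
    exact ⟨U, hU.of_forall_exists fun γ => ⟨γ.1, rfl⟩, hy⟩
  -- the complement of the closure of the image and the coborder are defined over a finitely
  -- generated field `L`, hence the image is stable over `L`
  let O : Y.Opens := ⟨(closure (Set.range i))ᶜ, isClosed_closure.isOpen_compl⟩
  obtain ⟨L₁, hL₁, -, hO⟩ := exists_fg_stable (ρ := c) (L := ⊥) IntermediateField.fg_bot
    (hcL ⊥) (U := O) (TopologicalSpace.NoetherianSpace.isCompact _)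
  obtain ⟨L, hL, hLL, hW⟩ := exists_fg_stable (ρ := c) hL₁
    (hcL _) (U := i.coborderRange) (TopologicalSpace.NoetherianSpace.isCompact _)
  replace hO := hO.of_le hLL
  have hlift (γ : L.fixingSubgroup) : ∃ r : X ⟶ X, r ≫ i = i ≫ c.hom γ := by
    refine exists_lift_of_isImmersion i _ ?_
    rintro _ ⟨x, rfl⟩
    have hx := (mem_range_iff_of_isImmersion i (i x)).mp ⟨x, rfl⟩
    rw [mem_range_iff_of_isImmersion]
    constructor
    · have := hx.1
      rw [← hW γ] at this
      exact this
    · by_contra h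
      have h1 : i x ∈ c.hom γ ⁻¹ᵁ O := h
      have h2 := hO γ
      exact (h2.le h1) hx.2
  choose r hr using hlift
  let ρ : SchemeAction L.fixingSubgroup f :=
    { hom := r
      hom_one := by
        rw [← cancel_mono i, hr, Category.id_comp]
        exact (congrArg (i ≫ ·) c.hom_one).trans (Category.comp_id _)
      hom_comp := fun γ δ => by
        rw [← cancel_mono i, hr, Category.assoc, hr, reassoc_of% hr γ]
        exact congrArg (i ≫ ·) (c.hom_comp _ _)
      hom_over := fun γ => by
        rw [← hi, reassoc_of% hr γ, Category.assoc]
        exact congrArg (i ≫ ·) (c.hom_over _) }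
  refine ⟨L, hL, ρ, hr, fun x => ?_⟩
  obtain ⟨U, hU, hxU⟩ := hcL L (i x)
  have hxW : i x ∈ i.coborderRange := ((mem_range_iff_of_isImmersion i (i x)).mp ⟨x, rfl⟩).1
  -- a good neighbourhood of `i x` in which the image is closed; its functions map onto the
  -- functions on the inverse image
  obtain ⟨a, ha, hxa, hle⟩ := hU.exists_basicOpen_le hW hxU hxW
  have hD := hU.basicOpen ha
  generalize Y.basicOpen (U := U) a = D at hxa hle hD
  have hst : ρ.Stable (i ⁻¹ᵁ D) := fun γ => by
    rw [← Scheme.Hom.comp_preimage]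
    change (r γ ≫ i) ⁻¹ᵁ D = _
    rw [hr, Scheme.Hom.comp_preimage]
    exact congrArg (i ⁻¹ᵁ ·) (hD.stable γ)
  refine ⟨i ⁻¹ᵁ D, ⟨isAffineOpen_preimage_of_isImmersion i hD.affine hle, hst, ?_⟩, hxa⟩
  let φ : Sect g D →ₗ[Ω] Sect f (i ⁻¹ᵁ D) :=
    { toFun := (i.appLE D (i ⁻¹ᵁ D) le_rfl).hom
      map_add' := map_add _
      map_smul' := fun a s => by
        have h1 := sectHom_appLE (h := i) (f := g) (g := f) (φ := 𝟙 _)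
          (by rw [Spec.map_id, Category.comp_id, hi]) (le_refl (i ⁻¹ᵁ D))
        refine (congrArg (i.appLE D (i ⁻¹ᵁ D) le_rfl).hom (Algebra.smul_def a s)).trans ?_
        refine (map_mul (i.appLE D (i ⁻¹ᵁ D) le_rfl).hom _ _).trans ?_
        refine .trans ?_ (Algebra.smul_def a (A := Sect f (i ⁻¹ᵁ D)) _).symm
        exact congrArg (· * _) congr($(h1).hom a) }
  have hφ : Function.Surjective φ := by
    have := app_surjective_of_isImmersion i hD.affine hle
    rwa [Scheme.Hom.app_eq_appLE] at this
  refine hD.split.of_surjective φ hφ fun γ s => ?_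
  have h1 : (c.hom γ).appLE D D (hD.stable γ).ge ≫ i.appLE D (i ⁻¹ᵁ D) le_rfl =
      i.appLE D (i ⁻¹ᵁ D) le_rfl ≫ (r γ).appLE (i ⁻¹ᵁ D) (i ⁻¹ᵁ D) (hst γ).ge := by
    refine (Scheme.Hom.appLE_comp_appLE i (c.hom γ) _ _ _ _ _).trans <|
      .trans ?_ (Scheme.Hom.appLE_comp_appLE (r γ) i _ _ _ _ _).symm
    congr 1
    exact (hr γ).symm
  exact congr($(h1).hom s)

end Immersion

/-! ### Affine neighbourhoods of finite sets in projective schemes -/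

section FiniteSets

variable {A : Type u} [CommRing A] {σ : Type*} [SetLike σ A] [AddSubgroupClass σ A] (𝒜 : ℕ → σ)
  [GradedRing 𝒜]

/-- The complements of the zero sets of homogeneous elements of positive degree form a basis. -/
lemma exists_basicOpen_le_of_mem {x : Proj 𝒜} {W : (Proj 𝒜).Opens} (hx : x ∈ W) :
    ∃ (m : ℕ) (_ : 0 < m) (F : A) (_ : F ∈ 𝒜 m), x ∈ Proj.basicOpen 𝒜 F ∧
      Proj.basicOpen 𝒜 F ≤ W := by
  classical
  obtain ⟨_, ⟨a, rfl⟩, hxa, ha⟩ :=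
    TopologicalSpace.Opens.isBasis_iff_nbhd.mp (Proj.isBasis_basicOpen 𝒜) hx
  rw [Proj.basicOpen_eq_iSup_proj] at hxa ha
  obtain ⟨i, hi⟩ := TopologicalSpace.Opens.mem_iSup.mp hxa
  obtain ⟨j, hj, G, hG, hxG⟩ : ∃ j, ∃ (_ : 0 < j), ∃ G ∈ 𝒜 j, x ∈ Proj.basicOpen 𝒜 G := by
    by_contra! h
    refine x.not_irrelevant_le ?_
    refine (HomogeneousIdeal.toIdeal_irrelevant_le (𝒜 := 𝒜) (I := x.asHomogeneousIdeal.toIdeal)).mpr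
      fun j hj G hG => ?_
    have := h j hj G hG
    rw [Proj.mem_basicOpen, not_not] at this
    exact this
  refine ⟨i + j, by omega, GradedRing.proj 𝒜 i a * G,
    SetLike.mul_mem_graded (SetLike.coe_mem _) hG, ?_⟩
  rw [Proj.basicOpen_mul]
  exact ⟨⟨hi, hxG⟩, inf_le_left.trans ((le_iSup _ i).trans ha)⟩

/-- Homogeneous prime avoidance for closed points: a finite set of closed points in an open set `W`
is contained in the complement of the zero set of a homogeneous element which lies in `W`. -/
theorem exists_basicOpen_le_of_finite {T : Set (Proj 𝒜)} (hT : T.Finite)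
    (hTc : ∀ x ∈ T, IsClosed {x}) {W : (Proj 𝒜).Opens} (hTW : T ⊆ W) :
    ∃ (m : ℕ) (_ : 0 < m) (F : A) (_ : F ∈ 𝒜 m), T ⊆ Proj.basicOpen 𝒜 F ∧
      Proj.basicOpen 𝒜 F ≤ W := by
  induction T, hT using Set.Finite.induction_on with
  | empty => exact ⟨1, one_pos, 0, zero_mem _, Set.empty_subset _, by simp⟩
  | @insert s T hs hT ih =>
    obtain ⟨m, hm, F, hF, hTF, hFW⟩ := ih (fun x hx => hTc x (.inr hx))
      ((Set.subset_insert _ _).trans hTW)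
    by_cases hsF : s ∈ Proj.basicOpen 𝒜 F
    · exact ⟨m, hm, F, hF, Set.insert_subset hsF hTF, hFW⟩
    have hTcl : IsClosed T := by
      rw [← Set.biUnion_of_singleton T]
      exact hT.isClosed_biUnion fun x hx => hTc x (.inr hx)
    obtain ⟨l, hl, G, hG, hsG, hGW⟩ := exists_basicOpen_le_of_mem 𝒜
      (W := W ⊓ ⟨Tᶜ, hTcl.isOpen_compl⟩) ⟨hTW (.inl rfl), hs⟩
    -- `F` vanishes at `s` but not on `T`, and `G` on `T` but not at `s`; the powers make the
    -- degrees equal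
    refine ⟨l * m, Nat.mul_pos hl hm, F ^ l + G ^ m, add_mem ?_ ?_, ?_, ?_⟩
    · exact SetLike.pow_mem_graded l hF
    · rw [mul_comm]
      exact SetLike.pow_mem_graded m hG
    · rintro x (rfl | hx)
      · intro h
        rw [Proj.mem_basicOpen, not_not] at hsF
        have h1 := (Ideal.add_mem_iff_right _ (Ideal.pow_mem_of_mem _ hsF l hl)).mp h
        exact hsG (x.isPrime.mem_of_pow_mem _ h1)
      · intro h
        have hxG : G ∈ x.asHomogeneousIdeal.toIdeal := by
          by_contra hxG
          exact (hGW hxG).2 hx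
        have h1 := (Ideal.add_mem_iff_left _ (Ideal.pow_mem_of_mem _ hxG m hm)).mp h
        exact hTF hx (x.isPrime.mem_of_pow_mem _ h1)
    · intro x hx
      by_cases hxF : x ∈ Proj.basicOpen 𝒜 F
      · exact hFW hxF
      refine (hGW (x := x) fun hxG => hx ?_).1
      rw [Proj.mem_basicOpen, not_not] at hxF
      exact Ideal.add_mem _ (Ideal.pow_mem_of_mem _ hxF l hl) (Ideal.pow_mem_of_mem _ hxG m hm)

end FiniteSets

lemma SchemePt.isClosed_pos {Ω : Type u} [Field Ω] {X : Scheme.{u}} {f : X ⟶ Spec (.of Ω)}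
    (z : SchemePt f) : IsClosed {z.pos} := by
  have h2 := isClosedImmersion_of_comp_eq_id _ _ z.2
  have h3 : Set.range z.1 = {z.pos} := by
    rw [Set.range_eq_singleton_iff]
    intro y
    rw [Subsingleton.elim y (specPt Ω)]
    rfl
  rw [← h3]
  exact z.1.isClosedEmbedding.isClosed_range

/-- The image of a rational point. -/
def SchemePt.map {Ω : Type u} [Field Ω] {X Y : Scheme.{u}} {f : X ⟶ Spec (.of Ω)}
    {g : Y ⟶ Spec (.of Ω)} (i : X ⟶ Y) (hi : i ≫ g = f) (z : SchemePt f) : SchemePt g :=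
  ⟨z.1 ≫ i, by rw [Category.assoc, hi, z.2]⟩

attribute [local instance] MvPolynomial.gradedAlgebra in
/-- Every finite set of rational points of a quasi-projective scheme is contained in an affine open
subset. -/
theorem exists_isAffineOpen_of_isImmersion {Ω : Type u} [Field Ω] {X : Scheme.{u}}
    {f : X ⟶ Spec (.of Ω)} {n : ℕ} (i : X ⟶ Proj (grading n Ω)) [IsImmersion i]
    (hi : i ≫ projHom n Ω = f) {T : Set (SchemePt f)} (hT : T.Finite) :
    ∃ U : X.Opens, IsAffineOpen U ∧ ∀ z ∈ T, z.pos ∈ U := by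
  obtain ⟨m, hm, F, hF, hTF, hFW⟩ := exists_basicOpen_le_of_finite (grading n Ω)
    (hT.image fun z => i z.pos) (W := i.coborderRange) (by
      rintro _ ⟨z, -, rfl⟩
      exact (z.map i hi).isClosed_pos) (by
      rintro _ ⟨z, -, rfl⟩
      exact ((mem_range_iff_of_isImmersion i _).mp ⟨_, rfl⟩).1)
  exact ⟨i ⁻¹ᵁ Proj.basicOpen (grading n Ω) F, isAffineOpen_preimage_of_isImmersion i
    (Proj.isAffineOpen_basicOpen _ _ hF hm) hFW, fun z hz => hTF ⟨z, hz, rfl⟩⟩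

/-! ### Rigid actions -/

section Rigidity

variable {k Ω : Type u} [Field k] [Field Ω] [Algebra k Ω]

/-- A rational point is fixed by the automorphisms over some finitely generated field: its
complement is an open subset, and a rational point is determined by its position. -/
lemma exists_fg_smulPt_eq [IsAlgClosed Ω] {Y : Scheme.{u}} {g : Y ⟶ Spec (.of Ω)}
    [LocallyOfFiniteType g] [IsNoetherian Y] (c : SchemeAction Gal(Ω/k) g)
    (hc : ∀ y, ∃ U, c.Good U ∧ y ∈ U) (z : SchemePt g) :
    ∃ L : IntermediateField k Ω, L.FG ∧ ∀ γ ∈ L.fixingSubgroup, c.smulPt γ z = z := by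
  obtain ⟨L, hL, -, hO⟩ := exists_fg_stable (ρ := c) (L := ⊥) IntermediateField.fg_bot
    (fun y => by
      obtain ⟨U, hU, hy⟩ := hc y
      exact ⟨U, hU.of_forall_exists fun γ => ⟨γ.1, rfl⟩, hy⟩)
    (U := ⟨{z.pos}ᶜ, z.isClosed_pos.isOpen_compl⟩) (TopologicalSpace.NoetherianSpace.isCompact _)
  refine ⟨L, hL, fun γ hγ => Subtype.ext (ext_of_apply_closedPoint_eq g (c.smulPt γ z).2 z.2 ?_)⟩
  change (c.smulPt γ z).pos = z.pos
  by_contra h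
  have h1 := (hO ⟨γ, hγ⟩).ge h
  exact h1 (c.pos_smulPt γ z)

lemma exists_fg_forall_smulPt_eq [IsAlgClosed Ω] {Y : Scheme.{u}} {g : Y ⟶ Spec (.of Ω)}
    [LocallyOfFiniteType g] [IsNoetherian Y] (c : SchemeAction Gal(Ω/k) g)
    (hc : ∀ y, ∃ U, c.Good U ∧ y ∈ U) {T : Set (SchemePt g)} (hT : T.Finite) :
    ∃ L : IntermediateField k Ω, L.FG ∧ ∀ γ ∈ L.fixingSubgroup, ∀ z ∈ T, c.smulPt γ z = z := by
  induction T, hT using Set.Finite.induction_on with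
  | empty => exact ⟨⊥, IntermediateField.fg_bot, fun _ _ _ h => h.elim⟩
  | @insert s T hs hT ih =>
    obtain ⟨L, hL, h⟩ := ih
    obtain ⟨L', hL', h'⟩ := exists_fg_smulPt_eq c hc s
    refine ⟨L ⊔ L', IntermediateField.fg_sup hL hL', ?_⟩
    rintro γ hγ z (rfl | hz)
    · exact h' γ (IntermediateField.fixingSubgroup_le le_sup_right hγ)
    · exact h γ (IntermediateField.fixingSubgroup_le le_sup_left hγ) z hz

/-- The automorphism of a variety by which two automorphisms over the same automorphism of the
base field differ. -/
def actionDiff {V : Variety Ω} {Γ Γ' : Type*} [Group Γ] [MulSemiringAction Γ Ω] [Group Γ']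
    [MulSemiringAction Γ' Ω] (ρ : SchemeAction Γ V.obj.hom) (ρ' : SchemeAction Γ' V.obj.hom)
    (γ : Γ) (γ' : Γ') (h : specAct Ω γ = specAct Ω γ') : V ≅ V where
  hom := ObjectProperty.homMk (Over.homMk (ρ.hom γ ≫ ρ'.hom γ'⁻¹) (by
    rw [Category.assoc, ρ'.hom_over, reassoc_of% ρ.hom_over γ, h, specAct_comp, mul_inv_cancel,
      specAct_one, Category.comp_id]))
  inv := ObjectProperty.homMk (Over.homMk (ρ'.hom γ' ≫ ρ.hom γ⁻¹) (by
    rw [Category.assoc, ρ.hom_over, reassoc_of% ρ'.hom_over γ', ← h, specAct_comp, mul_inv_cancel,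
      specAct_one, Category.comp_id]))
  hom_inv_id := by
    apply Variety.hom_ext
    change (ρ.hom γ ≫ ρ'.hom γ'⁻¹) ≫ ρ'.hom γ' ≫ ρ.hom γ⁻¹ = 𝟙 _
    rw [Category.assoc, ← Category.assoc (ρ'.hom γ'⁻¹), ρ'.hom_comp, inv_mul_cancel, ρ'.hom_one,
      Category.id_comp, ρ.hom_comp, mul_inv_cancel, ρ.hom_one]
  inv_hom_id := by
    apply Variety.hom_ext
    change (ρ'.hom γ' ≫ ρ.hom γ⁻¹) ≫ ρ.hom γ ≫ ρ'.hom γ'⁻¹ = 𝟙 _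
    rw [Category.assoc, ← Category.assoc (ρ.hom γ⁻¹), ρ.hom_comp, inv_mul_cancel, ρ.hom_one,
      Category.id_comp, ρ'.hom_comp, mul_inv_cancel, ρ'.hom_one]

attribute [local instance] MvPolynomial.gradedAlgebra in
lemma IsQuasiProjective.exists_immersion {V : Variety Ω} (hV : IsQuasiProjective V) :
    ∃ (n : ℕ) (i : V.obj.left ⟶ Proj (grading n Ω)), IsImmersion i ∧
      i ≫ projHom n Ω = V.obj.hom := by
  obtain ⟨n, i, hi⟩ := hV
  exact ⟨n, i.left, hi, Over.w i⟩

attribute [local instance] MvPolynomial.gradedAlgebra in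
lemma IsQuasiProjective.isSeparated {V : Variety Ω} (hV : IsQuasiProjective V) :
    IsSeparated V.obj.hom := by
  obtain ⟨n, i, hi, hiw⟩ := hV.exists_immersion
  rw [← hiw]
  infer_instance

attribute [local instance] MvPolynomial.gradedAlgebra in
/-- A rigid action on a quasi-projective variety is locally split over a finitely generated
field: there it agrees with the action through the coordinates of the ambient projective space,
since both fix enough points. -/
theorem exists_good_cover_of_rigid [IsAlgClosed Ω] {V : Variety Ω} (hV : IsQuasiProjective V)
    (ρ : SchemeAction Gal(Ω/k) V.obj.hom) {T : Set (SchemePt V.obj.hom)} (hT : T.Finite)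
    (hrigid : ∀ φ : V ≅ V, (∀ z ∈ T, z.1 ≫ φ.hom.hom.left = z.1) → φ = Iso.refl V)
    {L : IntermediateField k Ω} (hL : L.FG)
    (hfix : ∀ z ∈ T, ∀ γ ∈ L.fixingSubgroup, ρ.smulPt γ z = z) :
    ∃ L' : IntermediateField k Ω, L'.FG ∧
      ∀ x, ∃ U, (ρ.restrict L'.fixingSubgroup).Good U ∧ x ∈ U := by
  obtain ⟨n, i, hi, hiw⟩ := hV.exists_immersion
  have := V.isReduced
  obtain ⟨L₁, hL₁, ρ₁, hρ₁, hcov⟩ := exists_action_of_isImmersion i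
    hiw (projAction n Gal(Ω/k)) (exists_good_projAction n _)
  obtain ⟨L₂, hL₂, hL₂T⟩ := exists_fg_forall_smulPt_eq (projAction n Gal(Ω/k))
    (exists_good_projAction n _) (hT.image (SchemePt.map i hiw))
  refine ⟨L ⊔ (L₁ ⊔ L₂), IntermediateField.fg_sup hL (IntermediateField.fg_sup hL₁ hL₂),
    fun x => ?_⟩
  obtain ⟨U, hU, hx⟩ := hcov x
  refine ⟨U, hU.of_forall_exists fun γ => ?_, hx⟩
  have hγL := IntermediateField.fixingSubgroup_le le_sup_left γ.2
  have hγ₁ := IntermediateField.fixingSubgroup_le (le_sup_left.trans le_sup_right) γ.2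
  have hγ₂ := IntermediateField.fixingSubgroup_le (le_sup_right.trans le_sup_right) γ.2
  refine ⟨⟨γ.1, hγ₁⟩, ?_⟩
  -- both actions fix the points in `T`, so the automorphism by which they differ is the identity
  have h1 := hrigid (actionDiff ρ₁ ρ ⟨γ.1, hγ₁⟩ γ.1 rfl) fun z hz => ?_
  · have h2 : ρ₁.hom ⟨γ.1, hγ₁⟩ ≫ ρ.hom γ.1⁻¹ = 𝟙 _ := congr(($h1).hom.hom.left)
    have h3 := congr($h2 ≫ ρ.hom γ.1)
    rw [Category.assoc, ρ.hom_comp, inv_mul_cancel, ρ.hom_one, Category.comp_id,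
      Category.id_comp] at h3
    exact h3.symm
  -- the action `ρ₁` is the restriction of the action on projective space, which fixes `i z`
  · have h2 : ρ₁.smulPt ⟨γ.1, hγ₁⟩ z = z := by
      have h3 := congrArg Subtype.val (hL₂T γ.1 hγ₂ _ ⟨z, hz, rfl⟩)
      apply Subtype.ext
      rw [← cancel_mono i]
      refine .trans ?_ h3
      change (specAct Ω γ.1 ≫ z.1 ≫ ρ₁.hom ⟨γ.1, hγ₁⟩⁻¹) ≫ i =
        specAct Ω γ.1 ≫ (z.1 ≫ i) ≫ (projAction n Gal(Ω/k)).hom γ.1⁻¹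
      rw [Category.assoc, Category.assoc, Category.assoc]
      exact congrArg (fun t => specAct Ω γ.1 ≫ z.1 ≫ t) (hρ₁ ⟨γ.1, hγ₁⟩⁻¹)
    have h3 := ρ₁.smulPt_comp ⟨γ.1, hγ₁⟩ z
    rw [h2] at h3
    change z.1 ≫ ρ₁.hom ⟨γ.1, hγ₁⟩ ≫ ρ.hom γ.1⁻¹ = z.1
    rw [reassoc_of% h3]
    exact congrArg Subtype.val (hfix z hz _ hγL)

end Rigidity

/-! ### Models over the ground field -/

section Models

variable {E Ω : Type u} [Field E] [Field Ω] [Algebra E Ω] {X X₀ : Scheme.{u}}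
  {f : X ⟶ Spec (.of Ω)} {f₀ : X₀ ⟶ Spec (.of E)} {p : X ⟶ X₀}

/-- Geometric reducedness descends along an extension of fields: over a common extension of `Ω` and
of a given extension of `E`, both sides have the same base change. -/
lemma geometricallyReduced_of_isPullback (hp : IsPullback p f f₀ (specAlg E Ω))
    [GeometricallyReduced f] : GeometricallyReduced f₀ := by
  constructor
  intro K _ y Z fst snd h
  have : Surjective (specAlg E Ω) := inferInstance
  -- the residue field `F` of a point of `Spec (K ⊗ Ω)` is a common extension of `K` and `Ω`
  obtain ⟨x, -⟩ := (pullback.fst y (specAlg E Ω)).surjective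
    (IsLocalRing.closedPoint K : Spec (.of K))
  let F := (pullback y (specAlg E Ω)).residueField x
  let b : Spec F ⟶ Spec (.of K) := (pullback y (specAlg E Ω)).fromSpecResidueField x ≫
    pullback.fst _ _
  let a : Spec F ⟶ Spec (.of Ω) := (pullback y (specAlg E Ω)).fromSpecResidueField x ≫
    pullback.snd _ _
  have hab : b ≫ y = a ≫ specAlg E Ω := by
    rw [Category.assoc, Category.assoc, pullback.condition]
  have h1 : IsPullback (pullback.fst snd b ≫ fst) (pullback.snd snd b) f₀ (b ≫ y) :=
    (IsPullback.of_hasPullback snd b).paste_horiz h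
  rw [hab] at h1
  have h2 := h1.of_right' hp
  have : IsReduced (pullback snd b) :=
    GeometricallyReduced.geometrically_isReduced a _ _ h2
  -- the base change to `F` is reduced, and it dominates the base change to `K`, since fields are
  -- flat over fields
  have : Surjective b :=
    ⟨fun _ => ⟨IsLocalRing.closedPoint F, Subsingleton.elim (α := PrimeSpectrum K) _ _⟩⟩
  have := IsSchemeTheoreticallyDominant.of_isDominant b
  exact IsSchemeTheoreticallyDominant.isReduced (pullback.fst snd b)

/-- The variety over `E` defined by a model of a variety over `Ω`. -/
def descendedVariety {V : Variety Ω} {p : V.obj.left ⟶ X₀}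
    (hp : IsPullback p V.obj.hom f₀ (specAlg E Ω)) : Variety E where
  obj := Over.mk f₀
  property := by
    have := V.locallyOfFiniteType
    have := V.quasiCompact
    have : GeometricallyReduced V.obj.hom := V.property.1.1
    exact ⟨⟨geometricallyReduced_of_isPullback hp, locallyOfFiniteType_of_isPullback hp⟩,
      quasiCompact_of_isPullback hp⟩

/-- A variety over `Ω` is the extension of scalars of its model over `E`. -/
def descendedIso {V : Variety Ω} {p : V.obj.left ⟶ X₀}
    (hp : IsPullback p V.obj.hom f₀ (specAlg E Ω)) :
    V ≅ baseChange Ω (descendedVariety hp) where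
  hom := ObjectProperty.homMk (Over.homMk hp.isoPullback.hom hp.isoPullback_hom_snd)
  inv := ObjectProperty.homMk (Over.homMk hp.isoPullback.inv hp.isoPullback_inv_snd)
  hom_inv_id := Variety.hom_ext hp.isoPullback.hom_inv_id
  inv_hom_id := Variety.hom_ext hp.isoPullback.inv_hom_id

/-- Solutions can be transported along isomorphisms of varieties. -/
lemma ModuliProblem.IsSolution.of_iso {M : ModuliProblem.{u, w} Ω} {V W : Variety Ω}
    {α : M.Classes ≃ Pts V} {β : M.Classes ≃ Pts W} (hα : M.IsSolution V α) (e : V ≅ W)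
    (hβ : ∀ c, β c = α c ≫ e.hom) : M.IsSolution W β where
  regular T m := by
    obtain ⟨h, hh⟩ := hα.regular T m
    exact ⟨h ≫ e.hom, fun t => (hβ _).trans (by
      rw [← Category.assoc, ← hh])⟩
  universal U γ hγ := by
    obtain ⟨h, hh⟩ := hα.universal U γ hγ
    refine ⟨e.inv ≫ h, fun P => ?_⟩
    have h1 : γ (α.symm (α (β.symm P))) = _ := hh (α (β.symm P))
    rw [Equiv.symm_apply_apply] at h1
    have h2 := hβ (β.symm P)
    rw [Equiv.apply_symm_apply] at h2
    refine h1.trans ?_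
    conv_rhs => rw [h2, Category.assoc, Iso.hom_inv_id_assoc]

end Models

end Descent

end

theorem theorem1p4 {k Ω : Type u} [Field k] [Field Ω] [Algebra k Ω]
    [IsAlgClosed Ω] [CharZero Ω] (htr : Cardinal.aleph0 ≤ Algebra.trdeg k Ω)
    (M : RationalModuliProblem.{u, w} k Ω)
    (V : Variety Ω) (α : M.Classes ≃ Pts V) (hV : IsQuasiProjective V)
    (hα : M.IsSolution V α)
    (S : Set (M.fam.obj (op (pt Ω)))) (hS : S.Finite)
    (hrigid : ∀ φ : V ≅ V,
      (∀ P ∈ S, α (Quotient.mk (M.rel (pt Ω)) P) ≫ φ.hom = α (Quotient.mk (M.rel (pt Ω)) P)) →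
        φ = Iso.refl V)
    (hfix : ∃ L : IntermediateField k Ω, L.FG ∧
      ∀ P ∈ S, ∀ σ : Gal(Ω/k), (∀ x ∈ L, σ x = x) → M.rel (pt Ω) (M.act σ P) P) :
    ∃ (V₀ : Variety k) (α₀ : M.Classes ≃ PtsIn V₀ Ω), M.IsSolutionOver V₀ α₀ := by
  have := hV.isSeparated
  obtain ⟨ρ, hρ⟩ := M.exists_action hα
  let z (P : M.fam.obj (op (pt Ω))) : SchemePt V.obj.hom :=
    ⟨sch (α (Quotient.mk (M.rel (pt Ω)) P)), sch_comp _⟩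
  obtain ⟨L₀, hL₀, hfix⟩ := hfix
  obtain ⟨L, hL, hcov⟩ := exists_good_cover_of_rigid hV ρ (hS.image z)
    (fun φ hφ => hrigid φ fun P hP => Variety.hom_ext (hφ _ ⟨P, hP, rfl⟩)) hL₀ (by
      rintro _ ⟨P, hP, rfl⟩ γ hγ
      -- the points of `S` are fixed over `L₀`
      have h1 : M.actClass γ (Quotient.mk (M.rel (pt Ω)) P) = Quotient.mk (M.rel (pt Ω)) P :=
        Quotient.sound (hfix P hP γ fun x hx => hγ ⟨x, hx⟩)
      have h2 := hρ γ (Quotient.mk (M.rel (pt Ω)) P)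
      rw [h1] at h2
      exact Subtype.ext h2.symm)
  obtain ⟨n, i, hi, hiw⟩ := hV.exists_immersion
  have := V.locallyOfFiniteType
  have := V.quasiCompact
  -- the action is locally split over `k`, hence `V` descends
  have hgood := exists_good_cover ρ htr hL hcov
    fun T hT => exists_isAffineOpen_of_isImmersion i hiw hT
  obtain ⟨X₀, f₀, p, hp, hρp⟩ := ρ.exists_quotient (E := k) (fun c γ => γ.commutes c)
    (fun c hc => mem_range_algebraMap_of_forall_gal htr hc) hgood
  let β : M.Classes ≃ Pts (baseChange Ω (descendedVariety hp)) :=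
    α.trans ((descendedIso hp).homToEquiv)
  refine ⟨descendedVariety hp, β.trans (ptsBaseChange _).symm, ?_, fun σ m => ?_⟩
  · refine hα.of_iso (descendedIso hp) fun c => ?_
    exact (ptsBaseChange (descendedVariety hp)).apply_symm_apply (β c)
  · have hβ (c) : ((ptsBaseChange _).symm (β c)).left = sch (α c) ≫ p :=
      (Category.assoc _ _ _).trans (congrArg (sch (α c) ≫ ·) hp.isoPullback_hom_fst)
    ext1
    refine (hβ _).trans ?_
    refine (congrArg (· ≫ p) (hρ σ (Quotient.mk (M.rel (pt Ω)) m))).trans ?_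
    refine .trans ?_ (congrArg (specAut σ ≫ ·) (hβ (Quotient.mk (M.rel (pt Ω)) m))).symm
    rw [Category.assoc, Category.assoc, hρp]
    rfl
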